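/- Let $\Theta_4$ be the graph with two vertices $v_1,v_2$, four edges $e_1,\dots,e_4$ and no self-loops, and let $h_{i,j}$ be the half-edge of $e_j$ at $v_i$. Let $B_3(\Theta_4)$ be the space of unordered configurations of three distinct points in $\Theta_4$. Let $S(v_i)$ be the free abelian group on $\varnothing, v_i, h_{i,1},\dots,h_{i,4}$. The Świątkowski complex is $S(\Theta_4)=\mathbb Z[e_1,\dots,e_4]\otimes S(v_1)\otimes S(v_2)$ with the $\mathbb Z[e_1,\dots,e_4]$-linear differential determined (with the Koszul sign rule) by $\partial h_{i,j}=e_j-v_i$ and $\partial\varnothing=\partial v_i=0$; here $\varnothing$ has degree $0$ and weight $0$, $v_i$ and $e_j$ have degree $0$ and weight $1$, and $h_{i,j}$ has degree $1$ and weight $1$, and factors $\varnothing$ and tensor signs are omitted. The reduced Świątkowski complex $\widetilde S(\Theta_4)\subseteq S(\Theta_4)$ is the subcomplex obtained by replacing each $S(v_i)$ by its subgroup $\widetilde S(v_i)$ spanned by $\varnothing$ and the differences $h_{i,j}-h_{i,k}$. The homology of either complex in degree $n$ and weight $3$ is identified with the integral singular homology $H_n(B_3(\Theta_4))$ by realizing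 the generators of $S(\Theta_4)$ of degree $n$ and weight $3$ as $n$-dimensional cubes of configurations, in which each half-edge factor $h_{i,j}$ describes a point moving from $v_i$ into $e_j$, each factor $v_i$ a point at $v_i$, and each factor $e_j$ a point in the interior of $e_j$. Then the chain $$A_2=\sum_{\sigma\in\Sigma_4}\operatorname{sgn}(\sigma)\,(e_1-e_{\sigma(3)})\,(h_{1,\sigma(1)}-h_{1,1})\,(h_{2,\sigma(2)}-h_{2,1}),$$ which is an element of $\widetilde S(\Theta_4)$ of degree $2$ and weight $3$, is a cycle. Its class generates the homology of $\widetilde S(\Theta_4)$ in degree $2$ and weight $3$, and the corresponding class $[A_2]$ generates $H_2(B_3(\Theta_4))$. -/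

import Mathlib

open CategoryTheory AlgebraicTopology

noncomputable section

set_option linter.unusedSectionVars false
set_option linter.unnecessarySeqFocus false

/-- A (finite) graph, presented by its attaching maps: the edge `e` has the two half-edges
`(e, 0)` and `(e, 1)`, and `vert (e, i)` is the vertex at which the half-edge `(e, i)` is
attached.  Multiple edges and self-loops are allowed. -/
structure MultiGraph (V E : Type) where
  vert : E × Fin 2 → V

namespace MultiGraph

/-- The theta graph: two vertices `0, 1`, `n` edges, and no self-loops.  The half-edge of the edge
`j` at the vertex `i` is `(j, i)`. -/
def theta (n : ℕ) : MultiGraph (Fin 2) (Fin n) where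
  vert h := h.2

section Topology

variable {V E : Type} (Γ : MultiGraph V E)

/-- The attaching relation on the disjoint union of the `0`-cells (the vertices) and the closed
`1`-cells (one unit interval for each edge). -/
inductive Attach : (Σ _ : V, Unit) ⊕ (Σ _ : E, unitInterval) →
    (Σ _ : V, Unit) ⊕ (Σ _ : E, unitInterval) → Prop
  | left (e : E) : Attach (Sum.inr ⟨e, 0⟩) (Sum.inl ⟨Γ.vert (e, 0), ()⟩)
  | right (e : E) : Attach (Sum.inr ⟨e, 1⟩) (Sum.inl ⟨Γ.vert (e, 1), ()⟩)

/-- The underlying space of the graph, a CW complex of dimension at most one, with the quotient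
topology. -/
def Space : Type := Quot Γ.Attach

instance : TopologicalSpace Γ.Space :=
  inferInstanceAs (TopologicalSpace (Quot Γ.Attach))

/-- The point of the space of the graph given by a vertex. -/
def vertexPt (v : V) : Γ.Space := Quot.mk _ (Sum.inl ⟨v, ()⟩)

/-- The point of the space of the graph with coordinate `x` in the closed edge `e`. -/
def edgePt (e : E) (x : unitInterval) : Γ.Space := Quot.mk _ (Sum.inr ⟨e, x⟩)

end Topology

end MultiGraph

/-- The ordered configuration space of `k` distinct points in `X`. -/
abbrev OrderedConf (k : ℕ) (X : Type) : Type := {x : Fin k → X // Function.Injective x}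

/-- Two ordered configurations are equivalent if they differ by a permutation of the labels. -/
instance OrderedConf.setoid (k : ℕ) (X : Type) : Setoid (OrderedConf k X) where
  r x y := ∃ π : Equiv.Perm (Fin k), ∀ i, y.1 i = x.1 (π i)
  iseqv :=
    { refl := fun x => ⟨1, fun i => rfl⟩
      symm := by
        rintro x y ⟨π, h⟩
        exact ⟨π⁻¹, fun i => by simp [h]⟩
      trans := by
        rintro x y z ⟨π, h⟩ ⟨ρ, h'⟩
        exact ⟨π * ρ, fun i => by simp [h, h']⟩ }

/-- The unordered configuration space `B_k(X)`: the quotient of the ordered configuration space by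
the symmetric group, with the quotient topology. -/
abbrev UnorderedConf (k : ℕ) (X : Type) : Type := Quotient (OrderedConf.setoid k X)

/-- The singular chain complex of a topological space with integer coefficients. -/
def singularChains (X : Type) [TopologicalSpace X] : ChainComplex (ModuleCat.{0} ℤ) ℕ :=
  (TopCat.toSSet.obj (TopCat.of X)).chainComplex (ModuleCat.of ℤ ℤ)

/-- Singular homology with integer coefficients. -/
abbrev singularHomology (n : ℕ) (X : Type) [TopologicalSpace X] : ModuleCat.{0} ℤ :=
  (singularChains X).homology n

/-- The singular chain given by a single singular simplex. -/
def singularSimplex {X : Type} [TopologicalSpace X] {n : ℕ}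
    (f : C(stdSimplex ℝ (Fin (n + 1)), X)) : (singularChains X).X n :=
  (TopCat.toSSet.obj (TopCat.of X)).ιChainComplex (R := ModuleCat.of ℤ ℤ)
    (((TopCat.of X).toSSetObjEquiv (Opposite.op (SimplexCategory.mk n))).symm f) (1 : ℤ)

namespace MultiGraph

section Complex

variable {V E : Type} (Γ : MultiGraph V E)

/-- The set `H(v)` of half-edges at `v`. -/
abbrev HalfEdgeAt (v : V) : Type := {h : E × Fin 2 // Γ.vert h = v}

/-- The basis of `S(v)`: the empty state `∅` (encoded as `none`), the state `v` (encoded as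
`some none`), and the half-edges `h` at `v` (encoded as `some (some h)`). -/
abbrev LocalState (v : V) : Type := Option (Option (Γ.HalfEdgeAt v))

/-- `S(v) = ℤ⟨∅, v, h ∈ H(v)⟩`. -/
abbrev LocalModule (v : V) : Type := Γ.LocalState v →₀ ℤ

/-- A choice of a basis element of `S(v)` at each vertex `v`; these form a basis of the tensor
product of all the `S(v)`. -/
abbrev State : Type := (v : V) → Γ.LocalState v

/-- The underlying `ℤ[E]`-module `ℤ[E] ⊗ ⨂_v S(v)` of the Świątkowski complex, in its standard
basis: it is the free `ℤ[E]`-module on the states. -/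
abbrev SwiatkowskiModule : Type := Γ.State →₀ MvPolynomial E ℤ

variable {Γ} in
/-- The half-edge `h` at `v`, as an element of `S(v)`. -/
def HalfEdgeAt.toLocal {v : V} (h : Γ.HalfEdgeAt v) : Γ.LocalModule v :=
  Finsupp.single (some (some h)) 1

variable [Fintype V] [LinearOrder V] [Fintype E] [DecidableEq E]

/-- The pure tensor `⨂_v x_v`, the tensor factors being taken in the order of the vertices. -/
def pureTensor (x : (v : V) → Γ.LocalModule v) : Γ.SwiatkowskiModule :=
  Finsupp.equivFunOnFinite.symm fun s => MvPolynomial.C (∏ v, x v (s v))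

variable {Γ}

/-- The vertices at which a state is a half-edge. -/
def State.active (s : Γ.State) : Finset V := {v | ∃ h, s v = some (some h)}

/-- The vertices at which a state is not the empty state `∅`. -/
def State.occupied (s : Γ.State) : Finset V := {v | s v ≠ none}

/-- The homological degree: each half-edge has degree `1`, all other generators degree `0`. -/
def State.degree (s : Γ.State) : ℕ := s.active.card

/-- The weight of a state: half-edges and vertices have weight `1`. -/
def State.weight (s : Γ.State) : ℕ := s.occupied.card

/-- The differential on a state: the sum over the half-edges `h` occurring in it of
`± (e(h) - v(h))`, with the Koszul sign. -/
def State.boundary (s : Γ.State) : Γ.SwiatkowskiModule :=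
  ∑ v, match s v with
    | some (some h) =>
        (-1 : ℤ) ^ (s.active.filter (· < v)).card •
          (Finsupp.single (Function.update s v none) (MvPolynomial.X h.1.1) -
            Finsupp.single (Function.update s v (some none)) 1)
    | _ => 0

variable (Γ)

/-- The `ℤ[E]`-linear differential of the Świątkowski complex. -/
def boundary : Γ.SwiatkowskiModule →ₗ[MvPolynomial E ℤ] Γ.SwiatkowskiModule :=
  Finsupp.linearCombination (MvPolynomial E ℤ) State.boundary

/-- The part of degree `n` and weight `k`, spanned over `ℤ` by the products of a monomial in the
edges (each edge having degree `0` and weight `1`) and a state. -/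
def bigraded (n k : ℕ) : Submodule ℤ Γ.SwiatkowskiModule :=
  Submodule.span ℤ {x | ∃ (s : Γ.State) (m : E →₀ ℕ), s.degree = n ∧ s.weight + m.degree = k ∧
    x = Finsupp.single s (MvPolynomial.monomial m 1)}

/-- The submodule of `S(v)` spanned by `∅` and the differences of half-edges at `v`. -/
def reducedLocal (v : V) : Submodule ℤ (Γ.LocalModule v) :=
  Submodule.span ℤ ({Finsupp.single none 1} ∪
    {x | ∃ h h' : Γ.HalfEdgeAt v,
      x = HalfEdgeAt.toLocal h - HalfEdgeAt.toLocal h'})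

/-- The reduced Świątkowski complex, as a `ℤ[E]`-submodule of the Świątkowski complex. -/
def reduced : Submodule (MvPolynomial E ℤ) Γ.SwiatkowskiModule :=
  Submodule.span _ {x | ∃ y : (v : V) → Γ.LocalModule v,
    (∀ v, y v ∈ Γ.reducedLocal v) ∧ x = Γ.pureTensor y}

/-- Reduced chains of degree `n` and weight `k`. -/
def reducedChains (n k : ℕ) : Submodule ℤ Γ.SwiatkowskiModule :=
  Γ.reduced.restrictScalars ℤ ⊓ Γ.bigraded n k

/-- Reduced cycles of degree `n` and weight `k`. -/
def reducedCycles (n k : ℕ) : Submodule ℤ Γ.SwiatkowskiModule :=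
  Γ.reducedChains n k ⊓ LinearMap.ker (Γ.boundary.restrictScalars ℤ)

/-- Reduced boundaries of degree `n` and weight `k`. -/
def reducedBoundaries (n k : ℕ) : Submodule ℤ Γ.SwiatkowskiModule :=
  (Γ.reducedChains (n + 1) k).map (Γ.boundary.restrictScalars ℤ)

/-- Homology of the reduced Świątkowski complex in degree `n` and weight `k`. -/
abbrev ReducedHomology (n k : ℕ) : Type :=
  Γ.reducedCycles n k ⧸ (Γ.reducedBoundaries n k).submoduleOf (Γ.reducedCycles n k)

/-- The homology class of a reduced cycle. -/
def reducedClass (n k : ℕ) : Γ.reducedCycles n k →ₗ[ℤ] Γ.ReducedHomology n k :=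
  Submodule.mkQ _

end Complex

section Realization

/-! ### Comparison with the configuration spaces

A generator `m ⊗ s` of degree `n` and weight `k` (a monomial `m` in the edges and a state `s`) is
realized as an `n`-cube of unordered configurations of `k` points.  In an edge `e` there are `m e`
points; a vertex in state `v` carries a point; and for each vertex in a half-edge state `h` there
is one further point which moves from `v(h)` (time `0`) into the edge `e(h)` (time `1`). The points
in each edge are equally spaced, except that the gap between a vertex and a point moving from it is
multiplied by the time. At time `0` and time `1` this cube restricts to the cubes of the two
generators in which `h` is replaced by `v(h)` and by `e(h)`, respectively, in accordance with the
differential `∂ h = e(h) - v(h)`. These cubes are the cells of the cubical complex in `B_k(Γ)`, a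
deformation retract of `B_k(Γ)`, whose cellular chain complex is the weight `k` part of the
Świątkowski complex; so `realize` below represents the identification of the homology of the
latter with the homology of `B_k(Γ)`. -/

variable {V E : Type} {Γ : MultiGraph V E} [Fintype V] [LinearOrder V] [Fintype E] [DecidableEq E]

/-- The time parameter of the half-edge `h`; it is zero if `h` does not occur in the state. -/
def State.time (s : Γ.State) (t : V → unitInterval) (h : E × Fin 2) : ℝ :=
  if s (Γ.vert h) = some (some ⟨h, rfl⟩) then t (Γ.vert h) else 0

/-- The sum of all gaps in the edge `e` (before normalization). -/
def State.total (s : Γ.State) (m : E →₀ ℕ) (t : V → unitInterval) (e : E) : ℝ :=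
  s.time t (e, 0) + (m e + 1) + s.time t (e, 1)

/-- The coordinate in the edge `e` at distance `i` (before normalization) from the position that a
moving point coming from the end `0` has, or would have. -/
def State.coord (s : Γ.State) (m : E →₀ ℕ) (t : V → unitInterval) (e : E) (i : ℕ) : unitInterval :=
  Set.projIcc (0 : ℝ) 1 zero_le_one ((s.time t (e, 0) + i) / s.total m t e)

/-- The labels of the points: one for each occupied vertex, and `m e` for each edge `e`. -/
abbrev State.Label (s : Γ.State) (m : E →₀ ℕ) : Type :=
  {v : V // v ∈ s.occupied} ⊕ (Σ e : E, Fin (m e))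

/-- The position of the point with a given label. The points in the edge `e` have the coordinates
number `1, …, m e`; a point moving along the half-edge `(e, 0)` has the coordinate number `0`, and
one moving along `(e, 1)` the coordinate number `m e + 1`. -/
def State.position (s : Γ.State) (m : E →₀ ℕ) (t : V → unitInterval) : s.Label m → Γ.Space
  | Sum.inl v =>
      match s v.1 with
      | some (some h) => Γ.edgePt h.1.1 (s.coord m t h.1.1 (if h.1.2 = 0 then 0 else m h.1.1 + 1))
      | _ => Γ.vertexPt v.1
  | Sum.inr p => Γ.edgePt p.1 (s.coord m t p.1 (p.2 + 1))

/-- The vertex or the point in the interior of an edge that a point of the graph is. -/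
def normalForm (Γ : MultiGraph V E) : Γ.Space → V ⊕ E × unitInterval :=
  Quot.lift
    (fun p => match p with
      | Sum.inl v => Sum.inl v.1
      | Sum.inr ⟨e, x⟩ =>
          if x = 0 then Sum.inl (Γ.vert (e, 0))
          else if x = 1 then Sum.inl (Γ.vert (e, 1))
          else Sum.inr (e, x))
    (by
      rintro _ _ (e | e)
      · simp
      · simp)

theorem normalForm_vertexPt (v : V) : Γ.normalForm (Γ.vertexPt v) = Sum.inl v := rfl

theorem normalForm_edgePt (e : E) (x : unitInterval) :
    Γ.normalForm (Γ.edgePt e x) =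
      if x = 0 then Sum.inl (Γ.vert (e, 0))
      else if x = 1 then Sum.inl (Γ.vert (e, 1))
      else Sum.inr (e, x) := rfl

theorem State.time_nonneg (s : Γ.State) (t : V → unitInterval) (h : E × Fin 2) :
    0 ≤ s.time t h := by
  unfold State.time
  split_ifs
  · exact (t _).2.1
  · exact le_rfl

theorem State.total_pos (s : Γ.State) (m : E →₀ ℕ) (t : V → unitInterval) (e : E) :
    0 < s.total m t e := by
  have h0 := s.time_nonneg t (e, 0)
  have h1 := s.time_nonneg t (e, 1)
  unfold State.total
  positivity

theorem State.coord_val (s : Γ.State) (m : E →₀ ℕ) (t : V → unitInterval) (e : E) (i : ℕ)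
    (hi : i ≤ m e + 1) :
    (s.coord m t e i : ℝ) = (s.time t (e, 0) + i) / s.total m t e := by
  have h0 := s.time_nonneg t (e, 0)
  have h1 := s.time_nonneg t (e, 1)
  have hi' : (i : ℝ) ≤ m e + 1 := by exact_mod_cast hi
  unfold State.coord
  rw [Set.projIcc_of_mem zero_le_one]
  refine ⟨div_nonneg (by positivity) (s.total_pos m t e).le, ?_⟩
  rw [div_le_one (s.total_pos m t e)]
  unfold State.total
  linarith

theorem State.coord_inj (s : Γ.State) (m : E →₀ ℕ) (t : V → unitInterval) (e : E) {i j : ℕ}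
    (hi : i ≤ m e + 1) (hj : j ≤ m e + 1) (h : s.coord m t e i = s.coord m t e j) : i = j := by
  have h' := congrArg Subtype.val h
  rw [s.coord_val m t e i hi, s.coord_val m t e j hj, div_left_inj' (s.total_pos m t e).ne'] at h'
  exact_mod_cast add_left_cancel h'

theorem State.coord_ne_zero (s : Γ.State) (m : E →₀ ℕ) (t : V → unitInterval) (e : E) {i : ℕ}
    (hi : i ≤ m e + 1) (hi0 : i ≠ 0) : s.coord m t e i ≠ 0 := by
  intro h
  have h0 := s.time_nonneg t (e, 0)
  have h' := congrArg Subtype.val h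
  have hi1 : (0 : ℝ) < i := by exact_mod_cast Nat.pos_of_ne_zero hi0
  rw [s.coord_val m t e i hi] at h'
  have : 0 < (s.time t (e, 0) + i) / s.total m t e :=
    div_pos (by positivity) (s.total_pos m t e)
  exact this.ne' h'

theorem State.coord_ne_one (s : Γ.State) (m : E →₀ ℕ) (t : V → unitInterval) (e : E) {i : ℕ}
    (hi : i < m e + 1) : s.coord m t e i ≠ 1 := by
  intro h
  have h1 := s.time_nonneg t (e, 1)
  have h' := congrArg Subtype.val h
  have hi1 : (i : ℝ) < m e + 1 := by exact_mod_cast hi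
  rw [s.coord_val m t e i hi.le] at h'
  have : (s.time t (e, 0) + i) / s.total m t e < 1 := by
    rw [div_lt_one (s.total_pos m t e)]
    unfold State.total
    linarith
  exact this.ne h'

/-- The point at an occupied vertex is at that vertex, or is in the interior of an edge and moves
along a half-edge at that vertex. -/
theorem State.normalForm_inl (s : Γ.State) (m : E →₀ ℕ) (t : V → unitInterval)
    (v : {v : V // v ∈ s.occupied}) :
    Γ.normalForm (s.position m t (Sum.inl v)) = Sum.inl v.1 ∨
      ∃ e : E, ∃ i : Fin 2, Γ.vert (e, i) = v.1 ∧
        Γ.normalForm (s.position m t (Sum.inl v)) =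
          Sum.inr (e, s.coord m t e (if i = 0 then 0 else m e + 1)) := by
  rcases v with ⟨v, hv⟩
  rcases hs : s v with _ | _ | ⟨⟨e, i⟩, h⟩
  · left
    simp only [State.position, hs, normalForm_vertexPt]
  · left
    simp only [State.position, hs, normalForm_vertexPt]
  · simp only [State.position, hs, normalForm_edgePt]
    fin_cases i
    · have h1 : s.coord m t e 0 ≠ 1 := s.coord_ne_one m t e (by omega)
      by_cases h0 : s.coord m t e 0 = 0
      · left; simpa [h0] using h
      · right; exact ⟨e, 0, h, by simp [h0, h1]⟩
    · have h0 : s.coord m t e (m e + 1) ≠ 0 := s.coord_ne_zero m t e le_rfl (by omega)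
      by_cases h1 : s.coord m t e (m e + 1) = 1
      · left; simpa [h1] using h
      · right; exact ⟨e, 1, h, by simp [h0, h1]⟩

theorem State.normalForm_inr (s : Γ.State) (m : E →₀ ℕ) (t : V → unitInterval)
    (p : Σ e : E, Fin (m e)) :
    Γ.normalForm (s.position m t (Sum.inr p)) = Sum.inr (p.1, s.coord m t p.1 (p.2 + 1)) := by
  have h0 : s.coord m t p.1 (p.2 + 1) ≠ 0 := s.coord_ne_zero m t p.1 (by omega) (by omega)
  have h1 : s.coord m t p.1 (p.2 + 1) ≠ 1 := s.coord_ne_one m t p.1 (by omega)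
  simp [State.position, normalForm_edgePt, h0, h1]

theorem State.position_injective (s : Γ.State) (m : E →₀ ℕ) (t : V → unitInterval) :
    Function.Injective (s.position m t) := by
  have key : ∀ v p, s.position m t (Sum.inl v) ≠ s.position m t (Sum.inr p) := by
    rintro v ⟨e, j⟩ h
    have h' := congrArg Γ.normalForm h
    rw [s.normalForm_inr] at h'
    rcases s.normalForm_inl m t v with hv | ⟨e', i, -, hv⟩
    · rw [hv] at h'; cases h'
    · rw [hv] at h'
      simp only [Sum.inr.injEq, Prod.mk.injEq] at h'
      obtain ⟨rfl, h'⟩ := h'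
      have := s.coord_inj m t e' (by split_ifs <;> omega) (by omega) h'
      split_ifs at this <;> omega
  rintro (v | p) (w | q) h
  · have h' := congrArg Γ.normalForm h
    congr 1
    apply Subtype.ext
    rcases s.normalForm_inl m t v with hv | ⟨e, i, hi, hv⟩ <;>
      rcases s.normalForm_inl m t w with hw | ⟨e', i', hi', hw⟩ <;> rw [hv, hw] at h'
    · exact Sum.inl.inj h'
    · cases h'
    · cases h'
    · simp only [Sum.inr.injEq, Prod.mk.injEq] at h'
      obtain ⟨rfl, h'⟩ := h'
      have hc := s.coord_inj m t e (by split_ifs <;> omega) (by split_ifs <;> omega) h'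
      have : i = i' := by
        fin_cases i <;> fin_cases i' <;> simp_all
      rw [← hi, ← hi', this]
  · exact absurd h (key v q)
  · exact absurd h.symm (key w p)
  · have h' := congrArg Γ.normalForm h
    rw [s.normalForm_inr, s.normalForm_inr] at h'
    rcases p with ⟨e, j⟩
    rcases q with ⟨e', j'⟩
    simp only [Sum.inr.injEq, Prod.mk.injEq] at h'
    obtain ⟨rfl, h'⟩ := h'
    have := s.coord_inj m t e (by omega) (by omega) h'
    have : j = j' := Fin.ext (by omega)
    rw [this]

theorem State.continuous_time (s : Γ.State) (h : E × Fin 2) :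
    Continuous fun t : V → unitInterval => s.time t h := by
  unfold State.time
  split_ifs <;> fun_prop

theorem State.continuous_coord (s : Γ.State) (m : E →₀ ℕ) (e : E) (i : ℕ) :
    Continuous fun t : V → unitInterval => s.coord m t e i := by
  unfold State.coord
  refine continuous_projIcc.comp (Continuous.div ?_ ?_ fun t => (s.total_pos m t e).ne')
  · exact (s.continuous_time (e, 0)).add continuous_const
  · exact ((s.continuous_time (e, 0)).add continuous_const).add (s.continuous_time (e, 1))

theorem continuous_edgePt (Γ : MultiGraph V E) (e : E) : Continuous (Γ.edgePt e) :=
  continuous_quot_mk.comp (continuous_inr.comp continuous_sigmaMk)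

theorem State.continuous_position (s : Γ.State) (m : E →₀ ℕ) (l : s.Label m) :
    Continuous fun t : V → unitInterval => s.position m t l := by
  rcases l with ⟨v, hv⟩ | p
  · rcases hs : s v with _ | _ | h
    · simpa only [State.position, hs] using continuous_const
    · simpa only [State.position, hs] using continuous_const
    · simp only [State.position, hs]
      exact (Γ.continuous_edgePt _).comp (s.continuous_coord m _ _)
  · exact (Γ.continuous_edgePt _).comp (s.continuous_coord m _ _)

theorem State.card_label (s : Γ.State) (m : E →₀ ℕ) :
    Fintype.card (s.Label m) = s.weight + m.degree := by
  simp [State.weight, Finsupp.degree_eq_sum]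

/-- The cube of configurations realizing a generator `m ⊗ s` of weight `k`; it depends only on the
parameters at the vertices in a half-edge state.  (The chosen numbering of the points does not
matter, since the configurations are unordered.) -/
def State.cube (s : Γ.State) (m : E →₀ ℕ) {k : ℕ} (hk : s.weight + m.degree = k) :
    C(V → unitInterval, UnorderedConf k Γ.Space) where
  toFun t := Quotient.mk _
    ⟨fun i => s.position m t ((Fintype.equivFinOfCardEq ((s.card_label m).trans hk)).symm i),
      (s.position_injective m t).comp (Equiv.injective _)⟩
  continuous_toFun := continuous_quot_mk.comp
    (Continuous.subtype_mk (continuous_pi fun _ => s.continuous_position m _) _)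

/-- The sum of the barycentric coordinates of index larger than `i`. -/
def tailSum {n : ℕ} (i : Fin n) (x : stdSimplex ℝ (Fin (n + 1))) : unitInterval :=
  Set.projIcc (0 : ℝ) 1 zero_le_one (∑ j : Fin (n + 1) with i.castSucc < j, x j)

/-- The `n`-simplex, in the cube with one coordinate for each of the `n` vertices in a half-edge
state, whose vertices are `0, u_{π 0}, u_{π 0} + u_{π 1}, …`; here `u_i` is the unit vector for the
`i`-th of these vertices. -/
def State.simplexInCube (s : Γ.State) {n : ℕ} (hn : s.degree = n) (π : Equiv.Perm (Fin n)) :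
    C(stdSimplex ℝ (Fin (n + 1)), V → unitInterval) where
  toFun x v :=
    if hv : v ∈ s.active then tailSum (π.symm ((s.active.orderIsoOfFin hn).symm ⟨v, hv⟩)) x else 0
  continuous_toFun := by
    refine continuous_pi fun v => ?_
    split_ifs with hv
    · unfold tailSum
      refine continuous_projIcc.comp (continuous_finsetSum _ fun j _ => ?_)
      exact (continuous_apply j).comp continuous_subtype_val
    · exact continuous_const

/-- The singular chain realizing a generator `m ⊗ s` of degree `n` and weight `k`: the cube of
configurations, cut into `n!` oriented simplices. -/
def State.cubeChain (s : Γ.State) (m : E →₀ ℕ) {n k : ℕ} (hn : s.degree = n)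
    (hk : s.weight + m.degree = k) : (singularChains (UnorderedConf k Γ.Space)).X n :=
  ∑ π : Equiv.Perm (Fin n),
    ((Equiv.Perm.sign π : ℤ)) • singularSimplex ((s.cube m hk).comp (s.simplexInCube hn π))

variable (Γ) in
open Classical in
/-- The comparison map from the Świątkowski complex to the singular chains of `B_k(Γ)`, in degree
`n` and weight `k`; it is the `ℤ`-linear extension of `cubeChain`. -/
def realize (n k : ℕ) (x : Γ.SwiatkowskiModule) :
    (singularChains (UnorderedConf k Γ.Space)).X n :=
  ∑ s ∈ x.support, ∑ m ∈ (x s).support, (x s).coeff m •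
    if h : s.degree = n ∧ s.weight + m.degree = k then s.cubeChain m h.1 h.2 else 0

end Realization

end MultiGraph

namespace MultiGraph

/-- The half-edge of the theta graph at the vertex `i` in the edge `j`. -/
def thetaHalf {n : ℕ} (i : Fin 2) (j : Fin n) : (theta n).LocalModule i :=
  HalfEdgeAt.toLocal ⟨(j, i), rfl⟩

/-- The chain `A_2` on the theta graph with four edges (vertices, edges and half-edges are numbered
starting from `0`). -/
def thetaChain : (theta 4).SwiatkowskiModule :=
  ∑ σ : Equiv.Perm (Fin 4),
    (Equiv.Perm.sign σ : ℤ) •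
      (MvPolynomial.X 0 - MvPolynomial.X (σ 2) : MvPolynomial (Fin 4) ℤ) •
        (theta 4).pureTensor fun
          | 0 => thetaHalf 0 (σ 0) - thetaHalf 0 0
          | 1 => thetaHalf 1 (σ 1) - thetaHalf 1 0

end MultiGraph

end

/-! Algebra. A chain of degree two and weight three has a half-edge at each of the two vertices and
one further edge, so it is a family of integers `c j m l`: the half-edges of `j` at vertex `0` and
of `l` at vertex `1`, and a point on `m`. It is a cycle exactly when `c` is antisymmetric under
exchanging `j, m` and under exchanging `m, l`, and its sums over `j` and over `l` vanish
(`IsCycleCoeff`). Such a `c` is alternating, so it is given by its values on the four increasing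
triples of edges, and the vanishing sums determine these from `c 1 2 3`. The coefficients
`thetaCoeff` of `A_2` form such a family with value `-1` there, so every cycle is an integral
multiple of `A_2`.

Topology. The same relations are recovered from `B₃` by an iterated Mayer–Vietoris argument. For
each vertex, `B₃` is the union of two open sets: no point is at the vertex (`avoid`), or some point
is strictly closer to it than all others (`closest`). An intersection using at least one set from
each of the two covers is a disjoint union of contractible open sets: with a suitable labelling of
the points they are the `region`s, contracted by moving the points linearly along their edges
(`acyclicIn_piece`).

A 2-cycle is split along the first cover and the common boundary of its parts along the second; what
remains is a 0-chain in the fourfold intersection, the residue (`IsResidue`). The components of this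
intersection are the `cell`s, indexed by triples of edges `(j, m, l)`. The residue bounds in each of
the four triple intersections (`IsResidue.bounds`). Without `closest₀` the cells of `(j, m, l)` and
`(m, j, l)` merge; without `avoid₀` those of all `(j, m, l)` with `m, l` fixed merge; likewise at
the other vertex. So the total coefficients of the residue on the cells satisfy `IsCycleCoeff`.

The realization of `A_2` is a sum of squares of configurations whose sides cancel. Cutting each
square at the parameters `1/4` shows that the residue has the counts `thetaCoeff`. Hence any 2-cycle
minus a multiple of this one has a residue with vanishing counts; the residue then bounds, and by
acyclicity of the pieces so does the difference (`IsResidue.exists_d_eq`).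

The splitting of chains along open covers rests on barycentric subdivision. It is carried out on
formal chains of tuples of points, transported to singular simplices by naturality, and compared
with the singular chain complex at the end. -/

noncomputable section

set_option linter.unusedSectionVars false
set_option linter.unnecessarySeqFocus false
set_option linter.unnecessarySimpa false

/-! ### Alternating face sums -/

section Faces

variable {T : ℕ → Type} (δ : ∀ {n : ℕ}, Fin (n + 2) → T (n + 1) → T n)

/-- The alternating sum of the faces. -/
def faceSum (n : ℕ) : (T (n + 1) →₀ ℤ) →ₗ[ℤ] (T n →₀ ℤ) :=
  Finsupp.linearCombination ℤ fun t => ∑ i : Fin (n + 2), (-1 : ℤ) ^ (i : ℕ) • Finsupp.single (δ i t) 1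

theorem faceSum_single {n : ℕ} (t : T (n + 1)) :
    faceSum δ n (Finsupp.single t 1) =
      ∑ i : Fin (n + 2), (-1 : ℤ) ^ (i : ℕ) • Finsupp.single (δ i t) 1 := by
  simp [faceSum]

/-- The terms of the double sum cancel in pairs, by the face identity `h`. Tuples and singular
simplices are both instances. -/
theorem faceSum_faceSum {n : ℕ}
    (h : ∀ (i j : Fin (n + 2)) (t : T (n + 2)), i ≤ j →
      δ i (δ j.succ t) = δ j (δ i.castSucc t))
    (x : T (n + 2) →₀ ℤ) : faceSum δ n (faceSum δ (n + 1) x) = 0 := by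
  induction x using Finsupp.induction_linear with
  | zero => simp
  | add f g hf hg => simp [hf, hg]
  | single t c =>
    rw [← mul_one c, ← smul_eq_mul, ← Finsupp.smul_single, map_smul, map_smul, faceSum_single]
    simp only [map_sum, map_smul, faceSum_single, Finset.smul_sum]
    suffices H : ∑ j : Fin (n + 3), ∑ i : Fin (n + 2), (-1 : ℤ) ^ (j : ℕ) • (-1 : ℤ) ^ (i : ℕ) •
        (Finsupp.single (δ i (δ j t)) 1 : T n →₀ ℤ) = 0 by
      simp_rw [← Finset.smul_sum] at H ⊢
      rw [H, smul_zero]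
    rw [← Finset.sum_product']
    let P := Fin (n + 3) × Fin (n + 2)
    let S : Finset P := {ij : P | (ij.1 : ℕ) ≤ (ij.2 : ℕ)}
    rw [Finset.univ_product_univ, ← Finset.sum_add_sum_compl S, ← eq_neg_iff_add_eq_zero,
      ← Finset.sum_neg_distrib]
    -- For `i ≤ j`, taking face `i` and then `j` agrees with taking face `j + 1` and then `i`; the
    -- signs of the two terms are opposite.
    let φ : ∀ ij : P, ij ∈ S → P := fun ij hij =>
      (ij.2.succ, Fin.castLT ij.1 (lt_of_le_of_lt (by simpa [S] using hij) (Fin.is_lt ij.2)))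
    refine Finset.sum_bij φ ?_ ?_ ?_ ?_
    · rintro ⟨i, j⟩ hij
      simp only [S, φ, Finset.mem_compl, Finset.mem_filter_univ, Fin.val_succ, Fin.val_castLT,
        not_le] at hij ⊢
      omega
    · rintro ⟨i, j⟩ hij ⟨i', j'⟩ hij' h
      have h2 := Fin.succ_injective _ (congrArg Prod.fst h)
      have h1 := congrArg Fin.val (congrArg Prod.snd h)
      simp only [φ, Fin.val_castLT] at h1
      exact Prod.ext (Fin.ext h1) h2
    · rintro ⟨i, j⟩ hij
      simp only [S, Finset.mem_compl, Finset.mem_filter_univ, not_le] at hij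
      refine ⟨(j.castSucc, i.pred fun H => by simp [H] at hij), ?_, ?_⟩
      · simpa [S] using Nat.le_sub_one_of_lt hij
      · simp [φ]
    · rintro ⟨i, j⟩ hij
      simp only [S, Finset.mem_filter_univ] at hij
      have := h (i.castLT (lt_of_le_of_lt hij j.2)) j t (by simpa [Fin.le_def] using hij)
      simp only [φ, Fin.castSucc_castLT] at this ⊢
      rw [this]
      simp only [smul_smul, ← pow_add, ← neg_smul, Fin.val_succ, Fin.val_castLT]
      congr 1
      rw [pow_add, pow_add, pow_succ]
      ring

end Faces

theorem succAbove_comp {n : ℕ} {i j : Fin (n + 2)} (hij : i ≤ j) :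
    (j.succ.succAbove ∘ i.succAbove : Fin (n + 1) → Fin (n + 3)) =
      i.castSucc.succAbove ∘ j.succAbove := by
  funext k
  exact congrArg (fun f => f.toOrderHom k) (SimplexCategory.δ_comp_δ hij)

/-! ### Formal affine chains -/

/-- Formal integral combinations of `(n + 1)`-tuples of points. -/
abbrev TupleChain (S : Type) (n : ℕ) : Type := (Fin (n + 1) → S) →₀ ℤ

namespace TupleChain

variable {S S' : Type}

/-- The alternating sum of the faces of the tuples. -/
def d (n : ℕ) : TupleChain S (n + 1) →ₗ[ℤ] TupleChain S n :=
  faceSum (T := fun n => Fin (n + 1) → S) (fun i v => v ∘ i.succAbove) n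

theorem d_single {n : ℕ} (v : Fin (n + 2) → S) :
    d n (Finsupp.single v 1) =
      ∑ i : Fin (n + 2), (-1 : ℤ) ^ (i : ℕ) • Finsupp.single (v ∘ i.succAbove) 1 :=
  faceSum_single (T := fun n => Fin (n + 1) → S) _ v

theorem d_d {n : ℕ} (x : TupleChain S (n + 2)) : d n (d (n + 1) x) = 0 := by
  refine faceSum_faceSum (T := fun n => Fin (n + 1) → S) _ ?_ x
  intro i j t hij
  rw [Function.comp_assoc, succAbove_comp hij, Function.comp_assoc]

/-- The cone with a given apex. -/
def cone (b : S) (n : ℕ) : TupleChain S n →ₗ[ℤ] TupleChain S (n + 1) :=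
  Finsupp.lmapDomain ℤ ℤ (Fin.cons (α := fun _ => S) b)

theorem cone_single (b : S) {n : ℕ} (v : Fin (n + 1) → S) (c : ℤ) :
    cone b n (Finsupp.single v c) = Finsupp.single (Fin.cons (α := fun _ => S) b v) c := by
  simp [cone]

/-- In this pointwise form, identities between operators on formal chains are checked on single
generators. -/
theorem hom_ext {M : Type*} [AddCommGroup M] [Module ℤ M] {T : Type*} {f g : (T →₀ ℤ) →ₗ[ℤ] M}
    (h : ∀ t, f (Finsupp.single t 1) = g (Finsupp.single t 1)) (x : T →₀ ℤ) : f x = g x := by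
  have : f = g := Finsupp.lhom_ext' fun t => LinearMap.ext_ring (h t)
  rw [this]

/-- Omitting the apex gives the base; omitting another entry gives the cone over a face of the base,
with the index and hence the sign shifted by one. -/
theorem d_cone (b : S) {n : ℕ} (x : TupleChain S (n + 1)) :
    d (n + 1) (cone b (n + 1) x) = x - cone b n (d n x) := by
  refine hom_ext (f := d (n + 1) ∘ₗ cone b (n + 1)) (g := LinearMap.id - cone b n ∘ₗ d n)
    (fun v => ?_) x
  simp only [LinearMap.comp_apply, cone_single, d_single, LinearMap.sub_apply, LinearMap.id_apply,
    map_sum, map_smul]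
  rw [Fin.sum_univ_succ]
  simp only [Fin.val_zero, pow_zero, one_smul, Fin.val_succ, pow_succ, mul_neg, mul_one, neg_smul,
    Finset.sum_neg_distrib, sub_eq_add_neg]
  have h0 : (Fin.cons b v : Fin (n + 3) → S) ∘ (0 : Fin (n + 3)).succAbove = v := by
    funext k
    simp
  have hi : ∀ i : Fin (n + 2), (Fin.cons b v : Fin (n + 3) → S) ∘ i.succ.succAbove =
      Fin.cons b (v ∘ i.succAbove) := by
    intro i
    funext k
    refine Fin.cases ?_ (fun k => ?_) k
    · simp
    · simp [Fin.succ_succAbove_succ]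
  simp only [h0, hi]

/-- The sum of the coefficients. -/
def total : TupleChain S 0 →ₗ[ℤ] ℤ := Finsupp.linearCombination ℤ fun _ => 1

/-- In degree zero the face opposite to the base is the apex itself, which accounts for the
correction by the total coefficient. -/
theorem d_cone_zero (b : S) (x : TupleChain S 0) :
    d 0 (cone b 0 x) = x - total x • Finsupp.single (fun _ => b) 1 := by
  refine hom_ext (f := d 0 ∘ₗ cone b 0)
    (g := LinearMap.id - total.smulRight (Finsupp.single (fun _ => b) 1)) (fun v => ?_) x
  have h1 : (Fin.cons b v : Fin 2 → S) ∘ (1 : Fin 2).succAbove = fun _ => b := by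
    funext k
    have : k = 0 := Subsingleton.elim _ _
    subst this
    simp
  simp only [LinearMap.comp_apply, cone_single, LinearMap.sub_apply, LinearMap.id_apply,
    LinearMap.smulRight_apply, total, Finsupp.linearCombination_single]
  rw [d_single, Fin.sum_univ_two]
  simp [h1, sub_eq_add_neg]

theorem total_d (x : TupleChain S 1) : total (d 0 x) = 0 := by
  refine hom_ext (f := total ∘ₗ d 0) (g := 0) (fun v => ?_) x
  simp [d_single, total, Fin.sum_univ_two]

/-- The map induced by a map of points. -/
def map (g : S → S') (n : ℕ) : TupleChain S n →ₗ[ℤ] TupleChain S' n :=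
  Finsupp.lmapDomain ℤ ℤ (g ∘ ·)

theorem map_single (g : S → S') {n : ℕ} (v : Fin (n + 1) → S) (c : ℤ) :
    map g n (Finsupp.single v c) = Finsupp.single (g ∘ v) c := by
  simp [map]

theorem map_d (g : S → S') {n : ℕ} (x : TupleChain S (n + 1)) :
    map g n (d n x) = d n (map g (n + 1) x) := by
  refine hom_ext (f := map g n ∘ₗ d n) (g := d n ∘ₗ map g (n + 1)) (fun v => ?_) x
  simp [d_single, map_single, Function.comp_assoc]

theorem map_cone (g : S → S') (b : S) {n : ℕ} (x : TupleChain S n) :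
    map g (n + 1) (cone b n x) = cone (g b) n (map g n x) := by
  refine hom_ext (f := map g (n + 1) ∘ₗ cone b n) (g := cone (g b) n ∘ₗ map g n) (fun v => ?_) x
  simp only [LinearMap.comp_apply, cone_single, map_single]
  congr 1
  funext k
  refine Fin.cases ?_ (fun k => ?_) k <;> simp

end TupleChain

/-! ### Singular chains as formal combinations of singular simplices -/

/-- The standard simplex of dimension `n`. -/
abbrev StdSimp (n : ℕ) : Type := stdSimplex ℝ (Fin (n + 1))

/-- Formal integral combinations of singular `n`-simplices. -/
abbrev SingChain (X : Type) [TopologicalSpace X] (n : ℕ) : Type := C(StdSimp n, X) →₀ ℤ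

/-- The inclusion of a face of the standard simplex. -/
def stdFace {n : ℕ} (i : Fin (n + 2)) : C(StdSimp n, StdSimp (n + 1)) :=
  ⟨stdSimplex.map i.succAbove, stdSimplex.continuous_map _⟩

namespace SingChain

variable {X Y : Type} [TopologicalSpace X] [TopologicalSpace Y]

/-- The boundary operator. -/
def d (n : ℕ) : SingChain X (n + 1) →ₗ[ℤ] SingChain X n :=
  faceSum (T := fun n => C(StdSimp n, X)) (fun i σ => σ.comp (stdFace i)) n

theorem d_single {n : ℕ} (σ : C(StdSimp (n + 1), X)) :
    d n (Finsupp.single σ 1) =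
      ∑ i : Fin (n + 2), (-1 : ℤ) ^ (i : ℕ) • Finsupp.single (σ.comp (stdFace i)) 1 :=
  faceSum_single (T := fun n => C(StdSimp n, X)) _ σ

theorem d_d {n : ℕ} (x : SingChain X (n + 2)) : d n (d (n + 1) x) = 0 := by
  refine faceSum_faceSum (T := fun n => C(StdSimp n, X)) _ ?_ x
  intro i j t hij
  ext x
  simp only [ContinuousMap.comp_apply, stdFace, ContinuousMap.coe_mk, stdSimplex.map_comp_apply,
    succAbove_comp hij]

/-- The map induced by a continuous map. -/
def map (g : C(X, Y)) (n : ℕ) : SingChain X n →ₗ[ℤ] SingChain Y n :=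
  Finsupp.lmapDomain ℤ ℤ g.comp

theorem map_single (g : C(X, Y)) {n : ℕ} (σ : C(StdSimp n, X)) (c : ℤ) :
    map g n (Finsupp.single σ c) = Finsupp.single (g.comp σ) c := by
  simp [map]

theorem map_d (g : C(X, Y)) {n : ℕ} (x : SingChain X (n + 1)) :
    map g n (d n x) = d n (map g (n + 1) x) := by
  refine TupleChain.hom_ext (f := map g n ∘ₗ d n) (g := d n ∘ₗ map g (n + 1)) (fun v => ?_) x
  simp [d_single, map_single, ContinuousMap.comp_assoc]

/-- The chains of simplices lying in a set. -/
def inSet (S : Set X) (n : ℕ) : Submodule ℤ (SingChain X n) :=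
  Finsupp.supported ℤ ℤ {σ | ∀ t, σ t ∈ S}

theorem single_mem_inSet {S : Set X} {n : ℕ} {σ : C(StdSimp n, X)} (h : ∀ t, σ t ∈ S) (c : ℤ) :
    Finsupp.single σ c ∈ inSet S n :=
  Finsupp.single_mem_supported ℤ c h

theorem inSet_mono {S S' : Set X} (h : S ⊆ S') (n : ℕ) : inSet S n ≤ inSet S' n :=
  Finsupp.supported_mono fun _ hσ t => h (hσ t)

theorem mem_inSet_inter {S S' : Set X} {n : ℕ} {x : SingChain X n} (h : x ∈ inSet S n)
    (h' : x ∈ inSet S' n) : x ∈ inSet (S ∩ S') n := by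
  rw [inSet, Finsupp.mem_supported] at *
  exact fun σ hσ t => ⟨h hσ t, h' hσ t⟩

theorem mem_inSet_univ {n : ℕ} (x : SingChain X n) : x ∈ inSet Set.univ n := by
  rw [inSet, Finsupp.mem_supported]
  exact fun σ _ t => trivial

theorem inSet_induction {S : Set X} {n : ℕ} {p : SingChain X n → Prop}
    (h0 : p 0) (hadd : ∀ x y, p x → p y → p (x + y))
    (hs : ∀ σ : C(StdSimp n, X), (∀ t, σ t ∈ S) → ∀ c : ℤ, p (Finsupp.single σ c))
    {x : SingChain X n} (hx : x ∈ inSet S n) : p x := by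
  rw [inSet, Finsupp.mem_supported] at hx
  induction x using Finsupp.induction with
  | zero => exact h0
  | single_add σ c x hσ hc ih =>
    classical
    have hs' : (Finsupp.single σ c + x).support = insert σ x.support := by
      rw [Finsupp.support_single_add hσ hc, Finset.cons_eq_insert]
    rw [hs', Finset.coe_insert, Set.insert_subset_iff] at hx
    exact hadd _ _ (hs σ hx.1 c) (ih hx.2)

theorem map_mem_inSet {S : Set X} {T : Set Y} (g : C(X, Y)) (hg : ∀ x ∈ S, g x ∈ T) {n : ℕ}
    {x : SingChain X n} (hx : x ∈ inSet S n) : map g n x ∈ inSet T n := by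
  refine inSet_induction (p := fun x => map g n x ∈ inSet T n) ?_ ?_ ?_ hx
  · simp
  · intro x y hx hy
    rw [map_add]
    exact add_mem hx hy
  · intro σ hσ c
    rw [map_single]
    exact single_mem_inSet (fun t => hg _ (hσ t)) c

theorem single_eq_smul {T : Type*} (t : T) (c : ℤ) :
    Finsupp.single t c = c • Finsupp.single t (1 : ℤ) := by
  simp

theorem d_mem_inSet {S : Set X} {n : ℕ} {x : SingChain X (n + 1)} (hx : x ∈ inSet S (n + 1)) :
    d n x ∈ inSet S n := by
  refine inSet_induction (p := fun x => d n x ∈ inSet S n) ?_ ?_ ?_ hx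
  · simp
  · intro x y hx hy
    rw [map_add]
    exact add_mem hx hy
  · intro σ hσ c
    rw [single_eq_smul, map_smul, d_single]
    exact Submodule.smul_mem _ _ (Submodule.sum_mem _ fun i _ => Submodule.smul_mem _ _
      (single_mem_inSet (σ := σ.comp (stdFace i)) (fun t => hσ _) 1))

end SingChain

/-! ### Affine simplices -/

section Affine

variable {E : Type} [NormedAddCommGroup E] [NormedSpace ℝ E] {s : Set E}

/-- The affine simplex with given vertices in a convex set. -/
def affineSimplex (hs : Convex ℝ s) {n : ℕ} (v : Fin (n + 1) → s) : C(StdSimp n, s) where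
  toFun x := ⟨∑ i, x i • (v i : E), hs.sum_mem (fun i _ => x.2.1 i) x.2.2 fun i _ => (v i).2⟩
  continuous_toFun := by
    refine Continuous.subtype_mk (continuous_finsetSum _ fun i _ => ?_) _
    exact ((continuous_apply i).comp continuous_subtype_val).smul continuous_const

theorem affineSimplex_coe (hs : Convex ℝ s) {n : ℕ} (v : Fin (n + 1) → s) (x : StdSimp n) :
    (affineSimplex hs v x : E) = ∑ i, x i • (v i : E) := rfl

theorem stdFace_apply {n : ℕ} (i : Fin (n + 2)) (x : StdSimp n) :
    stdFace i x i = 0 ∧ ∀ k, stdFace i x (i.succAbove k) = x k := by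
  constructor
  · simp only [stdFace, ContinuousMap.coe_mk]
    change (stdSimplex.map i.succAbove x : Fin (n + 2) → ℝ) i = 0
    rw [stdSimplex.map_coe, FunOnFinite.linearMap_apply_apply]
    refine Finset.sum_eq_zero fun k hk => ?_
    simp [Fin.succAbove_ne] at hk
  · intro k
    simp only [stdFace, ContinuousMap.coe_mk]
    change (stdSimplex.map i.succAbove x : Fin (n + 2) → ℝ) _ = x k
    rw [stdSimplex.map_coe, FunOnFinite.linearMap_apply_apply]
    simp only [Fin.succAbove_right_inj]
    rw [Finset.sum_eq_single k] <;> simp +contextual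

theorem affineSimplex_comp_stdFace (hs : Convex ℝ s) {n : ℕ} (v : Fin (n + 2) → s)
    (i : Fin (n + 2)) :
    (affineSimplex hs v).comp (stdFace i) = affineSimplex hs (v ∘ i.succAbove) := by
  ext x
  simp only [ContinuousMap.comp_apply, affineSimplex_coe, Function.comp_apply]
  rw [Fin.sum_univ_succAbove _ i, (stdFace_apply i x).1, zero_smul, zero_add]
  simp only [(stdFace_apply i x).2]

variable {X Y : Type} [TopologicalSpace X] [TopologicalSpace Y]

/-- The singular chain obtained by mapping a formal affine chain in a convex set. -/
def realizeTuple (hs : Convex ℝ s) (f : C(s, X)) (n : ℕ) : TupleChain s n →ₗ[ℤ] SingChain X n :=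
  Finsupp.lmapDomain ℤ ℤ fun v => f.comp (affineSimplex hs v)

theorem realizeTuple_single (hs : Convex ℝ s) (f : C(s, X)) {n : ℕ} (v : Fin (n + 1) → s) (c : ℤ) :
    realizeTuple hs f n (Finsupp.single v c) = Finsupp.single (f.comp (affineSimplex hs v)) c := by
  simp [realizeTuple]

theorem d_realizeTuple (hs : Convex ℝ s) (f : C(s, X)) {n : ℕ} (x : TupleChain s (n + 1)) :
    SingChain.d n (realizeTuple hs f (n + 1) x) = realizeTuple hs f n (TupleChain.d n x) := by
  refine TupleChain.hom_ext (f := SingChain.d n ∘ₗ realizeTuple hs f (n + 1))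
    (g := realizeTuple hs f n ∘ₗ TupleChain.d n) (fun v => ?_) x
  simp [realizeTuple_single, SingChain.d_single, TupleChain.d_single, ContinuousMap.comp_assoc,
    affineSimplex_comp_stdFace]

theorem realizeTuple_map {E' : Type} [NormedAddCommGroup E'] [NormedSpace ℝ E'] {s' : Set E'}
    (hs : Convex ℝ s) (hs' : Convex ℝ s') (g : C(s, s'))
    (hg : ∀ (n : ℕ) (v : Fin (n + 1) → s),
      g.comp (affineSimplex hs v) = affineSimplex hs' (g ∘ v))
    (f : C(s', X)) {n : ℕ} (x : TupleChain s n) :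
    realizeTuple hs' f n (TupleChain.map g n x) = realizeTuple hs (f.comp g) n x := by
  refine TupleChain.hom_ext (f := realizeTuple hs' f n ∘ₗ TupleChain.map g n)
    (g := realizeTuple hs (f.comp g) n) (fun v => ?_) x
  simp [realizeTuple_single, TupleChain.map_single, ContinuousMap.comp_assoc, hg]

end Affine

/-! ### Barycentric subdivision -/

namespace TupleChain

variable {S S' : Type} (β : ∀ {n : ℕ}, (Fin (n + 1) → S) → S)
  (β' : ∀ {n : ℕ}, (Fin (n + 1) → S') → S')

/-- The iterated cone subdivision, with respect to a choice of a centre of each tuple. -/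
def subdiv : ∀ n : ℕ, TupleChain S n →ₗ[ℤ] TupleChain S n
  | 0 => LinearMap.id
  | n + 1 => Finsupp.linearCombination ℤ fun v =>
      cone (β v) n (subdiv n (d n (Finsupp.single v 1)))

/-- The chain homotopy between the identity and the subdivision. -/
def subdivHomotopy : ∀ n : ℕ, TupleChain S n →ₗ[ℤ] TupleChain S (n + 1)
  | 0 => 0
  | n + 1 => Finsupp.linearCombination ℤ fun v =>
      cone (β v) (n + 1) (Finsupp.single v 1 - subdivHomotopy n (d n (Finsupp.single v 1)))

theorem subdiv_single {n : ℕ} (v : Fin (n + 2) → S) :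
    subdiv β (n + 1) (Finsupp.single v 1) =
      cone (β v) n (subdiv β n (d n (Finsupp.single v 1))) := by
  simp [subdiv]

theorem subdivHomotopy_single {n : ℕ} (v : Fin (n + 2) → S) :
    subdivHomotopy β (n + 1) (Finsupp.single v 1) =
      cone (β v) (n + 1) (Finsupp.single v 1 -
        subdivHomotopy β n (d n (Finsupp.single v 1))) := by
  simp [subdivHomotopy]

/-- By the cone formula the boundary of the cone over `subdiv (d v)` is that chain itself, since by
induction `subdiv (d v)` is a cycle; in degree one, its total coefficient is zero. -/
theorem d_subdiv : ∀ {n : ℕ} (x : TupleChain S (n + 1)),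
    d n (subdiv β (n + 1) x) = subdiv β n (d n x)
  | 0, x => by
    refine hom_ext (f := d 0 ∘ₗ subdiv β 1) (g := subdiv β 0 ∘ₗ d 0) (fun v => ?_) x
    simp only [LinearMap.comp_apply, subdiv_single, d_cone_zero]
    simp [subdiv, total_d]
  | n + 1, x => by
    refine hom_ext (f := d (n + 1) ∘ₗ subdiv β (n + 2)) (g := subdiv β (n + 1) ∘ₗ d (n + 1))
      (fun v => ?_) x
    simp only [LinearMap.comp_apply, subdiv_single, d_cone]
    rw [d_subdiv, d_d]
    simp

/-- By induction the base `v - subdivHomotopy (d v)` of the cone has boundary `subdiv (d v)`, whose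
cone is `subdiv v`; the cone formula gives the rest. -/
theorem d_subdivHomotopy : ∀ {n : ℕ} (x : TupleChain S (n + 1)),
    d (n + 1) (subdivHomotopy β (n + 1) x) =
      x - subdiv β (n + 1) x - subdivHomotopy β n (d n x)
  | 0, x => by
    refine hom_ext (f := d 1 ∘ₗ subdivHomotopy β 1)
      (g := LinearMap.id - subdiv β 1 - subdivHomotopy β 0 ∘ₗ d 0) (fun v => ?_) x
    simp only [LinearMap.comp_apply, subdivHomotopy_single, d_cone, LinearMap.sub_apply,
      LinearMap.id_apply, subdiv_single]
    simp [subdiv, subdivHomotopy]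
  | n + 1, x => by
    refine hom_ext (f := d (n + 2) ∘ₗ subdivHomotopy β (n + 2))
      (g := LinearMap.id - subdiv β (n + 2) - subdivHomotopy β (n + 1) ∘ₗ d (n + 1))
      (fun v => ?_) x
    simp only [LinearMap.comp_apply, subdivHomotopy_single, d_cone, LinearMap.sub_apply,
      LinearMap.id_apply, subdiv_single]
    rw [map_sub, d_subdivHomotopy, d_d]
    simp only [map_zero, sub_zero, sub_sub_cancel]
    abel

variable {β β'}

/-- Naturality under maps preserving the chosen centres. Affine maps preserve barycentres, which is
what allows the subdivision to pass from the standard simplex to singular simplices. -/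
theorem map_subdiv (g : S → S') (hg : ∀ (n : ℕ) (v : Fin (n + 1) → S), g (β v) = β' (g ∘ v)) :
    ∀ {n : ℕ} (x : TupleChain S n), map g n (subdiv β n x) = subdiv β' n (map g n x)
  | 0, x => by simp [subdiv]
  | n + 1, x => by
    refine hom_ext (f := map g (n + 1) ∘ₗ subdiv β (n + 1))
      (g := subdiv β' (n + 1) ∘ₗ map g (n + 1)) (fun v => ?_) x
    simp only [LinearMap.comp_apply, subdiv_single, map_single, map_cone]
    rw [map_subdiv g hg, map_d, map_single, hg]

theorem map_subdivHomotopy (g : S → S')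
    (hg : ∀ (n : ℕ) (v : Fin (n + 1) → S), g (β v) = β' (g ∘ v)) :
    ∀ {n : ℕ} (x : TupleChain S n),
      map g (n + 1) (subdivHomotopy β n x) = subdivHomotopy β' n (map g n x)
  | 0, x => by simp [subdivHomotopy]
  | n + 1, x => by
    refine hom_ext (f := map g (n + 2) ∘ₗ subdivHomotopy β (n + 1))
      (g := subdivHomotopy β' (n + 1) ∘ₗ map g (n + 1)) (fun v => ?_) x
    simp only [LinearMap.comp_apply, subdivHomotopy_single, map_single, map_cone]
    rw [map_sub, map_subdivHomotopy g hg, map_d, map_single, hg]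

/-- The chains all of whose simplices have a given property. -/
def satisfying {n : ℕ} (P : (Fin (n + 1) → S) → Prop) : Submodule ℤ (TupleChain S n) :=
  Finsupp.supported ℤ ℤ {v | P v}

theorem satisfying_le_comap {n m : ℕ} {P : (Fin (n + 1) → S) → Prop}
    {Q : (Fin (m + 1) → S') → Prop} {f : TupleChain S n →ₗ[ℤ] TupleChain S' m}
    (h : ∀ v, P v → f (Finsupp.single v 1) ∈ satisfying Q) {x : TupleChain S n}
    (hx : x ∈ satisfying P) : f x ∈ satisfying Q := by
  suffices satisfying P ≤ (satisfying Q).comap f from this hx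
  rw [satisfying, Finsupp.supported_eq_span_single, Submodule.span_le]
  rintro _ ⟨v, hv, rfl⟩
  exact h v hv

theorem single_mem_satisfying {n : ℕ} {P : (Fin (n + 1) → S) → Prop} {v : Fin (n + 1) → S}
    (h : P v) (c : ℤ) : Finsupp.single v c ∈ satisfying P :=
  Finsupp.single_mem_supported ℤ c h

end TupleChain

/-! ### Barycentric subdivision of singular chains -/

namespace SingChain

variable {X Y : Type} [TopologicalSpace X] [TopologicalSpace Y]

/-- The vertices of the standard simplex. -/
def stdVertices (n : ℕ) : Fin (n + 1) → StdSimp n := stdSimplex.vertex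

theorem convex_std (n : ℕ) : Convex ℝ (stdSimplex ℝ (Fin (n + 1))) := convex_stdSimplex ℝ _

theorem affineSimplex_std_apply {n m : ℕ} (v : Fin (m + 1) → StdSimp n) (x : StdSimp m)
    (k : Fin (n + 1)) : affineSimplex (convex_std n) v x k = ∑ i, x i * v i k := by
  change ((affineSimplex (convex_std n) v x).1 : Fin (n + 1) → ℝ) k = _
  rw [affineSimplex_coe, Finset.sum_apply]
  rfl

theorem affineSimplex_stdVertices (n : ℕ) :
    affineSimplex (convex_std n) (stdVertices n) = ContinuousMap.id _ := by
  ext x i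
  rw [affineSimplex_std_apply]
  have : ∀ j, stdVertices n j i = if j = i then 1 else 0 := by
    intro j
    change (stdSimplex.vertex (S := ℝ) j : Fin (n + 1) → ℝ) i = _
    rw [stdSimplex.vertex_coe, Pi.single_apply]
    simp [eq_comm]
  simp [this]

section Affine

variable {E : Type} [NormedAddCommGroup E] [NormedSpace ℝ E] {s : Set E} (hs : Convex ℝ s)

/-- The barycentre of a tuple of points of a convex set. -/
def baryc {n : ℕ} (v : Fin (n + 1) → s) : s :=
  affineSimplex hs v stdSimplex.barycenter

theorem affineSimplex_comp {n m : ℕ} (v : Fin (n + 1) → s) (w : Fin (m + 1) → StdSimp n) :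
    (affineSimplex hs v).comp (affineSimplex (convex_std n) w) =
      affineSimplex hs (affineSimplex hs v ∘ w) := by
  ext x
  simp only [ContinuousMap.comp_apply, affineSimplex_coe, Function.comp_apply,
    affineSimplex_std_apply, Finset.sum_smul, Finset.smul_sum]
  rw [Finset.sum_comm]
  simp only [mul_smul]

theorem affineSimplex_baryc {n m : ℕ} (v : Fin (n + 1) → s) (w : Fin (m + 1) → StdSimp n) :
    affineSimplex hs v (baryc (convex_std n) w) = baryc hs (affineSimplex hs v ∘ w) :=
  DFunLike.congr_fun (affineSimplex_comp hs v w) _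

theorem affineSimplex_comp_vertices {n : ℕ} (v : Fin (n + 1) → s) :
    affineSimplex hs v ∘ stdVertices n = v := by
  funext i
  apply Subtype.ext
  have : ∀ j, stdVertices n i j = if i = j then 1 else 0 := by
    intro j
    change (stdSimplex.vertex (S := ℝ) i : Fin (n + 1) → ℝ) j = _
    rw [stdSimplex.vertex_coe, Pi.single_apply]
    simp [eq_comm]
  simp [affineSimplex_coe, this]

theorem realizeTuple_std {n : ℕ} (σ : C(StdSimp n, X)) :
    realizeTuple (convex_std n) σ n (Finsupp.single (stdVertices n) 1) = Finsupp.single σ 1 := by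
  rw [realizeTuple_single, affineSimplex_stdVertices, ContinuousMap.comp_id]

/-- The extension to singular chains of a natural operation on affine chains. -/
def extend {n m : ℕ} (f : TupleChain (StdSimp n) n →ₗ[ℤ] TupleChain (StdSimp n) m) :
    SingChain X n →ₗ[ℤ] SingChain X m :=
  Finsupp.linearCombination ℤ fun σ =>
    realizeTuple (convex_std n) σ m (f (Finsupp.single (stdVertices n) 1))

/-- An affine simplex is the image of the tuple of vertices of the standard simplex under an affine
map, and `hfg` says that the operation commutes with such maps. -/
theorem extend_realizeTuple {n m : ℕ} (f : TupleChain (StdSimp n) n →ₗ[ℤ] TupleChain (StdSimp n) m)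
    (g : TupleChain s n →ₗ[ℤ] TupleChain s m)
    (hfg : ∀ (v : Fin (n + 1) → s) x, TupleChain.map (affineSimplex hs v) m (f x) =
      g (TupleChain.map (affineSimplex hs v) n x)) (σ : C(s, X)) (x : TupleChain s n) :
    extend f (realizeTuple hs σ n x) = realizeTuple hs σ m (g x) := by
  refine TupleChain.hom_ext (f := extend f ∘ₗ realizeTuple hs σ n)
    (g := realizeTuple hs σ m ∘ₗ g) (fun v => ?_) x
  simp only [LinearMap.comp_apply, realizeTuple_single, extend,
    Finsupp.linearCombination_single, one_smul]
  rw [← realizeTuple_map (convex_std n) hs (affineSimplex hs v)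
    (fun m w => affineSimplex_comp hs v w), hfg, TupleChain.map_single,
    affineSimplex_comp_vertices]

end Affine

/-- The barycentric subdivision of singular chains. -/
def subdiv (n : ℕ) : SingChain X n →ₗ[ℤ] SingChain X n :=
  extend (TupleChain.subdiv (baryc (convex_std n)) n)

/-- The chain homotopy between the identity and the barycentric subdivision. -/
def subdivHomotopy (n : ℕ) : SingChain X n →ₗ[ℤ] SingChain X (n + 1) :=
  extend (TupleChain.subdivHomotopy (baryc (convex_std n)) n)

theorem subdiv_realizeTuple {E : Type} [NormedAddCommGroup E] [NormedSpace ℝ E] {s : Set E}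
    (hs : Convex ℝ s) (σ : C(s, X)) {n : ℕ} (x : TupleChain s n) :
    subdiv n (realizeTuple hs σ n x) =
      realizeTuple hs σ n (TupleChain.subdiv (baryc hs) n x) :=
  extend_realizeTuple hs _ _ (fun v x => TupleChain.map_subdiv (β := baryc (convex_std n))
    (β' := baryc hs) _ (fun _ w => affineSimplex_baryc hs v w) x) σ x

theorem subdivHomotopy_realizeTuple {E : Type} [NormedAddCommGroup E] [NormedSpace ℝ E] {s : Set E}
    (hs : Convex ℝ s) (σ : C(s, X)) {n : ℕ} (x : TupleChain s n) :
    subdivHomotopy n (realizeTuple hs σ n x) =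
      realizeTuple hs σ (n + 1) (TupleChain.subdivHomotopy (baryc hs) n x) :=
  extend_realizeTuple hs _ _ (fun v x => TupleChain.map_subdivHomotopy
    (β := baryc (convex_std n)) (β' := baryc hs) _ (fun _ w => affineSimplex_baryc hs v w) x) σ x

/-- Each singular simplex is the realization of the vertex tuple of the standard simplex, so the
identity is inherited from formal affine chains. -/
theorem d_subdiv {n : ℕ} (x : SingChain X (n + 1)) :
    d n (subdiv (n + 1) x) = subdiv n (d n x) := by
  refine TupleChain.hom_ext (f := d n ∘ₗ subdiv (n + 1)) (g := subdiv n ∘ₗ d n) (fun σ => ?_) x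
  simp only [LinearMap.comp_apply]
  rw [← realizeTuple_std σ, subdiv_realizeTuple, d_realizeTuple, d_realizeTuple,
    subdiv_realizeTuple, TupleChain.d_subdiv]

theorem d_subdivHomotopy {n : ℕ} (x : SingChain X (n + 1)) :
    d (n + 1) (subdivHomotopy (n + 1) x) =
      x - subdiv (n + 1) x - subdivHomotopy n (d n x) := by
  refine TupleChain.hom_ext (f := d (n + 1) ∘ₗ subdivHomotopy (n + 1))
    (g := LinearMap.id - subdiv (n + 1) - subdivHomotopy n ∘ₗ d n) (fun σ => ?_) x
  simp only [LinearMap.comp_apply, LinearMap.sub_apply, LinearMap.id_apply]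
  rw [← realizeTuple_std σ, subdivHomotopy_realizeTuple, subdiv_realizeTuple, d_realizeTuple,
    d_realizeTuple, subdivHomotopy_realizeTuple, TupleChain.d_subdivHomotopy, map_sub, map_sub]

theorem extend_mem_inSet {n m : ℕ} (f : TupleChain (StdSimp n) n →ₗ[ℤ] TupleChain (StdSimp n) m)
    {S : Set X} {x : SingChain X n} (hx : x ∈ inSet S n) : extend f x ∈ inSet S m := by
  refine inSet_induction (p := fun x => extend f x ∈ inSet S m) ?_ ?_ ?_ hx
  · simp
  · intro x y hx hy
    rw [map_add]
    exact add_mem hx hy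
  · intro σ hσ c
    rw [extend, Finsupp.linearCombination_single]
    refine Submodule.smul_mem _ _ ?_
    rw [realizeTuple, Finsupp.lmapDomain_apply, inSet, Finsupp.mem_supported]
    classical
    refine (Finset.coe_subset.2 Finsupp.mapDomain_support).trans ?_
    intro τ hτ t
    simp only [Finset.coe_image, Set.mem_image] at hτ
    obtain ⟨v, -, rfl⟩ := hτ
    exact hσ _

theorem subdiv_pow_mem_inSet {n : ℕ} (N : ℕ) {S : Set X} {x : SingChain X n}
    (hx : x ∈ inSet S n) : (subdiv n ^ N) x ∈ inSet S n := by
  induction N with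
  | zero => simpa
  | succ N ih =>
    rw [pow_succ', Module.End.mul_apply]
    exact extend_mem_inSet _ ih

theorem d_subdiv_pow {n : ℕ} (N : ℕ) (x : SingChain X (n + 1)) :
    d n ((subdiv (n + 1) ^ N) x) = (subdiv n ^ N) (d n x) := by
  induction N with
  | zero => simp
  | succ N ih => rw [pow_succ', Module.End.mul_apply, d_subdiv, ih, pow_succ', Module.End.mul_apply]

/-- The chain homotopy between the identity and an iterated subdivision. -/
def subdivPowHomotopy (n N : ℕ) : SingChain X n →ₗ[ℤ] SingChain X (n + 1) :=
  ∑ k ∈ Finset.range N, subdivHomotopy n ∘ₗ (subdiv n ^ k)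

theorem subdivPowHomotopy_mem_inSet {n : ℕ} (N : ℕ) {S : Set X} {x : SingChain X n}
    (hx : x ∈ inSet S n) : subdivPowHomotopy n N x ∈ inSet S (n + 1) := by
  rw [subdivPowHomotopy, LinearMap.sum_apply]
  exact Submodule.sum_mem _ fun k _ => extend_mem_inSet _ (subdiv_pow_mem_inSet k hx)

/-- The differences between consecutive subdivisions telescope. -/
theorem d_subdivPowHomotopy {n : ℕ} (N : ℕ) {x : SingChain X (n + 1)} (hx : d n x = 0) :
    d (n + 1) (subdivPowHomotopy (n + 1) N x) = x - (subdiv (n + 1) ^ N) x := by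
  induction N with
  | zero => simp [subdivPowHomotopy]
  | succ N ih =>
    rw [subdivPowHomotopy, Finset.sum_range_succ, LinearMap.add_apply, map_add,
      ← subdivPowHomotopy, ih, LinearMap.comp_apply, d_subdivHomotopy, d_subdiv_pow, hx, map_zero,
      map_zero, pow_succ', Module.End.mul_apply]
    abel

/-! ### Small simplices -/

section Mesh

variable {E : Type} [NormedAddCommGroup E] [NormedSpace ℝ E] {s : Set E} (hs : Convex ℝ s)

/-- The difference between a vertex and the barycentre is the average of `n + 1` differences of
vertices, one of which is zero. -/
theorem dist_baryc_le {n : ℕ} (v : Fin (n + 1) → s) {D : ℝ} (hv : ∀ i j, dist (v i) (v j) ≤ D)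
    (j : Fin (n + 1)) : dist (v j : E) (baryc hs v) ≤ n / (n + 1) * D := by
  have hb : (baryc hs v : E) = ∑ i, (1 / (n + 1) : ℝ) • (v i : E) := by
    rw [baryc, affineSimplex_coe]
    refine Finset.sum_congr rfl fun i _ => ?_
    congr 1
    exact (stdSimplex.barycenter_apply i).trans (by simp)
  have hj : (v j : E) = ∑ i : Fin (n + 1), (1 / (n + 1) : ℝ) • (v j : E) := by
    rw [Finset.sum_const, Finset.card_univ, Fintype.card_fin, ← Nat.cast_smul_eq_nsmul ℝ, smul_smul]
    push_cast
    rw [mul_one_div_cancel (by positivity), one_smul]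
  rw [hb, dist_eq_norm]
  conv_lhs => rw [hj]
  rw [← Finset.sum_sub_distrib, Fin.sum_univ_succAbove _ j, sub_self, zero_add]
  refine (norm_sum_le _ _).trans ?_
  have : ∀ i ∈ (Finset.univ : Finset (Fin n)),
      ‖(1 / (n + 1) : ℝ) • (v j : E) - (1 / (n + 1) : ℝ) • (v (j.succAbove i) : E)‖ ≤
        1 / (n + 1) * D := by
    intro i _
    rw [← smul_sub, norm_smul, Real.norm_of_nonneg (by positivity), ← dist_eq_norm]
    exact mul_le_mul_of_nonneg_left (hv _ _) (by positivity)
  refine (Finset.sum_le_sum this).trans (le_of_eq ?_)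
  rw [Finset.sum_const, Finset.card_univ, Fintype.card_fin, nsmul_eq_mul]
  ring

/-- A tuple in the convex hull of `v`, with mutual distances at most `D`. -/
def FineIn {n m : ℕ} (v : Fin (n + 1) → s) (D : ℝ) (w : Fin (m + 1) → s) : Prop :=
  (∀ i, (w i : E) ∈ convexHull ℝ (Set.range fun j => (v j : E))) ∧ ∀ i j, dist (w i) (w j) ≤ D

/-- Edges of a subdivided face are short by induction, the factor `n / (n + 1)` being increasing in
`n`. Edges at the apex are short because a ball around the barycentre contains all vertices, hence
their convex hull; this is why `FineIn` records membership in the hull. -/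
theorem subdiv_single_mem {n : ℕ} (v : Fin (n + 1) → s) {D : ℝ} (hD : 0 ≤ D)
    (hv : ∀ i j, dist (v i) (v j) ≤ D) :
    TupleChain.subdiv (baryc hs) n (Finsupp.single v 1) ∈
      TupleChain.satisfying (FineIn v (n / (n + 1) * D)) := by
  induction n with
  | zero =>
    refine TupleChain.single_mem_satisfying ⟨fun i => subset_convexHull _ _ ⟨i, rfl⟩,
      fun i j => ?_⟩ 1
    rw [Subsingleton.elim (α := Fin 1) i j]
    simp
  | succ n ih =>
    have hmono : (n : ℝ) / (n + 1) ≤ (n + 1 : ℕ) / ((n + 1 : ℕ) + 1) := by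
      rw [div_le_div_iff₀ (by positivity) (by positivity)]
      push_cast
      nlinarith
    rw [TupleChain.subdiv_single, TupleChain.d_single]
    simp only [map_sum, map_smul]
    refine Submodule.sum_mem _ fun i _ => Submodule.smul_mem _ _ ?_
    refine TupleChain.satisfying_le_comap (fun w hw => ?_)
      (ih (v ∘ i.succAbove) fun j k => hv _ _)
    rw [TupleChain.cone_single]
    have hsub : ∀ k, (w k : E) ∈ convexHull ℝ (Set.range fun j => (v j : E)) := fun k =>
      convexHull_mono (by rintro _ ⟨j, rfl⟩; exact ⟨_, rfl⟩) (hw.1 k)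
    have hdist : ∀ k, dist (w k : E) (baryc hs v) ≤ (n + 1 : ℕ) / ((n + 1 : ℕ) + 1) * D := by
      intro k
      have : convexHull ℝ (Set.range fun j => (v j : E)) ⊆
          Metric.closedBall (baryc hs v : E) ((n + 1 : ℕ) / ((n + 1 : ℕ) + 1) * D) := by
        refine convexHull_min ?_ (convex_closedBall _ _)
        rintro _ ⟨j, rfl⟩
        exact dist_baryc_le hs v hv j
      exact this (hsub k)
    refine TupleChain.single_mem_satisfying ⟨fun k => ?_, fun k l => ?_⟩ 1
    · refine Fin.cases ?_ (fun k => ?_) k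
      · rw [Fin.cons_zero, baryc, affineSimplex_coe]
        exact (convex_convexHull ℝ _).sum_mem (fun i _ => stdSimplex.zero_le _ i)
          (stdSimplex.sum_eq_one _) fun i _ => subset_convexHull _ _ ⟨i, rfl⟩
      · rw [Fin.cons_succ]
        exact hsub k
    · refine Fin.cases ?_ (fun k => ?_) k <;> refine Fin.cases ?_ (fun l => ?_) l
      · rw [dist_self]
        positivity
      · rw [Fin.cons_zero, Fin.cons_succ, dist_comm]
        exact hdist l
      · rw [Fin.cons_zero, Fin.cons_succ]
        exact hdist k
      · rw [Fin.cons_succ, Fin.cons_succ]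
        exact (hw.2 k l).trans (mul_le_mul_of_nonneg_right hmono hD)

theorem subdiv_pow_single_mem {n : ℕ} (v : Fin (n + 1) → s) {D : ℝ} (hD : 0 ≤ D)
    (hv : ∀ i j, dist (v i) (v j) ≤ D) (N : ℕ) :
    (TupleChain.subdiv (baryc hs) n ^ N) (Finsupp.single v 1) ∈
      TupleChain.satisfying fun w => ∀ i j, dist (w i) (w j) ≤ (n / (n + 1)) ^ N * D := by
  induction N with
  | zero => exact TupleChain.single_mem_satisfying (by simpa using hv) 1
  | succ N ih =>
    rw [pow_succ' (TupleChain.subdiv (baryc hs) n), Module.End.mul_apply]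
    refine TupleChain.satisfying_le_comap (fun w hw => ?_) ih
    refine Finsupp.supported_mono ?_ (subdiv_single_mem hs w (by positivity) hw)
    intro u hu i j
    refine (hu.2 i j).trans (le_of_eq ?_)
    rw [pow_succ']
    ring

theorem affineSimplex_mem_ball {n : ℕ} (w : Fin (n + 1) → s) {δ : ℝ}
    (hw : ∀ i j, dist (w i) (w j) < δ) (x : StdSimp n) :
    affineSimplex hs w x ∈ Metric.ball (w 0) δ := by
  change (affineSimplex hs w x : E) ∈ Metric.ball (w 0 : E) δ
  rw [affineSimplex_coe]
  exact (convex_ball _ _).sum_mem (fun i _ => x.2.1 i) x.2.2 fun i _ => hw i 0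

end Mesh

theorem subdiv_pow_realizeTuple {E : Type} [NormedAddCommGroup E] [NormedSpace ℝ E] {s : Set E}
    (hs : Convex ℝ s) (σ : C(s, X)) {n : ℕ} (N : ℕ) (x : TupleChain s n) :
    (subdiv n ^ N) (realizeTuple hs σ n x) =
      realizeTuple hs σ n ((TupleChain.subdiv (baryc hs) n ^ N) x) := by
  induction N with
  | zero => simp
  | succ N ih => rw [pow_succ', Module.End.mul_apply, ih, subdiv_realizeTuple, pow_succ',
      Module.End.mul_apply]

variable {U V : Set X}

/-- The preimages of `U` and `V` cover a compact simplex and so have a Lebesgue number, while the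
mesh of the iterated subdivision tends to zero. -/
theorem exists_subdiv_pow_single_mem (hU : IsOpen U) (hV : IsOpen V) {n : ℕ} (σ : C(StdSimp n, X))
    (hσ : ∀ t, σ t ∈ U ∪ V) :
    ∃ N, (subdiv n ^ N) (Finsupp.single σ 1) ∈ inSet U n ⊔ inSet V n := by
  obtain ⟨δ, hδ, hball⟩ := lebesgue_number_lemma_of_metric (s := (Set.univ : Set (StdSimp n)))
    (c := fun b : Bool => σ ⁻¹' (if b then U else V)) isCompact_univ
    (fun b => by cases b <;> simp [hU.preimage σ.continuous, hV.preimage σ.continuous])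
    (fun t _ => by
      rcases hσ t with h | h
      · exact Set.mem_iUnion.2 ⟨true, by simpa using h⟩
      · exact Set.mem_iUnion.2 ⟨false, by simpa using h⟩)
  -- The bound is made positive because the Lebesgue number is divided by it.
  obtain ⟨D, hD⟩ : ∃ D : ℝ, 0 < D ∧ ∀ i j, dist (stdVertices n i) (stdVertices n j) ≤ D := by
    obtain ⟨D, hD⟩ := Metric.isBounded_iff.1 (isCompact_univ (X := StdSimp n)).isBounded
    exact ⟨max D 1, by positivity, fun i j => (hD trivial trivial).trans (le_max_left _ _)⟩
  have hlt : (n / (n + 1) : ℝ) < 1 := by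
    rw [div_lt_one (by positivity)]
    linarith
  obtain ⟨N, hN⟩ := exists_pow_lt_of_lt_one (div_pos hδ hD.1) hlt
  refine ⟨N, ?_⟩
  rw [← realizeTuple_std σ, subdiv_pow_realizeTuple]
  have := subdiv_pow_single_mem (convex_std n) (stdVertices n) hD.1.le hD.2 N
  revert this
  generalize (TupleChain.subdiv (baryc (convex_std n)) n ^ N)
    (Finsupp.single (stdVertices n) 1) = x
  intro hx
  suffices TupleChain.satisfying (fun w => ∀ i j, dist (w i) (w j) ≤ (n / (n + 1) : ℝ) ^ N * D) ≤
      (inSet U n ⊔ inSet V n).comap (realizeTuple (convex_std n) σ n) from this hx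
  rw [TupleChain.satisfying, Finsupp.supported_eq_span_single, Submodule.span_le]
  rintro _ ⟨w, hw, rfl⟩
  change realizeTuple (convex_std n) σ n (Finsupp.single w 1) ∈ inSet U n ⊔ inSet V n
  rw [realizeTuple_single]
  obtain ⟨b, hb⟩ := hball (w 0) trivial
  have hmem : ∀ t, (σ.comp (affineSimplex (convex_std n) w)) t ∈ (if b then U else V) := by
    intro t
    refine hb (affineSimplex_mem_ball _ w (fun i j => (hw i j).trans_lt ?_) t)
    rwa [← lt_div_iff₀ hD.1]
  cases b
  · exact Submodule.mem_sup_right (single_mem_inSet (by simpa using hmem) 1)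
  · exact Submodule.mem_sup_left (single_mem_inSet (by simpa using hmem) 1)

theorem subdiv_pow_mem_sup {n : ℕ} (N : ℕ) {x : SingChain X n} (hx : x ∈ inSet U n ⊔ inSet V n) :
    (subdiv n ^ N) x ∈ inSet U n ⊔ inSet V n := by
  obtain ⟨a, ha, b, hb, rfl⟩ := Submodule.mem_sup.1 hx
  rw [map_add]
  exact Submodule.add_mem_sup (subdiv_pow_mem_inSet N ha) (subdiv_pow_mem_inSet N hb)

theorem exists_subdiv_pow_mem (hU : IsOpen U) (hV : IsOpen V) {n : ℕ} {x : SingChain X n}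
    (hx : x ∈ inSet (U ∪ V) n) : ∃ N, (subdiv n ^ N) x ∈ inSet U n ⊔ inSet V n := by
  refine inSet_induction (p := fun x => ∃ N, (subdiv n ^ N) x ∈ inSet U n ⊔ inSet V n)
    ⟨0, by simp⟩ ?_ ?_ hx
  · rintro x y ⟨N, hN⟩ ⟨M, hM⟩
    refine ⟨N + M, ?_⟩
    rw [map_add]
    refine add_mem ?_ ?_
    · rw [add_comm N M, pow_add, Module.End.mul_apply]
      exact subdiv_pow_mem_sup M hN
    · rw [pow_add, Module.End.mul_apply]
      exact subdiv_pow_mem_sup N hM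
  · intro σ hσ c
    obtain ⟨N, hN⟩ := exists_subdiv_pow_single_mem hU hV σ hσ
    refine ⟨N, ?_⟩
    rw [single_eq_smul, map_smul]
    exact Submodule.smul_mem _ _ hN

/-- Every cycle in the union of two open sets is homologous to a sum of chains in these sets. -/
theorem exists_decomposition (hU : IsOpen U) (hV : IsOpen V) {n : ℕ} {z : SingChain X (n + 1)}
    (hz : z ∈ inSet (U ∪ V) (n + 1)) (hdz : d n z = 0) :
    ∃ a ∈ inSet U (n + 1), ∃ b ∈ inSet V (n + 1), ∃ e ∈ inSet (U ∪ V) (n + 2),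
      z = a + b + d (n + 1) e := by
  obtain ⟨N, hN⟩ := exists_subdiv_pow_mem hU hV hz
  obtain ⟨a, ha, b, hb, hab⟩ := Submodule.mem_sup.1 hN
  refine ⟨a, ha, b, hb, _, subdivPowHomotopy_mem_inSet N hz, ?_⟩
  rw [d_subdivPowHomotopy N hdz, hab]
  abel

/-- If a sum of chains in two open sets bounds in the union, it bounds a sum of such chains. -/
theorem exists_small_bounding (hU : IsOpen U) (hV : IsOpen V) {n : ℕ} {a b : SingChain X (n + 1)}
    (ha : a ∈ inSet U (n + 1)) (hb : b ∈ inSet V (n + 1)) {f : SingChain X (n + 2)}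
    (hf : f ∈ inSet (U ∪ V) (n + 2)) (hdf : d (n + 1) f = a + b) :
    ∃ g ∈ inSet U (n + 2), ∃ h ∈ inSet V (n + 2), d (n + 1) (g + h) = a + b := by
  obtain ⟨N, hN⟩ := exists_subdiv_pow_mem hU hV hf
  obtain ⟨g, hg, h, hh, hgh⟩ := Submodule.mem_sup.1 hN
  have hcyc : d n (a + b) = 0 := by rw [← hdf, d_d]
  -- The boundary of the subdivided `f` is the subdivision of `a + b`. The homotopies applied to `a`
  -- and to `b` stay in `U` and in `V` and restore `a + b` itself.
  refine ⟨g + subdivPowHomotopy (n + 1) N a, add_mem hg (subdivPowHomotopy_mem_inSet N ha),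
    h + subdivPowHomotopy (n + 1) N b, add_mem hh (subdivPowHomotopy_mem_inSet N hb), ?_⟩
  have : g + subdivPowHomotopy (n + 1) N a + (h + subdivPowHomotopy (n + 1) N b) =
      (subdiv (n + 2) ^ N) f + subdivPowHomotopy (n + 1) N (a + b) := by
    rw [← hgh, map_add]
    abel
  rw [this, map_add, d_subdiv_pow, d_subdivPowHomotopy N hcyc, hdf]
  abel

end SingChain

/-! ### Comparison with the singular chain complex -/

namespace SingChain

variable {X Y : Type} [TopologicalSpace X] [TopologicalSpace Y]

/-- The simplex of the singular simplicial set given by a continuous map. -/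
def toSimplex {n : ℕ} (f : C(StdSimp n, X)) :
    (TopCat.toSSet.obj (TopCat.of X)).obj (Opposite.op (SimplexCategory.mk n)) :=
  ((TopCat.of X).toSSetObjEquiv (Opposite.op (SimplexCategory.mk n))).symm f

theorem δ_toSimplex {n : ℕ} (f : C(StdSimp (n + 1), X)) (i : Fin (n + 2)) :
    (TopCat.toSSet.obj (TopCat.of X)).δ i (toSimplex f) = toSimplex (f.comp (stdFace i)) := rfl

/-- The comparison of formal singular chains with the singular chain complex. -/
def toSingularChains (n : ℕ) : SingChain X n →ₗ[ℤ] (singularChains X).X n :=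
  Finsupp.linearCombination ℤ fun f => singularSimplex f

theorem toSingularChains_single {n : ℕ} (f : C(StdSimp n, X)) :
    toSingularChains n (Finsupp.single f 1) = singularSimplex f := by
  rw [toSingularChains, Finsupp.linearCombination_single]
  exact @one_smul ℤ _ _ ((singularChains X).X n).isModule.toMulAction _

theorem d_singularSimplex {n : ℕ} (f : C(StdSimp (n + 1), X)) :
    (singularChains X).d (n + 1) n (singularSimplex f) =
      ∑ i : Fin (n + 2), (-1 : ℤ) ^ (i : ℕ) • singularSimplex (f.comp (stdFace i)) := by
  have := congrArg (fun g => g.hom (1 : ℤ)) (SSet.ιChainComplex_d (R := ModuleCat.of ℤ ℤ)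
    (X := TopCat.toSSet.obj (TopCat.of X)) (toSimplex f))
  refine (this.trans ?_)
  rw [ModuleCat.hom_sum]
  simp only [LinearMap.sum_apply]
  refine Finset.sum_congr rfl fun i _ => ?_
  rw [δ_toSimplex]
  rfl

theorem d_toSingularChains {n : ℕ} (x : SingChain X (n + 1)) :
    (singularChains X).d (n + 1) n (toSingularChains (n + 1) x) = toSingularChains n (d n x) := by
  refine TupleChain.hom_ext (f := ((singularChains X).d (n + 1) n).hom ∘ₗ toSingularChains (n + 1))
    (g := toSingularChains n ∘ₗ d n) (fun f => ?_) x
  rw [LinearMap.comp_apply, LinearMap.comp_apply, toSingularChains_single, d_single, map_sum]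
  refine (d_singularSimplex f).trans (Finset.sum_congr rfl fun i _ => ?_)
  rw [map_zsmul, toSingularChains_single]

/-- The inverse of the comparison map. -/
def ofSingularChains (n : ℕ) : (singularChains X).X n ⟶ ModuleCat.of ℤ (SingChain X n) :=
  (SSet.isColimitChainComplexXCofan (TopCat.toSSet.obj (TopCat.of X)) (ModuleCat.of ℤ ℤ) n).desc
    (Limits.Cofan.mk (ModuleCat.of ℤ (SingChain X n)) fun x => ModuleCat.ofHom
      (LinearMap.toSpanSingleton ℤ (SingChain X n) (Finsupp.single
        ((TopCat.of X).toSSetObjEquiv (Opposite.op (SimplexCategory.mk n)) x) 1)))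

theorem ι_ofSingularChains {n : ℕ}
    (x : (TopCat.toSSet.obj (TopCat.of X)).obj (Opposite.op (SimplexCategory.mk n))) :
    (TopCat.toSSet.obj (TopCat.of X)).ιChainComplex (R := ModuleCat.of ℤ ℤ) x ≫
      ofSingularChains n = ModuleCat.ofHom
      (LinearMap.toSpanSingleton ℤ (SingChain X n) (Finsupp.single
        ((TopCat.of X).toSSetObjEquiv (Opposite.op (SimplexCategory.mk n)) x) 1)) :=
  (SSet.isColimitChainComplexXCofan (TopCat.toSSet.obj (TopCat.of X))
    (ModuleCat.of ℤ ℤ) n).fac _ ⟨x⟩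

theorem ofSingularChains_singularSimplex {n : ℕ} (f : C(StdSimp n, X)) :
    (ofSingularChains n).hom (singularSimplex f) = Finsupp.single f 1 := by
  have := congrArg (fun g => g.hom (1 : ℤ)) (ι_ofSingularChains (toSimplex f))
  refine this.trans ?_
  simp [toSimplex]

theorem ofSingularChains_toSingularChains {n : ℕ} (x : SingChain X n) :
    (ofSingularChains n).hom (toSingularChains n x) = x := by
  refine TupleChain.hom_ext (f := (ofSingularChains n).hom ∘ₗ toSingularChains n)
    (g := LinearMap.id) (fun f => ?_) x
  rw [LinearMap.comp_apply, toSingularChains_single]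
  exact ofSingularChains_singularSimplex f

theorem toSingularChains_ofSingularChains {n : ℕ} (y : (singularChains X).X n) :
    toSingularChains n ((ofSingularChains n).hom y) = y := by
  have : ofSingularChains n ≫ ModuleCat.ofHom (toSingularChains n) = 𝟙 ((singularChains X).X n) := by
    refine SSet.chainComplex_hom_ext (X := TopCat.toSSet.obj (TopCat.of X))
      (R := ModuleCat.of ℤ ℤ) fun x => ?_
    refine ((Category.assoc _ _ _).symm.trans (congrArg (· ≫ ModuleCat.ofHom (toSingularChains n))
      (ι_ofSingularChains x))).trans (Eq.trans ?_ (Category.comp_id _).symm)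
    refine ModuleCat.hom_ext (LinearMap.ext_ring ?_)
    simp only [ModuleCat.hom_comp, LinearMap.comp_apply, ModuleCat.hom_ofHom,
      LinearMap.toSpanSingleton_apply, one_smul, toSingularChains_single]
    simp only [singularSimplex, Equiv.symm_apply_apply]
    rfl
  exact congrArg (fun g => g.hom y) this

theorem toSingularChains_injective (n : ℕ) :
    Function.Injective (toSingularChains (X := X) n) :=
  Function.LeftInverse.injective ofSingularChains_toSingularChains

/-! ### Acyclic sets -/

/-- The cycles of positive degree `n + 1` in a set bound in the set. -/
def AcyclicIn (S : Set X) (n : ℕ) : Prop :=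
  ∀ z ∈ inSet S (n + 1), d n z = 0 → ∃ y ∈ inSet S (n + 2), d (n + 1) y = z

/-- The identity is homotopic to a map factoring through a point, whose homology vanishes in
positive degrees. -/
theorem exactAt_of_contractible [ContractibleSpace X] (n : ℕ) :
    (singularChains X).ExactAt (n + 1) := by
  obtain ⟨x, ⟨H⟩⟩ := id_nullhomotopic X
  let F := ((singularChainComplexFunctor (ModuleCat.{0} ℤ)).obj (ModuleCat.of ℤ ℤ))
  let p : TopCat.of X ⟶ TopCat.of Unit := TopCat.ofHom ⟨fun _ => (), continuous_const⟩
  let i : TopCat.of Unit ⟶ TopCat.of X := TopCat.ofHom ⟨fun _ => x, continuous_const⟩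
  have H' : TopCat.Homotopy (𝟙 (TopCat.of X)) (p ≫ i) := H
  have h1 := H'.congr_homologyMap_singularChainComplexFunctor (ModuleCat.of ℤ ℤ) (n + 1)
  have h2 := isZero_singularHomologyFunctor_of_totallyDisconnectedSpace (ModuleCat.{0} ℤ) (n + 1)
    (ModuleCat.of ℤ ℤ) (TopCat.of Unit) (Nat.succ_ne_zero n)
  rw [HomologicalComplex.exactAt_iff_isZero_homology, Limits.IsZero.iff_id_eq_zero]
  have h3 : HomologicalComplex.homologyMap (F.map p) (n + 1) = 0 := h2.eq_zero_of_tgt _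
  have h4 : HomologicalComplex.homologyMap (F.map (p ≫ i)) (n + 1) = 0 := by
    rw [F.map_comp, HomologicalComplex.homologyMap_comp, h3, Limits.zero_comp]
  have h5 : HomologicalComplex.homologyMap (F.map (𝟙 (TopCat.of X))) (n + 1) = 𝟙 _ := by
    rw [F.map_id, HomologicalComplex.homologyMap_id]
  exact h5.symm.trans (h1.trans h4)

/-- A chain of simplices lying in `S` is the image of a chain of the subspace `S`. The lift is again
a cycle because the inclusion is injective on simplices, so it bounds in the subspace. -/
theorem acyclicIn_of_contractible {S : Set X} [ContractibleSpace S] (n : ℕ) : AcyclicIn S n := by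
  intro z hz hdz
  let i : C(S, X) := ⟨Subtype.val, continuous_subtype_val⟩
  have hlift : ∃ w : SingChain S (n + 1), map i (n + 1) w = z := by
    refine inSet_induction (p := fun z => ∃ w : SingChain S (n + 1), map i (n + 1) w = z)
      ⟨0, map_zero _⟩ ?_ ?_ hz
    · rintro _ _ ⟨w, rfl⟩ ⟨w', rfl⟩
      exact ⟨w + w', map_add _ _ _⟩
    · intro σ hσ c
      refine ⟨Finsupp.single ⟨fun t => ⟨σ t, hσ t⟩, by fun_prop⟩ c, ?_⟩
      rw [map_single]
      rfl
  obtain ⟨w, rfl⟩ := hlift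
  have hdw : d n w = 0 := by
    have : Function.Injective (map i n) := by
      refine Finsupp.mapDomain_injective fun f g h => ?_
      ext t
      exact congrArg (fun k : C(StdSimp n, X) => k t) h
    rw [← map_d] at hdz
    exact this (by rw [hdz, map_zero])
  have hex := exactAt_of_contractible (X := S) n
  rw [HomologicalComplex.exactAt_iff' _ (n + 2) (n + 1) n (by simp) (by simp)] at hex
  rw [ShortComplex.moduleCat_exact_iff] at hex
  obtain ⟨y, hy⟩ := hex (toSingularChains (n + 1) w)
    ((d_toSingularChains w).trans ((congrArg _ hdw).trans (map_zero _)))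
  refine ⟨map i (n + 2) ((ofSingularChains (n + 2)).hom y), ?_, ?_⟩
  · exact map_mem_inSet (S := Set.univ) i (fun x _ => x.2) (mem_inSet_univ _)
  · rw [← map_d]
    congr 1
    apply toSingularChains_injective
    rw [← d_toSingularChains]
    exact (congrArg _ (toSingularChains_ofSingularChains (n := n + 2) y)).trans hy

/-- A union of a family of acyclic sets which are open in the union and pairwise equal or disjoint
is acyclic. -/
theorem acyclicIn_of_components {ι : Type} {S : Set X} (K : ι → Set X) (hopen : ∀ k, IsOpen (K k))
    (hS : S = ⋃ k, K k) (hK : ∀ k l, (K k ∩ K l).Nonempty → K k = K l) {n : ℕ}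
    (hacyc : ∀ k, AcyclicIn (K k) n) : AcyclicIn S n := by
  classical
  intro z hz hdz
  -- The preimages of the components in a simplex are clopen, and a simplex is connected.
  have hin : ∀ {m : ℕ} (σ : C(StdSimp m, X)), (∀ t, σ t ∈ S) → ∃ k, ∀ t, σ t ∈ K k := by
    intro m σ hσ
    obtain ⟨k, hk⟩ := Set.mem_iUnion.1 (hS ▸ hσ (stdVertices m 0))
    refine ⟨k, fun t => ?_⟩
    have hclopen : IsClopen (σ ⁻¹' K k) := by
      refine ⟨⟨?_⟩, (hopen k).preimage σ.continuous⟩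
      have : (σ ⁻¹' K k)ᶜ = ⋃ l ∈ {l | K l ≠ K k}, σ ⁻¹' K l := by
        ext t
        simp only [Set.mem_compl_iff, Set.mem_preimage, Set.mem_iUnion, Set.mem_ofPred_eq,
          exists_prop]
        constructor
        · intro ht
          obtain ⟨l, hl⟩ := Set.mem_iUnion.1 (hS ▸ hσ t)
          exact ⟨l, fun h => ht (h ▸ hl), hl⟩
        · rintro ⟨l, hl, hlt⟩ ht
          exact hl (hK l k ⟨_, hlt, ht⟩)
      rw [this]
      exact isOpen_biUnion fun l _ => (hopen l).preimage σ.continuous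
    have := hclopen.eq_univ ⟨_, hk⟩
    exact (this ▸ Set.mem_univ t : t ∈ σ ⁻¹' K k)
  -- Induction on a finite collection of components containing the simplices of the cycle. It
  -- consists of sets rather than of indices, since different indices may give the same component.
  have key : ∀ s : Finset (Set X), ∀ z ∈ inSet S (n + 1), d n z = 0 →
      (∀ σ ∈ z.support, ∃ A ∈ s, ∃ k, A = K k ∧ ∀ t, σ t ∈ K k) →
      ∃ y ∈ inSet S (n + 2), d (n + 1) y = z := by
    intro s
    induction s using Finset.induction_on with
    | empty =>
      intro z _ _ h
      refine ⟨0, zero_mem _, ?_⟩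
      rw [map_zero]
      refine (Finsupp.support_eq_empty.1 (Finset.eq_empty_of_forall_notMem fun σ hσ => ?_)).symm
      simpa using h σ hσ
    | insert A s hA ih =>
      intro z hz hdz h
      let z₁ := z.filter fun σ => ∀ t, σ t ∈ A
      let z₂ := z.filter fun σ => ¬ ∀ t, σ t ∈ A
      have hz12 : z₁ + z₂ = z := Finsupp.filter_add_filter_not z _
      have hsub₁ : z₁.support ⊆ z.support := by
        rw [Finsupp.support_filter]; exact Finset.filter_subset _ _
      have hsub₂ : z₂.support ⊆ z.support := by
        rw [Finsupp.support_filter]; exact Finset.filter_subset _ _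
      have h₁ : z₁ ∈ inSet A (n + 1) := by
        rw [inSet, Finsupp.mem_supported]
        intro σ hσ
        rw [Finset.mem_coe, Finsupp.support_filter, Finset.mem_filter] at hσ
        exact hσ.2
      have h₂S : z₂ ∈ inSet S (n + 1) := by
        rw [inSet, Finsupp.mem_supported] at hz ⊢
        exact fun σ hσ => hz (hsub₂ hσ)
      have hs₂ : ∀ σ ∈ z₂.support, ∃ B ∈ s, ∃ k, B = K k ∧ ∀ t, σ t ∈ K k := by
        intro σ hσ
        obtain ⟨B, hB, k, rfl, hk⟩ := h σ (hsub₂ hσ)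
        rw [Finsupp.support_filter, Finset.mem_filter] at hσ
        refine ⟨K k, (Finset.mem_insert.1 hB).resolve_left fun hBA => hσ.2 ?_, k, rfl, hk⟩
        exact hBA ▸ hk
      by_cases hAk : ∃ k, A = K k
      · obtain ⟨k, rfl⟩ := hAk
        have h₂ : z₂ ∈ inSet (K k)ᶜ (n + 1) := by
          rw [inSet, Finsupp.mem_supported]
          intro σ hσ t ht
          obtain ⟨B, hB, l, rfl, hl⟩ := hs₂ σ hσ
          exact hA (hK k l ⟨_, ht, hl t⟩ ▸ hB)
        have hd : d n z₁ = -d n z₂ := by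
          rw [← hz12, map_add] at hdz
          exact eq_neg_of_add_eq_zero_left hdz
        -- The boundaries of the two parts are opposite and lie in disjoint sets, so each of them
        -- vanishes.
        have hd₁ : d n z₁ = 0 := by
          have h0 := mem_inSet_inter (d_mem_inSet h₁) (hd ▸ neg_mem (d_mem_inSet h₂))
          rw [Set.inter_compl_self, inSet, Finsupp.mem_supported] at h0
          refine Finsupp.support_eq_empty.1 (Finset.eq_empty_of_forall_notMem fun σ hσ => ?_)
          exact h0 hσ (stdVertices n 0)
        obtain ⟨y₁, hy₁, hdy₁⟩ := hacyc k z₁ h₁ hd₁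
        obtain ⟨y₂, hy₂, hdy₂⟩ := ih z₂ h₂S (by rw [hd₁] at hd; simpa using hd.symm) hs₂
        refine ⟨y₁ + y₂, add_mem (inSet_mono ?_ _ hy₁) hy₂, by rw [map_add, hdy₁, hdy₂, hz12]⟩
        rw [hS]
        exact Set.subset_iUnion _ _
      · refine ih z hz hdz fun σ hσ => ?_
        obtain ⟨B, hB, k, rfl, hk⟩ := h σ hσ
        exact ⟨K k, (Finset.mem_insert.1 hB).resolve_left fun hBA => hAk ⟨k, hBA.symm⟩, k, rfl, hk⟩
  have hz' := hz
  rw [inSet, Finsupp.mem_supported] at hz'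
  have hch : ∀ σ : C(StdSimp (n + 1), X), ∃ A : Set X, (∀ t, σ t ∈ S) →
      ∃ k, A = K k ∧ ∀ t, σ t ∈ K k := by
    intro σ
    by_cases hσ : ∀ t, σ t ∈ S
    · obtain ⟨k, hk⟩ := hin σ hσ
      exact ⟨K k, fun _ => ⟨k, rfl, hk⟩⟩
    · exact ⟨∅, fun h => absurd h hσ⟩
  choose A hA using hch
  exact key (z.support.image A) z hz hdz fun σ hσ =>
    ⟨_, Finset.mem_image_of_mem _ hσ, hA σ (hz' hσ)⟩

/-- The point of a singular `0`-simplex. -/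
def point (σ : C(StdSimp 0, X)) : X := σ (stdVertices 0 0)

open Classical in
/-- The sum of the coefficients of the points lying in a set. -/
def countIn (K : Set X) : SingChain X 0 →ₗ[ℤ] ℤ :=
  Finsupp.linearCombination ℤ fun σ => if point σ ∈ K then 1 else 0

open Classical in
theorem countIn_single (K : Set X) (σ : C(StdSimp 0, X)) :
    countIn K (Finsupp.single σ 1) = if point σ ∈ K then 1 else 0 := by
  simp [countIn]

instance : Subsingleton (StdSimp 0) := inferInstanceAs (Subsingleton (stdSimplex ℝ (Fin 1)))

theorem eq_const (σ : C(StdSimp 0, X)) : σ = ContinuousMap.const _ (point σ) := by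
  ext t
  exact congrArg σ (Subsingleton.elim _ _)

/-- A set which is open in `S`, with open complement in `S`, contains as many starting points as
end points of the paths in `S`. -/
theorem countIn_d {S K L : Set X} (hK : IsOpen K) (hL : IsOpen L) (hS : S ⊆ K ∪ L)
    (hKL : Disjoint K L) {x : SingChain X 1} (hx : x ∈ inSet S 1) : countIn K (d 0 x) = 0 := by
  refine inSet_induction (p := fun x => countIn K (d 0 x) = 0) (by simp) ?_ ?_ hx
  · intro x y hx hy
    rw [map_add, map_add, hx, hy, add_zero]
  · intro σ hσ c
    have hclopen : IsClopen (σ ⁻¹' K) := by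
      refine ⟨⟨?_⟩, hK.preimage σ.continuous⟩
      have : (σ ⁻¹' K)ᶜ = σ ⁻¹' L := by
        ext t
        constructor
        · intro ht
          exact (hS (hσ t)).resolve_left ht
        · intro ht ht'
          exact Set.disjoint_left.1 hKL ht' ht
      rw [this]
      exact hL.preimage σ.continuous
    rw [single_eq_smul, map_smul, map_smul, d_single, Fin.sum_univ_two, map_add, map_smul, map_smul,
      countIn_single, countIn_single]
    rcases isClopen_iff.1 hclopen with h | h
    · have h' : ∀ t, σ t ∉ K := fun t ht => (h ▸ ht : t ∈ (∅ : Set (StdSimp 1)))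
      simp [point, h']
    · have h' : ∀ t, σ t ∈ K := fun t => (h ▸ Set.mem_univ t : t ∈ σ ⁻¹' K)
      simp [point, h']

/-- Two points of a path connected set are homologous. -/
theorem exists_d_eq_sub {K : Set X} {x y : X} (h : JoinedIn K x y) :
    ∃ f ∈ inSet K 1, d 0 f = Finsupp.single (ContinuousMap.const _ y) 1 -
      Finsupp.single (ContinuousMap.const _ x) 1 := by
  let σ : C(StdSimp 1, X) := ⟨fun t => h.somePath (stdSimplexHomeomorphUnitInterval t), by fun_prop⟩
  refine ⟨Finsupp.single σ 1, single_mem_inSet (fun t => h.somePath_mem _) 1, ?_⟩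
  rw [d_single, Fin.sum_univ_two, eq_const (σ.comp _), eq_const (σ.comp (stdFace 1))]
  have h0 : stdFace 0 (stdVertices 0 0) = stdVertices 1 1 := stdSimplex.map_vertex _ _
  have h1 : stdFace 1 (stdVertices 0 0) = stdVertices 1 0 := stdSimplex.map_vertex _ _
  have hy : point (σ.comp (stdFace 0)) = y := by
    simp only [point, ContinuousMap.comp_apply, h0]
    exact (congrArg h.somePath stdSimplexHomeomorphUnitInterval_one).trans h.somePath.target
  have hx : point (σ.comp (stdFace 1)) = x := by
    simp only [point, ContinuousMap.comp_apply, h1]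
    exact (congrArg h.somePath stdSimplexHomeomorphUnitInterval_zero).trans h.somePath.source
  rw [hx, hy]
  simp [sub_eq_add_neg]

/-- A `0`-chain in a disjoint union of path connected sets bounds if each of them has total
coefficient zero. -/
theorem exists_d_eq_of_countIn {ι : Type} [Fintype ι] {S : Set X} (K : ι → Set X)
    (hS : S = ⋃ k, K k) (hdisj : ∀ k l, (K k ∩ K l).Nonempty → k = l)
    (hconn : ∀ k, IsPathConnected (K k)) {u : SingChain X 0} (hu : u ∈ inSet S 0)
    (h0 : ∀ k, countIn (K k) u = 0) : ∃ f ∈ inSet S 1, d 0 f = u := by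
  classical
  choose p hp using fun k => (hconn k).nonempty
  have hKS : ∀ k, K k ⊆ S := fun k => hS ▸ Set.subset_iUnion _ _
  -- Without the assumption on the counts, `u` is homologous to the combination of base points `p k`
  -- with the counts as coefficients; this statement is additive in `u`.
  suffices ∃ f ∈ inSet S 1,
      d 0 f = u - ∑ k, countIn (K k) u • Finsupp.single (ContinuousMap.const _ (p k)) 1 by
    obtain ⟨f, hf, hdf⟩ := this
    exact ⟨f, hf, by simpa [h0] using hdf⟩
  clear h0
  refine inSet_induction (p := fun u => ∃ f ∈ inSet S 1,
      d 0 f = u - ∑ k, countIn (K k) u • Finsupp.single (ContinuousMap.const _ (p k)) 1)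
      ⟨0, zero_mem _, by simp⟩ ?_ ?_ hu
  · rintro x y ⟨f, hf, hdf⟩ ⟨g, hg, hdg⟩
    refine ⟨f + g, add_mem hf hg, ?_⟩
    simp only [map_add, hdf, hdg, add_smul, Finset.sum_add_distrib]
    abel
  · intro σ hσ c
    obtain ⟨k, hk⟩ := Set.mem_iUnion.1 (hS ▸ hσ (stdVertices 0 0))
    obtain ⟨f, hf, hdf⟩ := exists_d_eq_sub ((hconn k).joinedIn (p k) (hp k) (point σ) hk)
    refine ⟨c • f, Submodule.smul_mem _ _ (inSet_mono (hKS k) _ hf), ?_⟩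
    have hl : ∀ l, countIn (K l) (Finsupp.single σ 1) = if l = k then 1 else 0 := by
      intro l
      rw [countIn_single]
      congr 1
      exact propext ⟨fun h => hdisj l k ⟨_, h, hk⟩, fun h => h ▸ hk⟩
    rw [map_smul, hdf, single_eq_smul σ c, ← eq_const σ]
    simp only [map_smul, hl, smul_sub, smul_eq_mul, mul_ite, mul_one, mul_zero, ite_smul, zero_smul,
      Finset.sum_ite_eq', Finset.mem_univ, if_true]

end SingChain

/-! ### Residues of two-dimensional cycles with respect to two open covers -/

namespace SingChain

variable {X : Type} [TopologicalSpace X]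

/-- Mayer–Vietoris: up to a boundary, a cycle is a sum `a + b` of chains in the two parts. The
boundary of `a` is a cycle in the overlap, so it bounds some `f` there, and `a - f` and `b + f` are
cycles in the two parts. -/
theorem acyclicIn_of_cover {A U V : Set X} (hA : IsOpen A) (hU : IsOpen U) (hV : IsOpen V)
    (hUV : U ∪ V = Set.univ) {n : ℕ} (h₁ : AcyclicIn (A ∩ U) (n + 1))
    (h₂ : AcyclicIn (A ∩ V) (n + 1)) (h₃ : AcyclicIn (A ∩ (U ∩ V)) n) : AcyclicIn A (n + 1) := by
  intro z hz hdz
  have hAUV : A ∩ U ∪ A ∩ V = A := by rw [← Set.inter_union_distrib_left, hUV, Set.inter_univ]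
  obtain ⟨a, ha, b, hb, e, he, rfl⟩ :=
    exists_decomposition (hA.inter hU) (hA.inter hV) (by rwa [hAUV]) hdz
  rw [map_add, d_d, add_zero, map_add] at hdz
  have hda : d (n + 1) a = -d (n + 1) b := eq_neg_of_add_eq_zero_left hdz
  have hmem : d (n + 1) a ∈ inSet (A ∩ (U ∩ V)) (n + 1) := by
    have := mem_inSet_inter (d_mem_inSet ha) (hda ▸ neg_mem (d_mem_inSet hb))
    exact inSet_mono (by intro x; simp; tauto) _ this
  obtain ⟨f, hf, hdf⟩ := h₃ _ hmem (d_d a)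
  obtain ⟨p, hp, hdp⟩ := h₁ (a - f)
    (sub_mem ha (inSet_mono (Set.inter_subset_inter_right _ Set.inter_subset_left) _ hf))
    (by rw [map_sub, hdf, sub_self])
  obtain ⟨q, hq, hdq⟩ := h₂ (b + f)
    (add_mem hb (inSet_mono (Set.inter_subset_inter_right _ Set.inter_subset_right) _ hf))
    (by rw [map_add, hdf, hda, add_neg_cancel])
  refine ⟨p + q + e, add_mem (add_mem (inSet_mono Set.inter_subset_left _ hp)
    (inSet_mono Set.inter_subset_left _ hq)) (hAUV ▸ he), ?_⟩
  rw [map_add, map_add, hdp, hdq]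
  abel

/-- The chain `u` is an iterated residue of the cycle `z` with respect to the covers `U₁, V₁` and
`U₂, V₂`. -/
def IsResidue (U₁ V₁ U₂ V₂ : Set X) (z : SingChain X 2) (u : SingChain X 0) : Prop :=
  ∃ a ∈ inSet U₁ 2, ∃ b ∈ inSet V₁ 2, ∃ e : SingChain X 3,
    ∃ a' ∈ inSet (U₁ ∩ V₁ ∩ U₂) 1, ∃ b' ∈ inSet (U₁ ∩ V₁ ∩ V₂) 1, ∃ e' ∈ inSet (U₁ ∩ V₁) 2,
      z = a + b + d 2 e ∧ d 1 a = a' + b' + d 1 e' ∧ u = d 0 a'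

variable {U₁ V₁ U₂ V₂ : Set X}

theorem IsResidue.sub_smul {z z' : SingChain X 2} {u u' : SingChain X 0}
    (h : IsResidue U₁ V₁ U₂ V₂ z u) (h' : IsResidue U₁ V₁ U₂ V₂ z' u') (n : ℤ) :
    IsResidue U₁ V₁ U₂ V₂ (z - n • z') (u - n • u') := by
  obtain ⟨a, ha, b, hb, e, a', ha', b', hb', e', he', h1, h2, h3⟩ := h
  obtain ⟨c, hc, f, hf, g, c', hc', f', hf', g', hg', k1, k2, k3⟩ := h'
  refine ⟨a - n • c, sub_mem ha (Submodule.smul_mem _ n hc), b - n • f,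
    sub_mem hb (Submodule.smul_mem _ n hf), e - n • g, a' - n • c',
    sub_mem ha' (Submodule.smul_mem _ n hc'), b' - n • f',
    sub_mem hb' (Submodule.smul_mem _ n hf'), e' - n • g',
    sub_mem he' (Submodule.smul_mem _ n hg'), ?_, ?_, ?_⟩
  · simp only [h1, k1, map_sub, map_smul, smul_add]
    abel
  · simp only [h2, k2, map_sub, map_smul, smul_add]
    abel
  · simp only [h3, k3, map_sub, map_smul]

/-- Decompose `z` along the first cover, and then the boundary of its first part, a cycle in `U₁ ∩
V₁`, along the second. -/
theorem exists_isResidue (hU₁ : IsOpen U₁) (hV₁ : IsOpen V₁) (hU₂ : IsOpen U₂) (hV₂ : IsOpen V₂)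
    (h₁ : U₁ ∪ V₁ = Set.univ) (h₂ : U₂ ∪ V₂ = Set.univ) {z : SingChain X 2} (hz : d 1 z = 0) :
    ∃ u, IsResidue U₁ V₁ U₂ V₂ z u := by
  obtain ⟨a, ha, b, hb, e, he, rfl⟩ :=
    exists_decomposition hU₁ hV₁ (by rw [h₁]; exact mem_inSet_univ z) hz
  rw [map_add, d_d, add_zero, map_add] at hz
  have hda : d 1 a = -d 1 b := eq_neg_of_add_eq_zero_left hz
  have hmem := mem_inSet_inter (d_mem_inSet ha) (hda ▸ neg_mem (d_mem_inSet hb))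
  have hW : U₁ ∩ V₁ ∩ U₂ ∪ U₁ ∩ V₁ ∩ V₂ = U₁ ∩ V₁ := by
    rw [← Set.inter_union_distrib_left, h₂, Set.inter_univ]
  obtain ⟨a', ha', b', hb', e', he', h⟩ := exists_decomposition ((hU₁.inter hV₁).inter hU₂)
    ((hU₁.inter hV₁).inter hV₂) (by rwa [hW]) (d_d a)
  exact ⟨_, a, ha, b, hb, e, a', ha', b', hb', e', hW ▸ he', rfl, h, rfl⟩

/-- If `a + b = d (g + h)` with `g` and `h` small, then `a - d g = -(b - d h)` lies in both sets and
has the same boundary as `a`. -/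
theorem exists_bounding_inter {A : Set X} (hA : IsOpen A) (hU₂ : IsOpen U₂) (hV₂ : IsOpen V₂)
    (h₂ : U₂ ∪ V₂ = Set.univ) {a b : SingChain X 1} (ha : a ∈ inSet (A ∩ U₂) 1)
    (hb : b ∈ inSet (A ∩ V₂) 1) {f : SingChain X 2} (hf : f ∈ inSet A 2) (hdf : d 1 f = a + b) :
    ∃ x ∈ inSet (A ∩ (U₂ ∩ V₂)) 1, d 0 x = d 0 a := by
  have hA' : A ∩ U₂ ∪ A ∩ V₂ = A := by rw [← Set.inter_union_distrib_left, h₂, Set.inter_univ]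
  obtain ⟨g, hg, h, hh, hgh⟩ :=
    exists_small_bounding (hA.inter hU₂) (hA.inter hV₂) ha hb (by rwa [hA']) hdf
  rw [map_add] at hgh
  have heq : a - d 1 g = -(b - d 1 h) := by
    rw [← sub_eq_zero]
    calc a - d 1 g - -(b - d 1 h) = a + b - (d 1 g + d 1 h) := by abel
      _ = 0 := by rw [hgh, sub_self]
  refine ⟨a - d 1 g, ?_, by rw [map_sub, d_d, sub_zero]⟩
  have := mem_inSet_inter (sub_mem ha (d_mem_inSet hg))
    (heq ▸ neg_mem (sub_mem hb (d_mem_inSet hh)))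
  exact inSet_mono (by intro x; simp; tauto) _ this

/-- The residue bounds in each of the four adjacent sets. -/
theorem IsResidue.bounds (hU₁ : IsOpen U₁) (hV₁ : IsOpen V₁) (hU₂ : IsOpen U₂) (hV₂ : IsOpen V₂)
    (h₂ : U₂ ∪ V₂ = Set.univ) {z : SingChain X 2} (hz : d 1 z = 0)
    {u : SingChain X 0} (h : IsResidue U₁ V₁ U₂ V₂ z u) :
    u ∈ inSet (U₁ ∩ V₁ ∩ (U₂ ∩ V₂)) 0 ∧
    (∃ x ∈ inSet (U₁ ∩ V₁ ∩ U₂) 1, d 0 x = u) ∧ (∃ x ∈ inSet (U₁ ∩ V₁ ∩ V₂) 1, d 0 x = u) ∧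
    (∃ x ∈ inSet (U₁ ∩ (U₂ ∩ V₂)) 1, d 0 x = u) ∧
    (∃ x ∈ inSet (V₁ ∩ (U₂ ∩ V₂)) 1, d 0 x = u) := by
  obtain ⟨a, ha, b, hb, e, a', ha', b', hb', e', he', rfl, h, rfl⟩ := h
  rw [map_add, d_d, add_zero, map_add] at hz
  have hdb : d 1 (-b) = a' + b' + d 1 e' := by
    rw [← h, map_neg, eq_neg_of_add_eq_zero_left hz]
  have hb'u : d 0 (-b') = d 0 a' := by
    have := d_d a
    rw [h, map_add, d_d, add_zero, map_add] at this
    rw [map_neg, eq_neg_of_add_eq_zero_left this]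
  have hU : U₁ ∩ V₁ ⊆ U₁ := Set.inter_subset_left
  have hV : U₁ ∩ V₁ ⊆ V₁ := Set.inter_subset_right
  refine ⟨?_, ⟨a', ha', rfl⟩, ⟨-b', neg_mem hb', hb'u⟩, ?_, ?_⟩
  · have := mem_inSet_inter (d_mem_inSet ha') (hb'u ▸ d_mem_inSet (neg_mem hb'))
    exact inSet_mono (by intro x; simp; tauto) _ this
  -- The chain `a' + b'` bounds `a - e'` in `U₁` and, in the next case, `-b - e'` in `V₁`.
  · exact exists_bounding_inter hU₁ hU₂ hV₂ h₂
      (inSet_mono (Set.inter_subset_inter_left _ hU) _ ha')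
      (inSet_mono (Set.inter_subset_inter_left _ hU) _ hb')
      (sub_mem ha (inSet_mono hU _ he')) (by rw [map_sub, h, add_sub_cancel_right])
  · exact exists_bounding_inter hV₁ hU₂ hV₂ h₂
      (inSet_mono (Set.inter_subset_inter_left _ hV) _ ha')
      (inSet_mono (Set.inter_subset_inter_left _ hV) _ hb')
      (sub_mem (neg_mem hb) (inSet_mono hV _ he')) (by rw [map_sub, hdb, add_sub_cancel_right])

/-- A cycle bounds if its residue bounds. -/
theorem IsResidue.exists_d_eq (hU₁ : IsOpen U₁) (hV₁ : IsOpen V₁) (hU₂ : IsOpen U₂)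
    (hV₂ : IsOpen V₂) (h₂ : U₂ ∪ V₂ = Set.univ)
    (hUU : AcyclicIn (U₁ ∩ U₂) 1) (hUV : AcyclicIn (U₁ ∩ V₂) 1) (hUW : AcyclicIn (U₁ ∩ (U₂ ∩ V₂)) 0)
    (hVU : AcyclicIn (V₁ ∩ U₂) 1) (hVV : AcyclicIn (V₁ ∩ V₂) 1) (hVW : AcyclicIn (V₁ ∩ (U₂ ∩ V₂)) 0)
    (hWU : AcyclicIn (U₁ ∩ V₁ ∩ U₂) 0) (hWV : AcyclicIn (U₁ ∩ V₁ ∩ V₂) 0)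
    {z : SingChain X 2} (hz : d 1 z = 0)
    {u : SingChain X 0} (h : IsResidue U₁ V₁ U₂ V₂ z u)
    (hu : ∃ f ∈ inSet (U₁ ∩ V₁ ∩ (U₂ ∩ V₂)) 1, d 0 f = u) : ∃ y, d 2 y = z := by
  obtain ⟨a, ha, b, hb, e, a', ha', b', hb'', e', he', rfl, h, rfl⟩ := h
  obtain ⟨f, hf, hdf⟩ := hu
  rw [map_add, d_d, add_zero, map_add] at hz
  have hdb : d 1 b = -d 1 a := eq_neg_of_add_eq_zero_right hz
  have hb' : d 0 b' = -d 0 a' := by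
    have := d_d a
    rw [h, map_add, d_d, add_zero, map_add] at this
    exact eq_neg_of_add_eq_zero_right this
  -- Correcting by `f` turns `a'` and `b'` into cycles in acyclic sets, so the boundary of `a`
  -- already bounds in `U₁ ∩ V₁`.
  obtain ⟨p, hp, hdp⟩ := hWU (a' - f)
    (sub_mem ha' (inSet_mono (Set.inter_subset_inter_right _ Set.inter_subset_left) _ hf))
    (by rw [map_sub, hdf, sub_self])
  obtain ⟨q, hq, hdq⟩ := hWV (b' + f)
    (add_mem hb'' (inSet_mono (Set.inter_subset_inter_right _ Set.inter_subset_right) _ hf))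
    (by rw [map_add, hdf, hb', neg_add_cancel])
  have hr : p + q + e' ∈ inSet (U₁ ∩ V₁) 2 :=
    add_mem (add_mem (inSet_mono Set.inter_subset_left _ hp)
      (inSet_mono Set.inter_subset_left _ hq)) he'
  have hdr : d 1 (p + q + e') = d 1 a := by
    rw [map_add, map_add, hdp, hdq, h]
    abel
  -- Subtracting this chain from `a` and adding it to `b` gives cycles in `U₁` and `V₁`, each of
  -- which is acyclic in degree two by the second cover.
  obtain ⟨y₁, -, hy₁⟩ := acyclicIn_of_cover hU₁ hU₂ hV₂ h₂ hUU hUV hUW (a - (p + q + e'))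
    (sub_mem ha (inSet_mono Set.inter_subset_left _ hr)) (by rw [map_sub, hdr, sub_self])
  obtain ⟨y₂, -, hy₂⟩ := acyclicIn_of_cover hV₁ hU₂ hV₂ h₂ hVU hVV hVW (b + (p + q + e'))
    (add_mem hb (inSet_mono Set.inter_subset_right _ hr))
    (by rw [map_add, hdr, hdb, neg_add_cancel])
  refine ⟨y₁ + y₂ + e, ?_⟩
  rw [map_add, map_add, hy₁, hy₂]
  abel

end SingChain

/-! ### The theta graph -/

namespace Theta

/-- The theta graph with four edges. -/
abbrev Pt : Type := (MultiGraph.theta 4).Space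

/-- The point with coordinate `x` on the edge `e`. -/
abbrev pt (e : Fin 4) (x : unitInterval) : Pt := (MultiGraph.theta 4).edgePt e x

theorem vertexPt_zero (e : Fin 4) : (MultiGraph.theta 4).vertexPt 0 = pt e 0 :=
  (Quot.sound (MultiGraph.Attach.left (Γ := MultiGraph.theta 4) e)).symm

theorem vertexPt_one (e : Fin 4) : (MultiGraph.theta 4).vertexPt 1 = pt e 1 :=
  (Quot.sound (MultiGraph.Attach.right (Γ := MultiGraph.theta 4) e)).symm

theorem pt_zero (e e' : Fin 4) : pt e 0 = pt e' 0 := by rw [← vertexPt_zero, ← vertexPt_zero]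

theorem pt_one (e e' : Fin 4) : pt e 1 = pt e' 1 := by rw [← vertexPt_one, ← vertexPt_one]

theorem continuous_pt (e : Fin 4) : Continuous (pt e) :=
  MultiGraph.continuous_edgePt _ e

/-- The coordinate of a point of the theta graph: all edges run from the vertex `0` to the
vertex `1`. -/
def height : Pt → unitInterval :=
  Quot.lift (fun p => match p with
    | Sum.inl v => if v.1 = 0 then 0 else 1
    | Sum.inr q => q.2) (by rintro _ _ (e | e) <;> simp [MultiGraph.theta])

@[simp]
theorem height_pt (e : Fin 4) (x : unitInterval) : height (pt e x) = x := rfl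

theorem continuous_height : Continuous height := by
  refine continuous_quot_lift _ ?_
  refine continuous_sum_dom.2 ⟨continuous_sigma fun v =>
    continuous_of_discreteTopology, ?_⟩
  exact continuous_sigma fun e => continuous_id

theorem exists_eq_pt (p : Pt) : ∃ e, p = pt e (height p) := by
  obtain ⟨⟨v, -⟩ | ⟨e, x⟩, rfl⟩ := Quot.exists_rep p
  · fin_cases v
    · exact ⟨0, vertexPt_zero 0⟩
    · exact ⟨0, vertexPt_one 0⟩
  · exact ⟨e, rfl⟩

/-- An edge containing a given point. -/
def edge (p : Pt) : Fin 4 := (exists_eq_pt p).choose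

theorem pt_edge (p : Pt) : pt (edge p) (height p) = p := (exists_eq_pt p).choose_spec.symm

theorem edge_eq_of_pt_eq {e e' : Fin 4} {x x' : unitInterval} (h : pt e x = pt e' x') (h0 : 0 < x)
    (h1 : x < 1) : e = e' := by
  have hx : x = x' := congrArg height h
  have := congrArg (MultiGraph.theta 4).normalForm h
  rw [MultiGraph.normalForm_edgePt, MultiGraph.normalForm_edgePt, ← hx, if_neg h0.ne', if_neg h1.ne,
    if_neg h0.ne', if_neg h1.ne] at this
  simpa using this

theorem edge_pt {e : Fin 4} {x : unitInterval} (h0 : 0 < x) (h1 : x < 1) : edge (pt e x) = e :=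
  edge_eq_of_pt_eq (pt_edge (pt e x)) h0 h1

/-- The interior of an edge. -/
def openEdge (e : Fin 4) : Set Pt := {p | 0 < height p ∧ height p < 1 ∧ edge p = e}

theorem isOpen_openEdge (e : Fin 4) : IsOpen (openEdge e) := by
  change IsOpen (Quot.mk _ ⁻¹' openEdge e)
  rw [isOpen_sum_iff]
  constructor
  · rw [isOpen_sigma_iff]
    intro v
    exact isOpen_discrete _
  · rw [isOpen_sigma_iff]
    intro e'
    have : (Sigma.mk e' ⁻¹' (Sum.inr ⁻¹' (Quot.mk (MultiGraph.theta 4).Attach ⁻¹' openEdge e))) =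
        {x : unitInterval | 0 < x ∧ x < 1 ∧ e' = e} := by
      ext x
      change (0 < x ∧ x < 1 ∧ edge (pt e' x) = e) ↔ _
      constructor
      · rintro ⟨h0, h1, h⟩
        exact ⟨h0, h1, by rw [← h, edge_pt h0 h1]⟩
      · rintro ⟨h0, h1, h⟩
        exact ⟨h0, h1, by rw [← h, edge_pt h0 h1]⟩
    erw [this]
    by_cases h : e' = e
    · simp only [h, and_true]
      exact isOpen_Ioo
    · simp [h]

theorem pt_mem_openEdge {e : Fin 4} {x : unitInterval} (h0 : 0 < x) (h1 : x < 1) :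
    pt e x ∈ openEdge e := ⟨h0, h1, edge_pt h0 h1⟩

theorem eq_of_height_eq {p q : Pt} (h : height p = height q) (he : edge p = edge q) : p = q := by
  rw [← pt_edge p, ← pt_edge q, h, he]

/-- Moving a point along its edge is continuous as long as it does not pass through a vertex. -/
theorem continuousAt_pt_edge {T : Type} [TopologicalSpace T] {q : T → Pt} {g : T → unitInterval}
    {t : T} (hq : ContinuousAt q t) (hg : ContinuousAt g t)
    (h : (0 < height (q t) ∧ height (q t) < 1) ∨ g t = 0 ∨ g t = 1) :
    ContinuousAt (fun t => pt (edge (q t)) (g t)) t := by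
  -- When the moved point is at a vertex, `edge (q s)` may jump near `t`. There are finitely many
  -- edges, and along each of them the moved point tends to the same vertex.
  have key : ∀ c, (∀ e e', pt e c = pt e' c) → g t = c →
      ContinuousAt (fun t => pt (edge (q t)) (g t)) t := by
    intro c hc hgt O hO
    replace hO : O ∈ nhds (pt (edge (q t)) c) := hgt ▸ hO
    have : ∀ e : Fin 4, ∀ᶠ s in nhds t, pt e (g s) ∈ O := by
      intro e
      have := (continuous_pt e).continuousAt.comp hg
      exact this (by rw [Function.comp_apply, hgt, hc e (edge (q t))]; exact hO)
    exact Filter.Eventually.mono (f := nhds t) (Filter.eventually_all.2 this) fun s hs => hs _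
  rcases h with ⟨h0, h1⟩ | h | h
  · have hev : ∀ᶠ s in nhds t, pt (edge (q t)) (g s) = pt (edge (q s)) (g s) := by
      have := hq ((isOpen_openEdge (edge (q t))).mem_nhds ⟨h0, h1, rfl⟩)
      filter_upwards [this] with s hs
      rw [hs.2.2]
    exact ((continuous_pt _).continuousAt.comp hg).congr hev
  · exact key 0 pt_zero h
  · exact key 1 pt_one h

end Theta

/-! ### Unordered configurations -/

section Conf

variable {k : ℕ} {X : Type} [TopologicalSpace X]

/-- The unordered configuration underlying an ordered one. -/
def toUnordered (y : OrderedConf k X) : UnorderedConf k X := Quotient.mk _ y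

theorem continuous_toUnordered : Continuous (toUnordered (k := k) (X := X)) := continuous_quot_mk

theorem toUnordered_eq_iff {y y' : OrderedConf k X} :
    toUnordered y = toUnordered y' ↔ ∃ π : Equiv.Perm (Fin k), ∀ i, y'.1 i = y.1 (π i) :=
  Quotient.eq

/-- The relabelling of an ordered configuration. -/
def OrderedConf.relabel (π : Equiv.Perm (Fin k)) (y : OrderedConf k X) : OrderedConf k X :=
  ⟨y.1 ∘ π, y.2.comp π.injective⟩

theorem OrderedConf.continuous_relabel (π : Equiv.Perm (Fin k)) :
    Continuous (OrderedConf.relabel (X := X) π) :=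
  Continuous.subtype_mk (f := fun y : OrderedConf k X => y.1 ∘ π)
    (continuous_pi fun i => (continuous_apply (π i)).comp continuous_subtype_val) _

theorem toUnordered_relabel (π : Equiv.Perm (Fin k)) (y : OrderedConf k X) :
    toUnordered (y.relabel π) = toUnordered y :=
  (toUnordered_eq_iff.2 ⟨π, fun _ => rfl⟩).symm

/-- The saturation of an open set is the union of its preimages under the relabellings. -/
theorem isOpenMap_toUnordered : IsOpenMap (toUnordered (k := k) (X := X)) := by
  intro O hO
  change IsOpen (toUnordered ⁻¹' (toUnordered '' O))
  have : toUnordered ⁻¹' (toUnordered '' O) =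
      ⋃ π : Equiv.Perm (Fin k), OrderedConf.relabel (X := X) π ⁻¹' O := by
    ext y
    simp only [Set.mem_preimage, Set.mem_image, Set.mem_iUnion]
    constructor
    · rintro ⟨x, hx, h⟩
      obtain ⟨π, hπ⟩ := toUnordered_eq_iff.1 h.symm
      refine ⟨π, ?_⟩
      convert hx
      exact Subtype.ext (funext fun i => (hπ i).symm)
    · rintro ⟨π, hπ⟩
      exact ⟨_, hπ, toUnordered_relabel π y⟩
  rw [this]
  exact isOpen_iUnion fun π => hO.preimage (OrderedConf.continuous_relabel π)

theorem toUnordered_surjective : Function.Surjective (toUnordered (k := k) (X := X)) :=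
  Quotient.mk_surjective

end Conf

namespace Theta

/-! ### Two open covers of the configuration space -/

/-- The space of unordered configurations of three points in the theta graph. -/
abbrev B₃ : Type := UnorderedConf 3 Pt

/-- The configurations without a point at the vertex `0`. -/
def avoid₀ : Set B₃ := toUnordered '' {y | ∀ i, 0 < height (y.1 i)}

/-- The configurations without a point at the vertex `1`. -/
def avoid₁ : Set B₃ := toUnordered '' {y | ∀ i, height (y.1 i) < 1}

/-- The configurations with a unique point closest to the vertex `0`. -/
def closest₀ : Set B₃ := toUnordered '' {y | ∃ i, ∀ j, j ≠ i → height (y.1 i) < height (y.1 j)}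

/-- The configurations with a unique point closest to the vertex `1`. -/
def closest₁ : Set B₃ := toUnordered '' {y | ∃ i, ∀ j, j ≠ i → height (y.1 j) < height (y.1 i)}

theorem continuous_height_apply (i : Fin 3) :
    Continuous fun y : OrderedConf 3 Pt => height (y.1 i) :=
  continuous_height.comp ((continuous_apply i).comp continuous_subtype_val)

theorem isOpen_avoid₀ : IsOpen avoid₀ := by
  refine isOpenMap_toUnordered _ ?_
  rw [Set.ofPred_forall]
  exact isOpen_iInter_of_finite fun i => isOpen_lt continuous_const (continuous_height_apply i)

theorem isOpen_avoid₁ : IsOpen avoid₁ := by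
  refine isOpenMap_toUnordered _ ?_
  rw [Set.ofPred_forall]
  exact isOpen_iInter_of_finite fun i => isOpen_lt (continuous_height_apply i) continuous_const

theorem isOpen_closest₀ : IsOpen closest₀ := by
  refine isOpenMap_toUnordered _ ?_
  simp only [Set.ofPred_exists, Set.ofPred_forall]
  exact isOpen_iUnion fun i => isOpen_iInter_of_finite fun j => isOpen_iInter_of_finite fun _ =>
    isOpen_lt (continuous_height_apply i) (continuous_height_apply j)

theorem isOpen_closest₁ : IsOpen closest₁ := by
  refine isOpenMap_toUnordered _ ?_
  simp only [Set.ofPred_exists, Set.ofPred_forall]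
  exact isOpen_iUnion fun i => isOpen_iInter_of_finite fun j => isOpen_iInter_of_finite fun _ =>
    isOpen_lt (continuous_height_apply j) (continuous_height_apply i)

theorem toUnordered_mem_avoid₀ {y : OrderedConf 3 Pt} :
    toUnordered y ∈ avoid₀ ↔ ∀ i, 0 < height (y.1 i) := by
  refine ⟨?_, fun h => ⟨y, h, rfl⟩⟩
  rintro ⟨x, hx, h⟩ i
  obtain ⟨π, hπ⟩ := toUnordered_eq_iff.1 h
  rw [hπ]
  exact hx _

theorem toUnordered_mem_avoid₁ {y : OrderedConf 3 Pt} :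
    toUnordered y ∈ avoid₁ ↔ ∀ i, height (y.1 i) < 1 := by
  refine ⟨?_, fun h => ⟨y, h, rfl⟩⟩
  rintro ⟨x, hx, h⟩ i
  obtain ⟨π, hπ⟩ := toUnordered_eq_iff.1 h
  rw [hπ]
  exact hx _

theorem toUnordered_mem_closest₀ {y : OrderedConf 3 Pt} :
    toUnordered y ∈ closest₀ ↔ ∃ i, ∀ j, j ≠ i → height (y.1 i) < height (y.1 j) := by
  refine ⟨?_, fun h => ⟨y, h, rfl⟩⟩
  rintro ⟨x, ⟨i, hi⟩, h⟩
  obtain ⟨π, hπ⟩ := toUnordered_eq_iff.1 h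
  refine ⟨π.symm i, fun j hj => ?_⟩
  rw [hπ, hπ, Equiv.apply_symm_apply]
  exact hi _ fun h => hj (by rw [← h, Equiv.symm_apply_apply])

theorem toUnordered_mem_closest₁ {y : OrderedConf 3 Pt} :
    toUnordered y ∈ closest₁ ↔ ∃ i, ∀ j, j ≠ i → height (y.1 j) < height (y.1 i) := by
  refine ⟨?_, fun h => ⟨y, h, rfl⟩⟩
  rintro ⟨x, ⟨i, hi⟩, h⟩
  obtain ⟨π, hπ⟩ := toUnordered_eq_iff.1 h
  refine ⟨π.symm i, fun j hj => ?_⟩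
  rw [hπ, hπ, Equiv.apply_symm_apply]
  exact hi _ fun h => hj (by rw [← h, Equiv.symm_apply_apply])

/-- A point at the vertex is the unique closest one, as the points are distinct. -/
theorem avoid_union_closest₀ : avoid₀ ∪ closest₀ = Set.univ := by
  refine Set.eq_univ_of_forall fun x => ?_
  obtain ⟨y, rfl⟩ := toUnordered_surjective x
  by_cases h : ∀ i, 0 < height (y.1 i)
  · exact Or.inl (toUnordered_mem_avoid₀.2 h)
  · right
    push Not at h
    obtain ⟨i, hi⟩ := h
    have hi0 : height (y.1 i) = 0 := le_antisymm hi unitInterval.nonneg'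
    refine toUnordered_mem_closest₀.2 ⟨i, fun j hj => ?_⟩
    rw [hi0]
    refine lt_of_le_of_ne unitInterval.nonneg' fun hj0 => hj (y.2 ?_)
    rw [← pt_edge (y.1 j), ← pt_edge (y.1 i), ← hj0, hi0, pt_zero]

theorem avoid_union_closest₁ : avoid₁ ∪ closest₁ = Set.univ := by
  refine Set.eq_univ_of_forall fun x => ?_
  obtain ⟨y, rfl⟩ := toUnordered_surjective x
  by_cases h : ∀ i, height (y.1 i) < 1
  · exact Or.inl (toUnordered_mem_avoid₁.2 h)
  · right
    push Not at h
    obtain ⟨i, hi⟩ := h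
    have hi0 : height (y.1 i) = 1 := le_antisymm unitInterval.le_one' hi
    refine toUnordered_mem_closest₁.2 ⟨i, fun j hj => ?_⟩
    rw [hi0]
    refine lt_of_le_of_ne unitInterval.le_one' fun hj0 => hj (y.2 ?_)
    rw [← pt_edge (y.1 j), ← pt_edge (y.1 i), hj0, hi0, pt_one]

/-! ### The components of the pieces -/

/-- The labelled configurations with the point `i` in the interior of the edge `ε i`, the points on
each edge being labelled in order. If `m₀` holds, the point `0` is the unique closest one to the
vertex `0`, and it may be at the vertex or on any edge unless `k₀` holds; likewise for the
point `2` and the vertex `1`. -/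
def region (k₀ m₀ k₁ m₁ : Prop) (ε : Fin 3 → Fin 4) : Set (OrderedConf 3 Pt) :=
  {y | (∀ i, (i = 0 → k₀) → (i = 2 → k₁) → y.1 i ∈ openEdge (ε i)) ∧
    (m₀ → ∀ j, j ≠ 0 → height (y.1 0) < height (y.1 j)) ∧
    (m₁ → ∀ j, j ≠ 2 → height (y.1 j) < height (y.1 2)) ∧
    ∀ i j, i < j → ε i = ε j → height (y.1 i) < height (y.1 j)}

/-- The piece of the configuration space cut out by membership in the chosen open sets. -/
def piece (k₀ m₀ k₁ m₁ : Prop) : Set B₃ :=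
  {x | (k₀ → x ∈ avoid₀) ∧ (m₀ → x ∈ closest₀) ∧ (k₁ → x ∈ avoid₁) ∧ (m₁ → x ∈ closest₁)}

variable {k₀ m₀ k₁ m₁ : Prop}

theorem isOpen_region (ε : Fin 3 → Fin 4) : IsOpen (region k₀ m₀ k₁ m₁ ε) := by
  simp only [region, Set.ofPred_and, Set.ofPred_forall]
  refine IsOpen.inter ?_ (IsOpen.inter ?_ (IsOpen.inter ?_ ?_))
  · exact isOpen_iInter_of_finite fun i => isOpen_iInter_of_finite fun _ =>
      isOpen_iInter_of_finite fun _ =>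
        (isOpen_openEdge _).preimage ((continuous_apply i).comp continuous_subtype_val)
  · exact isOpen_iInter_of_finite fun _ => isOpen_iInter_of_finite fun j =>
      isOpen_iInter_of_finite fun _ =>
        isOpen_lt (continuous_height_apply 0) (continuous_height_apply j)
  · exact isOpen_iInter_of_finite fun _ => isOpen_iInter_of_finite fun j =>
      isOpen_iInter_of_finite fun _ =>
        isOpen_lt (continuous_height_apply j) (continuous_height_apply 2)
  · exact isOpen_iInter_of_finite fun i => isOpen_iInter_of_finite fun j =>
      isOpen_iInter_of_finite fun _ => isOpen_iInter_of_finite fun _ =>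
        isOpen_lt (continuous_height_apply i) (continuous_height_apply j)

theorem exists_sorted (x : B₃) : ∃ y : OrderedConf 3 Pt, toUnordered y = x ∧
    Monotone fun i => height (y.1 i) := by
  obtain ⟨y, rfl⟩ := toUnordered_surjective x
  exact ⟨y.relabel (Tuple.sort fun i => height (y.1 i)), toUnordered_relabel _ _,
    Tuple.monotone_sort fun i => height (y.1 i)⟩

theorem toUnordered_mem_piece (h₀ : k₀ ∨ m₀) (h₁ : k₁ ∨ m₁) {ε : Fin 3 → Fin 4}
    {y : OrderedConf 3 Pt} (hy : y ∈ region k₀ m₀ k₁ m₁ ε) :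
    toUnordered y ∈ piece k₀ m₀ k₁ m₁ := by
  obtain ⟨hE, hm₀, hm₁, -⟩ := hy
  have hy1 := hE 1 (by simp) (by simp)
  refine ⟨fun hk => toUnordered_mem_avoid₀.2 fun i => ?_,
    fun hm => toUnordered_mem_closest₀.2 ⟨0, hm₀ hm⟩,
    fun hk => toUnordered_mem_avoid₁.2 fun i => ?_,
    fun hm => toUnordered_mem_closest₁.2 ⟨2, hm₁ hm⟩⟩
  -- A point `2` not confined to an edge lies above the point `1`, which is always in the interior
  -- of an edge.
  · by_cases h : i = 2 ∧ ¬k₁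
    · rw [h.1]
      exact hy1.1.trans (hm₁ (h₁.resolve_left h.2) 1 (by decide))
    · exact (hE i (fun _ => hk) fun h2 => not_not.1 fun hk => h ⟨h2, hk⟩).1
  · by_cases h : i = 0 ∧ ¬k₀
    · rw [h.1]
      exact (hm₀ (h₀.resolve_left h.2) 1 (by decide)).trans hy1.2.1
    · exact (hE i (fun h2 => not_not.1 fun hk => h ⟨h2, hk⟩) (fun _ => hk)).2.1

/-- Label the points by increasing height and let `ε` record their edges. Unique closest points then
get the labels `0` and `2`, and points on one edge have distinct heights. -/
theorem piece_eq_iUnion (h₀ : k₀ ∨ m₀) (h₁ : k₁ ∨ m₁) :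
    piece k₀ m₀ k₁ m₁ = ⋃ ε, toUnordered '' region k₀ m₀ k₁ m₁ ε := by
  ext x
  simp only [Set.mem_iUnion]
  constructor
  · intro hx
    obtain ⟨y, rfl, hmono⟩ := exists_sorted x
    obtain ⟨hk₀, hm₀, hk₁, hm₁⟩ := hx
    rw [toUnordered_mem_avoid₀] at hk₀
    rw [toUnordered_mem_closest₀] at hm₀
    rw [toUnordered_mem_avoid₁] at hk₁
    rw [toUnordered_mem_closest₁] at hm₁
    have hm₀' : m₀ → ∀ j, j ≠ 0 → height (y.1 0) < height (y.1 j) := by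
      intro hm
      obtain ⟨i, hi⟩ := hm₀ hm
      have : i = 0 := by
        by_contra h
        exact absurd (hi 0 (Ne.symm h)) (not_lt.2 (hmono (Fin.zero_le i)))
      exact this ▸ hi
    have hm₁' : m₁ → ∀ j, j ≠ 2 → height (y.1 j) < height (y.1 2) := by
      intro hm
      obtain ⟨i, hi⟩ := hm₁ hm
      have : i = 2 := by
        by_contra h
        exact absurd (hi 2 (Ne.symm h)) (not_lt.2 (hmono (Fin.le_last i)))
      exact this ▸ hi
    refine ⟨fun i => edge (y.1 i), y, ⟨fun i h0 h2 => ⟨?_, ?_, rfl⟩, hm₀', hm₁', ?_⟩, rfl⟩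
    · rcases h₀ with hk | hm
      · exact hk₀ hk i
      · by_cases hi : i = 0
        · exact hk₀ (h0 hi) i
        · exact lt_of_le_of_lt unitInterval.nonneg' (hm₀' hm i hi)
    · rcases h₁ with hk | hm
      · exact hk₁ hk i
      · by_cases hi : i = 2
        · exact hk₁ (h2 hi) i
        · exact lt_of_lt_of_le (hm₁' hm i hi) unitInterval.le_one'
    · intro i j hij he
      exact lt_of_le_of_ne (hmono hij.le) fun h => hij.ne (y.2 (eq_of_height_eq h he))
  · rintro ⟨ε, y, hy, rfl⟩
    exact toUnordered_mem_piece h₀ h₁ hy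

/-- The unique closest point depends only on the unordered configuration. -/
theorem perm_fixes₀ {ε ε' : Fin 3 → Fin 4} {y y' : OrderedConf 3 Pt}
    (hy : y ∈ region k₀ m₀ k₁ m₁ ε) (hy' : y' ∈ region k₀ m₀ k₁ m₁ ε') {π : Equiv.Perm (Fin 3)}
    (hπ : ∀ i, y'.1 i = y.1 (π i)) (hm : m₀) : π 0 = 0 := by
  by_contra h
  have h1 := hy.2.1 hm _ h
  have h2 := hy'.2.1 hm (π.symm 0) fun h' => h (by rw [← h', Equiv.apply_symm_apply, h'])
  rw [hπ, hπ, Equiv.apply_symm_apply] at h2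
  exact lt_asymm h1 h2

theorem perm_fixes₁ {ε ε' : Fin 3 → Fin 4} {y y' : OrderedConf 3 Pt}
    (hy : y ∈ region k₀ m₀ k₁ m₁ ε) (hy' : y' ∈ region k₀ m₀ k₁ m₁ ε') {π : Equiv.Perm (Fin 3)}
    (hπ : ∀ i, y'.1 i = y.1 (π i)) (hm : m₁) : π 2 = 2 := by
  by_contra h
  have h1 := hy.2.2.1 hm _ h
  have h2 := hy'.2.2.1 hm (π.symm 2) fun h' => h (by rw [← h', Equiv.apply_symm_apply, h'])
  rw [hπ, hπ, Equiv.apply_symm_apply] at h2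
  exact lt_asymm h1 h2

/-- A label not confined to an edge belongs to a unique closest point and is fixed by `π`. So `π`
permutes the confined labels, and the edge of a confined point is determined by the point. -/
theorem edge_of_perm (h₀ : k₀ ∨ m₀) (h₁ : k₁ ∨ m₁) {ε ε' : Fin 3 → Fin 4} {y y' : OrderedConf 3 Pt}
    (hy : y ∈ region k₀ m₀ k₁ m₁ ε) (hy' : y' ∈ region k₀ m₀ k₁ m₁ ε') {π : Equiv.Perm (Fin 3)}
    (hπ : ∀ i, y'.1 i = y.1 (π i)) {i : Fin 3} (hi0 : i = 0 → k₀) (hi2 : i = 2 → k₁) :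
    (π i = 0 → k₀) ∧ (π i = 2 → k₁) ∧ ε' i = ε (π i) := by
  have a0 : π i = 0 → k₀ := by
    intro h
    by_contra hk
    have := perm_fixes₀ hy hy' hπ (h₀.resolve_left hk)
    exact hk (hi0 (π.injective (h.trans this.symm)))
  have a2 : π i = 2 → k₁ := by
    intro h
    by_contra hk
    have := perm_fixes₁ hy hy' hπ (h₁.resolve_left hk)
    exact hk (hi2 (π.injective (h.trans this.symm)))
  refine ⟨a0, a2, ?_⟩
  have e1 := (hy.1 (π i) a0 a2).2.2
  have e2 := (hy'.1 i hi0 hi2).2.2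
  rw [hπ] at e2
  rw [← e1, ← e2]

/-- A permutation matching one configuration of each region carries all the constraints of one
region to those of the other, so it matches the whole regions. -/
theorem image_region_subset (h₀ : k₀ ∨ m₀) (h₁ : k₁ ∨ m₁) {ε ε' : Fin 3 → Fin 4}
    {y y' : OrderedConf 3 Pt}
    (hy : y ∈ region k₀ m₀ k₁ m₁ ε) (hy' : y' ∈ region k₀ m₀ k₁ m₁ ε') {π : Equiv.Perm (Fin 3)}
    (hπ : ∀ i, y'.1 i = y.1 (π i)) :
    toUnordered '' region k₀ m₀ k₁ m₁ ε ⊆ toUnordered '' region k₀ m₀ k₁ m₁ ε' := by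
  rintro _ ⟨z, hz, rfl⟩
  refine ⟨z.relabel π, ?_, toUnordered_relabel π z⟩
  have hm₀' : m₀ → ∀ j, j ≠ 0 → height (z.1 (π 0)) < height (z.1 (π j)) := by
    intro hm j hj
    have h := perm_fixes₀ hy hy' hπ hm
    rw [h]
    exact hz.2.1 hm _ fun h' => hj (π.injective (h'.trans h.symm))
  have hm₁' : m₁ → ∀ j, j ≠ 2 → height (z.1 (π j)) < height (z.1 (π 2)) := by
    intro hm j hj
    have h := perm_fixes₁ hy hy' hπ hm
    rw [h]
    exact hz.2.2.1 hm _ fun h' => hj (π.injective (h'.trans h.symm))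
  refine ⟨fun i hi0 hi2 => ?_, hm₀', hm₁', fun i j hij he => ?_⟩
  · obtain ⟨a0, a2, a⟩ := edge_of_perm h₀ h₁ hy hy' hπ hi0 hi2
    rw [a]
    exact hz.1 _ a0 a2
  · change height (z.1 (π i)) < height (z.1 (π j))
    by_cases c0 : i = 0 ∧ ¬k₀
    · rw [c0.1]
      exact hm₀' (h₀.resolve_left c0.2) j fun h => by simp [h] at hij
    by_cases c2 : j = 2 ∧ ¬k₁
    · rw [c2.1]
      exact hm₁' (h₁.resolve_left c2.2) i fun h => by
        rw [h] at hij
        exact absurd (Fin.le_last j) (not_le.2 hij)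
    obtain ⟨-, -, ei⟩ := edge_of_perm h₀ h₁ hy hy' hπ (i := i)
      (fun h => not_not.1 fun hk => c0 ⟨h, hk⟩) (fun h => by
        rw [h] at hij
        exact absurd (Fin.le_last j) (not_le.2 hij))
    obtain ⟨-, -, ej⟩ := edge_of_perm h₀ h₁ hy hy' hπ (i := j) (fun h => by simp [h] at hij)
      (fun h => not_not.1 fun hk => c2 ⟨h, hk⟩)
    have hlt := hy'.2.2.2 i j hij he
    rw [hπ, hπ] at hlt
    rw [ei, ej] at he
    -- The order of `π i` and `π j` is forced by the heights of the given `y` on their common edge;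
    -- the constraint on `z` then has the same direction.
    rcases lt_trichotomy (π i) (π j) with h | h | h
    · exact hz.2.2.2 _ _ h he
    · exact absurd (π.injective h) hij.ne
    · exact absurd (hy.2.2.2 _ _ h he.symm) (lt_asymm hlt)

theorem image_region_eq (h₀ : k₀ ∨ m₀) (h₁ : k₁ ∨ m₁) {ε ε' : Fin 3 → Fin 4}
    (h : (toUnordered '' region k₀ m₀ k₁ m₁ ε ∩ toUnordered '' region k₀ m₀ k₁ m₁ ε').Nonempty) :
    toUnordered '' region k₀ m₀ k₁ m₁ ε = toUnordered '' region k₀ m₀ k₁ m₁ ε' := by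
  obtain ⟨_, ⟨y, hy, rfl⟩, y', hy', h⟩ := h
  obtain ⟨π, hπ⟩ := toUnordered_eq_iff.1 h
  obtain ⟨ρ, hρ⟩ := toUnordered_eq_iff.1 h.symm
  exact (image_region_subset h₀ h₁ hy hy' hρ).antisymm (image_region_subset h₀ h₁ hy' hy hπ)

/-- If `i` is the least label moved by `π`, then `π i` and `π⁻¹ i` are both larger and have the same
edge as `i`. The order on this edge in `y` puts `y i` below `y (π i)`, and in `y'` it says the
opposite. -/
theorem injOn_region (h₀ : k₀ ∨ m₀) (h₁ : k₁ ∨ m₁) (ε : Fin 3 → Fin 4) :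
    Set.InjOn toUnordered (region k₀ m₀ k₁ m₁ ε) := by
  intro y hy y' hy' h
  obtain ⟨π, hπ⟩ := toUnordered_eq_iff.1 h
  have key : ∀ i, π i = i := by
    intro i
    induction i using WellFoundedLT.induction with
    | ind i ih =>
    by_contra hi
    have hfix : ∀ k, k < i → π.symm i ≠ k := fun k hk h => by
      rw [Equiv.symm_apply_eq, ih k hk] at h
      exact hk.ne h.symm
    have hlt : i < π i := lt_of_le_of_ne (not_lt.1 fun h => by
      have := ih _ h
      exact hi (π.injective this)) (Ne.symm hi)
    have hlt' : i < π.symm i := lt_of_le_of_ne (not_lt.1 fun h => hfix _ h rfl) fun h => by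
      rw [eq_comm, Equiv.symm_apply_eq] at h
      exact hi h.symm
    obtain ⟨-, -, e1⟩ := edge_of_perm h₀ h₁ hy hy' hπ (i := i)
      (fun h => by
        by_contra hk
        exact hi (h ▸ perm_fixes₀ hy hy' hπ (h₀.resolve_left hk)))
      (fun h => by
        rw [h] at hlt
        exact absurd (Fin.le_last _) (not_le.2 hlt))
    obtain ⟨-, -, e2⟩ := edge_of_perm h₀ h₁ hy hy' hπ (i := π.symm i)
      (fun h => by simp [h] at hlt')
      (fun h => by
        by_contra hk
        have := perm_fixes₁ hy hy' hπ (h₁.resolve_left hk)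
        rw [← h, Equiv.apply_symm_apply] at this
        exact hlt'.ne this)
    rw [Equiv.apply_symm_apply] at e2
    have l1 := hy.2.2.2 _ _ hlt e1
    have l2 := hy'.2.2.2 _ _ hlt' e2.symm
    rw [hπ, hπ, Equiv.apply_symm_apply] at l2
    exact lt_asymm l1 l2
  refine Subtype.ext (funext fun i => ?_)
  rw [hπ, key]

/-! ### Contractibility of the components -/

/-- The point dividing a segment in the unit interval in a given ratio. -/
def lin (s a b : unitInterval) : unitInterval :=
  ⟨(1 - s) * a + s * b, by
    have hs := s.2
    have ha := a.2
    have hb := b.2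
    constructor
    · have : (0 : ℝ) ≤ 1 - s := by linarith [hs.2]
      have := mul_nonneg this ha.1
      have := mul_nonneg hs.1 hb.1
      linarith
    · nlinarith [hs.1, hs.2, ha.2, hb.2, mul_nonneg hs.1 (sub_nonneg.2 hb.2),
        mul_nonneg (sub_nonneg.2 hs.2) (sub_nonneg.2 ha.2)]⟩

theorem lin_coe (s a b : unitInterval) : (lin s a b : ℝ) = (1 - s) * a + s * b := rfl

theorem lin_lt {s a b a' b' : unitInterval} (h : a < a') (h' : b < b') : lin s a b < lin s a' b' := by
  rw [← Subtype.coe_lt_coe] at *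
  rw [lin_coe, lin_coe]
  rcases s.2.1.eq_or_lt with hs | hs
  · simp [← hs, h]
  · have := mul_lt_mul_of_pos_left h' hs
    have := mul_le_mul_of_nonneg_left h.le (sub_nonneg.2 s.2.2)
    linarith

@[simp] theorem lin_zero (a b : unitInterval) : lin 0 a b = a := by
  ext; simp [lin_coe]

@[simp] theorem lin_one (a b : unitInterval) : lin 1 a b = b := by
  ext; simp [lin_coe]

@[simp] theorem lin_self (s a : unitInterval) : lin s a a = a := by
  ext; simp [lin_coe]; ring

theorem continuous_lin {T : Type} [TopologicalSpace T] {s a b : T → unitInterval} {t : T}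
    (hs : ContinuousAt s t) (ha : ContinuousAt a t) (hb : ContinuousAt b t) :
    ContinuousAt (fun t => lin (s t) (a t) (b t)) t := by
  refine Topology.IsInducing.subtypeVal.continuousAt_iff.2 ?_
  change ContinuousAt (fun t => (1 - (s t : ℝ)) * a t + s t * b t) t
  have hs' := continuousAt_subtype_val.comp hs
  have ha' := continuousAt_subtype_val.comp ha
  have hb' := continuousAt_subtype_val.comp hb
  exact ((continuousAt_const.sub hs').mul ha').add (hs'.mul hb')

open Classical in
/-- The coordinates of a standard configuration in a region. -/
def target (k₀ k₁ : Prop) : Fin 3 → unitInterval :=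
  ![if k₀ then ⟨1 / 4, by norm_num, by norm_num⟩ else 0, ⟨1 / 2, by norm_num, by norm_num⟩,
    if k₁ then ⟨3 / 4, by norm_num, by norm_num⟩ else 1]

theorem target_strictMono (k₀ k₁ : Prop) : StrictMono (target k₀ k₁) := by
  have h1 : target k₀ k₁ 0 < target k₀ k₁ 1 := by
    rw [← Subtype.coe_lt_coe]
    by_cases h : k₀ <;> simp [target, h]
    norm_num
  have h2 : target k₀ k₁ 1 < target k₀ k₁ 2 := by
    rw [← Subtype.coe_lt_coe]
    by_cases h : k₁ <;> simp [target, h] <;> norm_num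
  refine Fin.strictMono_iff_lt_succ.2 fun i => ?_
  fin_cases i
  · exact h1
  · exact h2

theorem target_pos {k₀ : Prop} (k₁ : Prop) {i : Fin 3} (h : i = 0 → k₀) : 0 < target k₀ k₁ i := by
  by_cases hi : i = 0
  · subst hi
    rw [← Subtype.coe_lt_coe]
    simp [target, h rfl]
  · exact lt_of_le_of_lt unitInterval.nonneg' (target_strictMono k₀ k₁ (Fin.pos_iff_ne_zero.2 hi))

theorem target_lt_one (k₀ : Prop) {k₁ : Prop} {i : Fin 3} (h : i = 2 → k₁) :
    target k₀ k₁ i < 1 := by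
  by_cases hi : i = 2
  · subst hi
    rw [← Subtype.coe_lt_coe]
    simp [target, h rfl]
    norm_num
  · exact lt_of_lt_of_le (target_strictMono k₀ k₁ (lt_of_le_of_ne (Fin.le_last i) hi))
      unitInterval.le_one'

theorem region_not_k₀ {ε : Fin 3 → Fin 4} {y : OrderedConf 3 Pt}
    (hy : y ∈ region k₀ m₀ k₁ m₁ ε) (hm : m₀) : height (y.1 0) < 1 :=
  (hy.2.1 hm 1 (by decide)).trans (hy.1 1 (by simp) (by simp)).2.1

theorem region_not_k₁ {ε : Fin 3 → Fin 4} {y : OrderedConf 3 Pt}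
    (hy : y ∈ region k₀ m₀ k₁ m₁ ε) (hm : m₁) : 0 < height (y.1 2) :=
  (hy.1 1 (by simp) (by simp)).1.trans (hy.2.2.1 hm 1 (by decide))

/-- Configurations of points with the coordinates of a region are in the region. -/
theorem exists_mem_region (h₀ : k₀ ∨ m₀) (h₁ : k₁ ∨ m₁) {ε : Fin 3 → Fin 4} {p : Fin 3 → Pt}
    (hE : ∀ i, (i = 0 → k₀) → (i = 2 → k₁) → p i ∈ openEdge (ε i))
    (hm₀ : m₀ → ∀ j, j ≠ 0 → height (p 0) < height (p j))
    (hm₁ : m₁ → ∀ j, j ≠ 2 → height (p j) < height (p 2))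
    (hε : ∀ i j, i < j → ε i = ε j → height (p i) < height (p j)) :
    ∃ h : Function.Injective p, ⟨p, h⟩ ∈ region k₀ m₀ k₁ m₁ ε := by
  have hne : ∀ i j, i < j → p i ≠ p j := by
    intro i j hij h
    have hh : ¬height (p i) < height (p j) := by rw [h]; exact lt_irrefl _
    by_cases c0 : i = 0 ∧ ¬k₀
    · rw [c0.1] at hh hij
      exact hh (hm₀ (h₀.resolve_left c0.2) j hij.ne')
    by_cases c2 : j = 2 ∧ ¬k₁
    · rw [c2.1] at hh hij
      exact hh (hm₁ (h₁.resolve_left c2.2) i hij.ne)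
    have e1 := hE i (fun h => not_not.1 fun hk => c0 ⟨h, hk⟩) (fun h => by
        rw [h] at hij
        exact absurd (Fin.le_last j) (not_le.2 hij))
    have e2 := hE j (fun h => by simp [h] at hij) (fun h => not_not.1 fun hk => c2 ⟨h, hk⟩)
    exact hh (hε i j hij (by rw [← e1.2.2, ← e2.2.2, h]))
  refine ⟨fun i j h => ?_, hE, hm₀, hm₁, hε⟩
  rcases lt_trichotomy i j with hij | hij | hij
  · exact absurd h (hne i j hij)
  · exact hij
  · exact absurd h.symm (hne j i hij)

/-- The target heights increase with the label, so linear interpolation preserves every strict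
inequality defining the region. -/
theorem contract_mem_region (h₀ : k₀ ∨ m₀) (h₁ : k₁ ∨ m₁) {ε : Fin 3 → Fin 4}
    (s : unitInterval) {y : OrderedConf 3 Pt} (hy : y ∈ region k₀ m₀ k₁ m₁ ε) :
    ∃ h : Function.Injective fun i => pt (edge (y.1 i)) (lin s (height (y.1 i)) (target k₀ k₁ i)),
      ⟨_, h⟩ ∈ region k₀ m₀ k₁ m₁ ε := by
  refine exists_mem_region h₀ h₁ ?_ ?_ ?_ ?_
  · intro i hi0 hi2
    obtain ⟨a, b, c⟩ := hy.1 i hi0 hi2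
    rw [c]
    refine pt_mem_openEdge ?_ ?_
    · simpa using lin_lt (s := s) a (target_pos k₁ hi0)
    · simpa using lin_lt (s := s) b (target_lt_one k₀ hi2)
  · intro hm j hj
    simp only [height_pt]
    exact lin_lt (hy.2.1 hm j hj) (target_strictMono k₀ k₁ (Fin.pos_iff_ne_zero.2 hj))
  · intro hm j hj
    simp only [height_pt]
    exact lin_lt (hy.2.2.1 hm j hj)
      (target_strictMono k₀ k₁ (lt_of_le_of_ne (Fin.le_last j) hj))
  · intro i j hij he
    simp only [height_pt]
    exact lin_lt (hy.2.2.2 i j hij he) (target_strictMono k₀ k₁ hij)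

theorem target_mem_region (h₀ : k₀ ∨ m₀) (h₁ : k₁ ∨ m₁) (ε : Fin 3 → Fin 4) :
    ∃ h : Function.Injective fun i => pt (ε i) (target k₀ k₁ i),
      ⟨_, h⟩ ∈ region k₀ m₀ k₁ m₁ ε := by
  refine exists_mem_region h₀ h₁ ?_ ?_ ?_ ?_
  · exact fun i hi0 hi2 => pt_mem_openEdge (target_pos k₁ hi0) (target_lt_one k₀ hi2)
  · exact fun _ j hj => target_strictMono k₀ k₁ (Fin.pos_iff_ne_zero.2 hj)
  · exact fun _ j hj => target_strictMono k₀ k₁ (lt_of_le_of_ne (Fin.le_last j) hj)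
  · exact fun i j hij _ => target_strictMono k₀ k₁ hij

/-- Contract by linear interpolation of the heights along the edges. A point free to change edges is
moved to its vertex, which makes its edge irrelevant. -/
theorem contractible_region (h₀ : k₀ ∨ m₀) (h₁ : k₁ ∨ m₁) (ε : Fin 3 → Fin 4) :
    ContractibleSpace (region k₀ m₀ k₁ m₁ ε) := by
  rw [contractible_iff_id_nullhomotopic]
  obtain ⟨hinj, hmem⟩ := target_mem_region h₀ h₁ ε
  refine ⟨⟨⟨_, hinj⟩, hmem⟩, ⟨⟨⟨fun q => ⟨⟨_, (contract_mem_region h₀ h₁ q.1 q.2.2).1⟩,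
    (contract_mem_region h₀ h₁ q.1 q.2.2).2⟩, ?_⟩, ?_, ?_⟩⟩⟩
  · refine Continuous.subtype_mk (Continuous.subtype_mk (continuous_pi fun i => ?_) _) _
    rw [continuous_iff_continuousAt]
    rintro ⟨s, y, hy⟩
    have hq : Continuous fun q : unitInterval × region k₀ m₀ k₁ m₁ ε => q.2.1.1 i :=
      (continuous_apply i).comp (continuous_subtype_val.comp
        (continuous_subtype_val.comp continuous_snd))
    refine continuousAt_pt_edge (q := fun q : unitInterval × region k₀ m₀ k₁ m₁ ε => q.2.1.1 i)
      hq.continuousAt (continuous_lin continuousAt_fst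
        (continuous_height.comp hq).continuousAt continuousAt_const) ?_
    -- Only an unconfined point can be at a vertex, and then the homotopy leaves it there.
    change (0 < height (y.1 i) ∧ height (y.1 i) < 1) ∨ lin s (height (y.1 i)) (target k₀ k₁ i) = 0 ∨
      lin s (height (y.1 i)) (target k₀ k₁ i) = 1
    by_cases c0 : i = 0 ∧ ¬k₀
    · obtain ⟨rfl, hk⟩ := c0
      rcases (unitInterval.nonneg' (t := height (y.1 0))).eq_or_lt with h | h
      · right; left
        rw [← h]
        simp [target, hk]
      · exact Or.inl ⟨h, region_not_k₀ hy (h₀.resolve_left hk)⟩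
    by_cases c2 : i = 2 ∧ ¬k₁
    · obtain ⟨rfl, hk⟩ := c2
      rcases (unitInterval.le_one' (t := height (y.1 2))).eq_or_lt with h | h
      · right; right
        rw [h]
        simp [target, hk]
      · exact Or.inl ⟨region_not_k₁ hy (h₁.resolve_left hk), h⟩
    have := hy.1 i (fun h => not_not.1 fun hk => c0 ⟨h, hk⟩)
      (fun h => not_not.1 fun hk => c2 ⟨h, hk⟩)
    exact Or.inl ⟨this.1, this.2.1⟩
  · rintro ⟨y, hy⟩
    refine Subtype.ext (Subtype.ext (funext fun i => ?_))
    simp only [lin_zero]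
    exact pt_edge _
  · rintro ⟨y, hy⟩
    refine Subtype.ext (Subtype.ext (funext fun i => ?_))
    simp only [lin_one]
    change pt (edge (y.1 i)) (target k₀ k₁ i) = pt (ε i) (target k₀ k₁ i)
    -- An unconfined point ends at its vertex, where the points of all edges coincide.
    by_cases c0 : i = 0 ∧ ¬k₀
    · obtain ⟨rfl, hk⟩ := c0
      simp only [target, hk, if_false, Matrix.cons_val_zero]
      exact pt_zero _ _
    by_cases c2 : i = 2 ∧ ¬k₁
    · obtain ⟨rfl, hk⟩ := c2
      simp only [target, hk, if_false, Matrix.cons_val]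
      exact pt_one _ _
    rw [(hy.1 i (fun h => not_not.1 fun hk => c0 ⟨h, hk⟩)
      (fun h => not_not.1 fun hk => c2 ⟨h, hk⟩)).2.2]

theorem contractible_image_region (h₀ : k₀ ∨ m₀) (h₁ : k₁ ∨ m₁) (ε : Fin 3 → Fin 4) :
    ContractibleSpace (toUnordered '' region k₀ m₀ k₁ m₁ ε : Set B₃) := by
  have := contractible_region h₀ h₁ ε
  let f : region k₀ m₀ k₁ m₁ ε → B₃ := fun y => toUnordered y.1
  have hf : Topology.IsOpenEmbedding f := Topology.IsOpenEmbedding.of_continuous_injective_isOpenMap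
    (continuous_toUnordered.comp continuous_subtype_val)
    (fun y y' h => Subtype.ext (injOn_region h₀ h₁ ε y.2 y'.2 h))
    (isOpenMap_toUnordered.comp (isOpen_region ε).isOpenMap_subtype_val)
  have hr : Set.range f = toUnordered '' region k₀ m₀ k₁ m₁ ε := by
    rw [Set.image_eq_range]
  rw [← hr]
  exact hf.toIsEmbedding.toHomeomorph.symm.contractibleSpace

/-- The images of the regions are open, contractible, and pairwise equal or disjoint. -/
theorem acyclicIn_piece (h₀ : k₀ ∨ m₀) (h₁ : k₁ ∨ m₁) (n : ℕ) :
    SingChain.AcyclicIn (piece k₀ m₀ k₁ m₁) n := by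
  refine SingChain.acyclicIn_of_components (fun ε => toUnordered '' region k₀ m₀ k₁ m₁ ε)
    (fun ε => isOpenMap_toUnordered _ (isOpen_region ε)) (piece_eq_iUnion h₀ h₁)
    (fun _ _ => image_region_eq h₀ h₁) fun ε => ?_
  have := contractible_image_region h₀ h₁ ε
  exact SingChain.acyclicIn_of_contractible n

end Theta

/-! ### Counting the points of a chain in a union of components -/

namespace SingChain

variable {X : Type} [TopologicalSpace X]

open Classical in
theorem countIn_eq_sum {ι : Type} [Fintype ι] {S : Set X} {K : ι → Set X} (hS : S = ⋃ k, K k)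
    (hdisj : ∀ k l, (K k ∩ K l).Nonempty → k = l) {L : Set X} {P : ι → Prop}
    (hP : ∀ k, ∀ x ∈ K k, x ∈ L ↔ P k) {u : SingChain X 0} (hu : u ∈ inSet S 0) :
    countIn L u = ∑ k with P k, countIn (K k) u := by
  refine inSet_induction (p := fun u => countIn L u = ∑ k with P k, countIn (K k) u) (by simp)
    ?_ ?_ hu
  · intro x y hx hy
    simp only [map_add, hx, hy, Finset.sum_add_distrib]
  · intro σ hσ c
    obtain ⟨k, hk⟩ := Set.mem_iUnion.1 (hS ▸ hσ (stdVertices 0 0))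
    have hl : ∀ l, point σ ∈ K l ↔ l = k :=
      fun l => ⟨fun h => hdisj l k ⟨_, h, hk⟩, fun h => h ▸ hk⟩
    rw [single_eq_smul]
    simp only [map_smul, ← Finset.smul_sum, countIn_single, hl]
    congr 1
    rw [Finset.sum_ite_eq', if_congr (hP k (point σ) hk) rfl rfl]
    simp

end SingChain

/-! ### The cells and the linear relations between the counts of a residue -/

namespace Theta

variable {k₀ m₀ k₁ m₁ : Prop}

theorem isOpen_image_region (ε : Fin 3 → Fin 4) :
    IsOpen (toUnordered '' region k₀ m₀ k₁ m₁ ε) := isOpenMap_toUnordered _ (isOpen_region ε)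

theorem countIn_image_region (h₀ : k₀ ∨ m₀) (h₁ : k₁ ∨ m₁) (ε : Fin 3 → Fin 4)
    {x : SingChain B₃ 1} (hx : x ∈ SingChain.inSet (piece k₀ m₀ k₁ m₁) 1) :
    SingChain.countIn (toUnordered '' region k₀ m₀ k₁ m₁ ε) (SingChain.d 0 x) = 0 := by
  refine SingChain.countIn_d (isOpen_image_region ε)
    (L := ⋃ ε' ∈ {ε' | toUnordered '' region k₀ m₀ k₁ m₁ ε' ≠ toUnordered '' region k₀ m₀ k₁ m₁ ε},
      toUnordered '' region k₀ m₀ k₁ m₁ ε')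
    (isOpen_biUnion fun ε' _ => isOpen_image_region ε') ?_ ?_ hx
  · intro x hx
    rw [piece_eq_iUnion h₀ h₁] at hx
    obtain ⟨ε', hε'⟩ := Set.mem_iUnion.1 hx
    by_cases h : toUnordered '' region k₀ m₀ k₁ m₁ ε' = toUnordered '' region k₀ m₀ k₁ m₁ ε
    · exact Or.inl (h ▸ hε')
    · exact Or.inr (Set.mem_biUnion (Set.mem_ofPred.2 h) hε')
  · rw [Set.disjoint_left]
    intro x hx hx'
    obtain ⟨ε', h, hε'⟩ := Set.mem_iUnion₂.1 hx'
    exact h (image_region_eq h₀ h₁ ⟨x, hε', hx⟩)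

/-- The component of the configurations with a unique point closest to, and not at, each vertex,
these points being on the edges `ε 0` and `ε 2` and the third point on the edge `ε 1`. -/
abbrev cell (ε : Fin 3 → Fin 4) : Set B₃ := toUnordered '' region True True True True ε

/-- Both extreme points are determined by the configuration, hence so is the middle one, and with
them the three edges. -/
theorem cell_disjoint (ε ε' : Fin 3 → Fin 4) (h : (cell ε ∩ cell ε').Nonempty) : ε = ε' := by
  obtain ⟨_, ⟨y, hy, rfl⟩, y', hy', h⟩ := h
  obtain ⟨π, hπ⟩ := toUnordered_eq_iff.1 h.symm
  have p0 := perm_fixes₀ hy hy' hπ trivial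
  have p2 := perm_fixes₁ hy hy' hπ trivial
  have p1 : π 1 = 1 := by
    have h0 : π 1 ≠ 0 := fun h => by simpa using π.injective (h.trans p0.symm)
    have h2 : π 1 ≠ 2 := fun h => by simpa using π.injective (h.trans p2.symm)
    omega
  have hall : ∀ i, π i = i := by
    intro i
    fin_cases i
    exacts [p0, p1, p2]
  funext i
  have := (edge_of_perm (Or.inl trivial) (Or.inl trivial) hy hy' hπ (i := i)
    (fun _ => trivial) (fun _ => trivial)).2.2
  rw [this, hall]

theorem cell_subset (ε : Fin 3 → Fin 4) : cell ε ⊆ toUnordered '' region k₀ m₀ k₁ m₁ ε := by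
  refine Set.image_mono fun y hy => ⟨fun i _ _ => hy.1 i (fun _ => trivial) fun _ => trivial,
    fun _ => hy.2.1 trivial, fun _ => hy.2.2.1 trivial, hy.2.2.2⟩

open Classical in
/-- A `0`-chain of configurations in the cells which bounds in a bigger piece has total coefficient
zero on the cells in each component of this piece. -/
theorem sum_countIn_eq_zero (h₀ : k₀ ∨ m₀) (h₁ : k₁ ∨ m₁) (ε : Fin 3 → Fin 4) {u : SingChain B₃ 0}
    (hu : u ∈ SingChain.inSet (piece True True True True) 0)
    (hx : ∃ x ∈ SingChain.inSet (piece k₀ m₀ k₁ m₁) 1, SingChain.d 0 x = u) :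
    ∑ ε' with toUnordered '' region k₀ m₀ k₁ m₁ ε' = toUnordered '' region k₀ m₀ k₁ m₁ ε,
      SingChain.countIn (cell ε') u = 0 := by
  obtain ⟨x, hx, rfl⟩ := hx
  rw [← countIn_image_region h₀ h₁ ε hx]
  symm
  refine SingChain.countIn_eq_sum (piece_eq_iUnion (Or.inl trivial) (Or.inl trivial)) cell_disjoint
    (fun ε' x hx' => ?_) hu
  constructor
  · intro h
    exact image_region_eq h₀ h₁ ⟨x, cell_subset ε' hx', h⟩
  · intro h
    rw [← h]
    exact cell_subset ε' hx'

theorem exists_d_eq_of_countIn_cell {u : SingChain B₃ 0}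
    (hu : u ∈ SingChain.inSet (piece True True True True) 0)
    (h0 : ∀ ε, SingChain.countIn (cell ε) u = 0) :
    ∃ f ∈ SingChain.inSet (piece True True True True) 1, SingChain.d 0 f = u := by
  refine SingChain.exists_d_eq_of_countIn cell (piece_eq_iUnion (Or.inl trivial) (Or.inl trivial))
    cell_disjoint (fun ε => ?_) hu h0
  have := contractible_image_region (k₀ := True) (m₀ := True) (k₁ := True) (m₁ := True)
    (Or.inl trivial) (Or.inl trivial) ε
  exact isPathConnected_iff_pathConnectedSpace.2 inferInstance

theorem exists_perm_of_image_region_eq (h₀ : k₀ ∨ m₀) (h₁ : k₁ ∨ m₁) {ε ε' : Fin 3 → Fin 4}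
    (h : toUnordered '' region k₀ m₀ k₁ m₁ ε' = toUnordered '' region k₀ m₀ k₁ m₁ ε) :
    ∃ π : Equiv.Perm (Fin 3), (m₀ → π 0 = 0) ∧ (m₁ → π 2 = 2) ∧
      ∀ i, (i = 0 → k₀) → (i = 2 → k₁) → ε' i = ε (π i) := by
  obtain ⟨hinj, hmem⟩ := target_mem_region h₀ h₁ ε
  have : toUnordered ⟨_, hinj⟩ ∈ toUnordered '' region k₀ m₀ k₁ m₁ ε := ⟨_, hmem, rfl⟩
  rw [← h] at this
  obtain ⟨y', hy', hyy'⟩ := this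
  obtain ⟨π, hπ⟩ := toUnordered_eq_iff.1 hyy'.symm
  exact ⟨π, perm_fixes₀ hmem hy' hπ, perm_fixes₁ hmem hy' hπ,
    fun i hi0 hi2 => (edge_of_perm h₀ h₁ hmem hy' hπ hi0 hi2).2.2⟩

/-- The total coefficient of a `0`-chain on the cell given by three edges. -/
def cellCount (u : SingChain B₃ 0) (i j k : Fin 4) : ℤ := SingChain.countIn (cell ![i, j, k]) u

theorem eq_vec (ε : Fin 3 → Fin 4) : ε = ![ε 0, ε 1, ε 2] := by
  funext i; fin_cases i <;> rfl

/-- Without a unique closest point at the vertex `0`, nothing orders the points `0` and `1` on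
distinct edges, so exchanging their labels carries a configuration of one region into the other. -/
theorem image_region_swap₀ {i j k : Fin 4} (h : i ≠ j) :
    toUnordered '' region True False True True ![j, i, k] =
      toUnordered '' region True False True True ![i, j, k] := by
  refine image_region_eq (Or.inl trivial) (Or.inl trivial) ?_
  obtain ⟨hinj, hmem⟩ := target_mem_region (k₀ := True) (m₀ := False) (k₁ := True) (m₁ := True)
    (Or.inl trivial) (Or.inl trivial) ![i, j, k]
  have hs : Equiv.swap (0 : Fin 3) 1 2 = 2 := by decide
  refine ⟨toUnordered ⟨_, hinj⟩, ⟨OrderedConf.relabel (Equiv.swap 0 1) ⟨_, hinj⟩,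
    ⟨?_, fun h => h.elim, ?_, ?_⟩, toUnordered_relabel _ _⟩, _, hmem, rfl⟩
  · intro a _ _
    have := hmem.1 (Equiv.swap 0 1 a) (fun _ => trivial) (fun _ => trivial)
    fin_cases a <;> simpa [OrderedConf.relabel, hs] using this
  · intro _ a ha
    have := hmem.2.2.1 trivial (Equiv.swap 0 1 a) (by revert ha; revert a; decide)
    fin_cases a <;> simpa [OrderedConf.relabel, hs] using this
  · intro a b hab he
    have h02 := hmem.2.2.1 trivial 0 (by decide)
    have h12 := hmem.2.2.1 trivial 1 (by decide)
    fin_cases a <;> fin_cases b <;> simp [OrderedConf.relabel, hs] at hab he h02 h12 ⊢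
    · exact absurd he.symm h
    · exact h12
    · exact h02

theorem image_region_swap₁ {i j k : Fin 4} (h : j ≠ k) :
    toUnordered '' region True True True False ![i, k, j] =
      toUnordered '' region True True True False ![i, j, k] := by
  refine image_region_eq (Or.inl trivial) (Or.inl trivial) ?_
  obtain ⟨hinj, hmem⟩ := target_mem_region (k₀ := True) (m₀ := True) (k₁ := True) (m₁ := False)
    (Or.inl trivial) (Or.inl trivial) ![i, j, k]
  have hs : Equiv.swap (1 : Fin 3) 2 0 = 0 := by decide
  refine ⟨toUnordered ⟨_, hinj⟩, ⟨OrderedConf.relabel (Equiv.swap 1 2) ⟨_, hinj⟩,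
    ⟨?_, ?_, fun h => h.elim, ?_⟩, toUnordered_relabel _ _⟩, _, hmem, rfl⟩
  · intro a _ _
    have := hmem.1 (Equiv.swap 1 2 a) (fun _ => trivial) (fun _ => trivial)
    fin_cases a <;> simpa [OrderedConf.relabel, hs] using this
  · intro _ a ha
    have := hmem.2.1 trivial (Equiv.swap 1 2 a) (by revert ha; revert a; decide)
    fin_cases a <;> simpa [OrderedConf.relabel, hs] using this
  · intro a b hab he
    have h02 := hmem.2.1 trivial 1 (by decide)
    have h12 := hmem.2.1 trivial 2 (by decide)
    fin_cases a <;> fin_cases b <;> simp [OrderedConf.relabel, hs] at hab he h02 h12 ⊢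
    · exact h12
    · exact h02
    · exact absurd he.symm h

/-- The edge of an unconfined point `0` enters only through the order on that edge, which being
closest implies anyway. -/
theorem region_forget₀ {i i' j k : Fin 4} :
    region False True True True ![i', j, k] = region False True True True ![i, j, k] := by
  have : ∀ i i' : Fin 4,
      region False True True True ![i', j, k] ⊆ region False True True True ![i, j, k] := by
    intro i i' y hy
    refine ⟨fun a ha0 ha2 => ?_, hy.2.1, hy.2.2.1, fun a b hab he => ?_⟩
    · have := hy.1 a ha0 ha2
      fin_cases a
      · simp at ha0
      · exact this
      · exact this
    · by_cases ha : a = 0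
      · rw [ha] at hab ⊢
        exact hy.2.1 trivial b hab.ne'
      · refine hy.2.2.2 a b hab ?_
        fin_cases a <;> fin_cases b <;> simp at ha hab he ⊢
        exact he
  exact (this _ _).antisymm (this _ _)

theorem region_forget₁ {i j k k' : Fin 4} :
    region True True False True ![i, j, k'] = region True True False True ![i, j, k] := by
  have : ∀ k k' : Fin 4,
      region True True False True ![i, j, k'] ⊆ region True True False True ![i, j, k] := by
    intro k k' y hy
    refine ⟨fun a ha0 ha2 => ?_, hy.2.1, hy.2.2.1, fun a b hab he => ?_⟩
    · have := hy.1 a ha0 ha2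
      fin_cases a
      · exact this
      · exact this
      · simp at ha2
    · by_cases hb : b = 2
      · rw [hb] at hab ⊢
        exact hy.2.2.1 trivial a hab.ne
      · refine hy.2.2.2 a b hab ?_
        fin_cases a <;> fin_cases b <;> simp at hb hab he ⊢
        exact he
  exact (this _ _).antisymm (this _ _)

variable {u : SingChain B₃ 0}

/-- Without `closest₀`, the component of `(i, j, k)` contains exactly the cells of `(i, j, k)` and
`(j, i, k)`, because a permutation fixing the label `2` is the identity or a swap. For `i = j` this
is a single cell, so its count vanishes on its own. -/
theorem cellCount_swap₀ (hu : u ∈ SingChain.inSet (piece True True True True) 0)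
    (hx : ∃ x ∈ SingChain.inSet (piece True False True True) 1, SingChain.d 0 x = u)
    (i j k : Fin 4) : cellCount u i i k = 0 ∧ cellCount u i j k + cellCount u j i k = 0 := by
  classical
  have hle : ∀ (i j : Fin 4) (ε : Fin 3 → Fin 4), toUnordered '' region True False True True ε =
      toUnordered '' region True False True True ![i, j, k] → ε = ![i, j, k] ∨ ε = ![j, i, k] := by
    intro i j ε hε
    obtain ⟨π, -, hπ, h⟩ := exists_perm_of_image_region_eq (Or.inl trivial) (Or.inl trivial) hε
    have h0 := h 0 (by simp) (by simp)
    have h1 := h 1 (by simp) (by simp)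
    have h2 := h 2 (by simp) (by simp)
    rw [hπ trivial] at h2
    have hp : ∀ π : Equiv.Perm (Fin 3), π 2 = 2 → (π 0 = 0 ∧ π 1 = 1) ∨ (π 0 = 1 ∧ π 1 = 0) := by
      decide
    rw [eq_vec ε, h0, h1, h2]
    rcases hp π (hπ trivial) with ⟨a, b⟩ | ⟨a, b⟩ <;> simp [a, b]
  have key : ∀ i j : Fin 4, i ≠ j → cellCount u i j k + cellCount u j i k = 0 := by
    intro i j hij
    have := sum_countIn_eq_zero (k₀ := True) (m₀ := False) (k₁ := True) (m₁ := True)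
      (Or.inl trivial) (Or.inl trivial) ![i, j, k] hu hx
    rw [← this]
    refine (Finset.sum_pair (f := fun ε => SingChain.countIn (cell ε) u)
      (a := ![i, j, k]) (b := ![j, i, k]) (by simp [hij])).symm.trans ?_
    refine Finset.sum_congr ?_ fun _ _ => rfl
    ext ε
    rw [Finset.mem_insert, Finset.mem_singleton, Finset.mem_filter_univ]
    refine ⟨?_, hle i j ε⟩
    rintro (rfl | rfl)
    · rfl
    · exact image_region_swap₀ hij
  have hii : ∀ i, cellCount u i i k = 0 := by
    intro i
    have := sum_countIn_eq_zero (k₀ := True) (m₀ := False) (k₁ := True) (m₁ := True)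
      (Or.inl trivial) (Or.inl trivial) ![i, i, k] hu hx
    rw [← this]
    refine (Finset.sum_singleton (f := fun ε => SingChain.countIn (cell ε) u)
      (a := ![i, i, k])).symm.trans (Finset.sum_congr ?_ fun _ _ => rfl)
    ext ε
    rw [Finset.mem_singleton, Finset.mem_filter_univ]
    exact ⟨fun h => h ▸ rfl, fun h => (hle i i ε h).elim id id⟩
  refine ⟨hii i, ?_⟩
  by_cases h : i = j
  · subst h
    rw [hii, add_zero]
  · exact key i j h

theorem cellCount_swap₁ (hu : u ∈ SingChain.inSet (piece True True True True) 0)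
    (hx : ∃ x ∈ SingChain.inSet (piece True True True False) 1, SingChain.d 0 x = u)
    (i j k : Fin 4) : cellCount u i j j = 0 ∧ cellCount u i j k + cellCount u i k j = 0 := by
  classical
  have hle : ∀ (j k : Fin 4) (ε : Fin 3 → Fin 4), toUnordered '' region True True True False ε =
      toUnordered '' region True True True False ![i, j, k] → ε = ![i, j, k] ∨ ε = ![i, k, j] := by
    intro j k ε hε
    obtain ⟨π, hπ, -, h⟩ := exists_perm_of_image_region_eq (Or.inl trivial) (Or.inl trivial) hε
    have h0 := h 0 (by simp) (by simp)
    have h1 := h 1 (by simp) (by simp)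
    have h2 := h 2 (by simp) (by simp)
    rw [hπ trivial] at h0
    have hp : ∀ π : Equiv.Perm (Fin 3), π 0 = 0 → (π 1 = 1 ∧ π 2 = 2) ∨ (π 1 = 2 ∧ π 2 = 1) := by
      decide
    rw [eq_vec ε, h0, h1, h2]
    rcases hp π (hπ trivial) with ⟨a, b⟩ | ⟨a, b⟩ <;> simp [a, b]
  have key : ∀ j k : Fin 4, j ≠ k → cellCount u i j k + cellCount u i k j = 0 := by
    intro j k hjk
    have := sum_countIn_eq_zero (k₀ := True) (m₀ := True) (k₁ := True) (m₁ := False)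
      (Or.inl trivial) (Or.inl trivial) ![i, j, k] hu hx
    rw [← this]
    refine (Finset.sum_pair (f := fun ε => SingChain.countIn (cell ε) u)
      (a := ![i, j, k]) (b := ![i, k, j]) (by simp [hjk])).symm.trans ?_
    refine Finset.sum_congr ?_ fun _ _ => rfl
    ext ε
    rw [Finset.mem_insert, Finset.mem_singleton, Finset.mem_filter_univ]
    refine ⟨?_, hle j k ε⟩
    rintro (rfl | rfl)
    · rfl
    · exact image_region_swap₁ hjk
  have hjj : ∀ j, cellCount u i j j = 0 := by
    intro j
    have := sum_countIn_eq_zero (k₀ := True) (m₀ := True) (k₁ := True) (m₁ := False)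
      (Or.inl trivial) (Or.inl trivial) ![i, j, j] hu hx
    rw [← this]
    refine (Finset.sum_singleton (f := fun ε => SingChain.countIn (cell ε) u)
      (a := ![i, j, j])).symm.trans (Finset.sum_congr ?_ fun _ _ => rfl)
    ext ε
    rw [Finset.mem_singleton, Finset.mem_filter_univ]
    exact ⟨fun h => h ▸ rfl, fun h => (hle j j ε h).elim id id⟩
  refine ⟨hjj j, ?_⟩
  by_cases h : j = k
  · subst h
    rw [hjj, add_zero]
  · exact key j k h

/-- When the closest point may pass through the vertex `0`, the cells with all possible first edges
lie in one component, and no other cell does. -/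
theorem cellCount_sum₀ (hu : u ∈ SingChain.inSet (piece True True True True) 0)
    (hx : ∃ x ∈ SingChain.inSet (piece False True True True) 1, SingChain.d 0 x = u)
    (j k : Fin 4) : ∑ i, cellCount u i j k = 0 := by
  classical
  have := sum_countIn_eq_zero (k₀ := False) (m₀ := True) (k₁ := True) (m₁ := True)
    (Or.inr trivial) (Or.inl trivial) ![0, j, k] hu hx
  rw [← this]
  refine Finset.sum_bij (fun i _ => ![i, j, k]) ?_ ?_ ?_ fun _ _ => rfl
  · intro i _
    rw [Finset.mem_filter_univ, region_forget₀]
  · intro i _ i' _ h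
    exact congrFun h 0
  · intro ε hε
    rw [Finset.mem_filter_univ] at hε
    obtain ⟨π, hπ0, hπ2, h⟩ := exists_perm_of_image_region_eq (Or.inr trivial) (Or.inl trivial) hε
    have h1 := h 1 (by simp) (by simp)
    have h2 := h 2 (by simp) (by simp)
    have hp : ∀ π : Equiv.Perm (Fin 3), π 0 = 0 → π 2 = 2 → π 1 = 1 := by decide
    rw [hp π (hπ0 trivial) (hπ2 trivial)] at h1
    rw [hπ2 trivial] at h2
    exact ⟨ε 0, Finset.mem_univ _, by rw [eq_vec ε, h1, h2]; rfl⟩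

theorem cellCount_sum₁ (hu : u ∈ SingChain.inSet (piece True True True True) 0)
    (hx : ∃ x ∈ SingChain.inSet (piece True True False True) 1, SingChain.d 0 x = u)
    (i j : Fin 4) : ∑ k, cellCount u i j k = 0 := by
  classical
  have := sum_countIn_eq_zero (k₀ := True) (m₀ := True) (k₁ := False) (m₁ := True)
    (Or.inl trivial) (Or.inr trivial) ![i, j, 0] hu hx
  rw [← this]
  refine Finset.sum_bij (fun k _ => ![i, j, k]) ?_ ?_ ?_ fun _ _ => rfl
  · intro k _
    rw [Finset.mem_filter_univ, region_forget₁]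
  · intro i _ i' _ h
    exact congrFun h 2
  · intro ε hε
    rw [Finset.mem_filter_univ] at hε
    obtain ⟨π, hπ0, hπ2, h⟩ := exists_perm_of_image_region_eq (Or.inl trivial) (Or.inr trivial) hε
    have h0 := h 0 (by simp) (by simp)
    have h1 := h 1 (by simp) (by simp)
    have hp : ∀ π : Equiv.Perm (Fin 3), π 0 = 0 → π 2 = 2 → π 1 = 1 := by decide
    rw [hp π (hπ0 trivial) (hπ2 trivial)] at h1
    rw [hπ0 trivial] at h0
    exact ⟨ε 2, Finset.mem_univ _, by rw [eq_vec ε, h0, h1]; rfl⟩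

end Theta

/-! ### Linear algebra of cycle coefficients, and chains of degree two and weight three -/

namespace Theta

open MultiGraph

/-- The linear relations satisfied by the coefficients of a two-dimensional cycle of weight three:
`c j m l` is the coefficient of the generator with the half-edges of `j` at the vertex `0` and of
`l` at the vertex `1` and a point on the edge `m`. -/
structure IsCycleCoeff (c : Fin 4 → Fin 4 → Fin 4 → ℤ) : Prop where
  swap₀ : ∀ j m l, c j m l + c m j l = 0
  swap₁ : ∀ j m l, c j m l + c j l m = 0
  sum₀ : ∀ m l, ∑ j, c j m l = 0
  sum₁ : ∀ j m, ∑ l, c j m l = 0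

namespace IsCycleCoeff

variable {c c' : Fin 4 → Fin 4 → Fin 4 → ℤ}

/-- The coefficients vanish on repeated indices, so a sum over one index with two distinct others
fixed has only two terms. Such sums relate the values on the four increasing triples to each other
up to sign. -/
theorem eq_zero (h : IsCycleCoeff c) (h0 : c 1 2 3 = 0) (j m l : Fin 4) : c j m l = 0 := by
  have d0 : ∀ i k, c i i k = 0 := fun i k => by have := h.swap₀ i i k; omega
  have d1 : ∀ i k, c i k k = 0 := fun i k => by have := h.swap₁ i k k; omega
  have d2 : ∀ i k, c i k i = 0 := fun i k => by have := h.swap₀ i k i; have := d1 k i; omega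
  have h1 : c 0 2 3 = 0 := by
    have := h.sum₀ 2 3
    simp only [Fin.sum_univ_four, d0, d2] at this
    omega
  have h2 : c 0 1 3 = 0 := by
    have := h.sum₀ 1 3
    have := h.swap₀ 2 1 3
    simp only [Fin.sum_univ_four, d0, d1, d2] at *
    omega
  have h3 : c 0 1 2 = 0 := by
    have := h.sum₀ 1 2
    have := h.swap₀ 3 1 2
    have := h.swap₁ 1 3 2
    simp only [Fin.sum_univ_four, d0, d1, d2] at *
    omega
  have s1 := h.swap₀ j m l
  have s2 := h.swap₁ j m l
  have s3 := h.swap₀ j l m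
  have s4 := h.swap₁ m j l
  have s5 := h.swap₀ m l j
  have s6 := h.swap₁ l j m
  fin_cases j <;> fin_cases m <;> fin_cases l <;>
    simp only [Fin.zero_eta, Fin.mk_one, Fin.reduceFinMk, d0, d1, d2, h0, h1, h2, h3, add_zero,
      zero_add] at * <;> omega

theorem sub_smul (h : IsCycleCoeff c) (h' : IsCycleCoeff c') (n : ℤ) :
    IsCycleCoeff fun j m l => c j m l - n * c' j m l where
  swap₀ j m l := by linear_combination h.swap₀ j m l - n * h'.swap₀ j m l
  swap₁ j m l := by linear_combination h.swap₁ j m l - n * h'.swap₁ j m l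
  sum₀ m l := by rw [Finset.sum_sub_distrib, ← Finset.mul_sum, h.sum₀, h'.sum₀]; simp
  sum₁ j m := by rw [Finset.sum_sub_distrib, ← Finset.mul_sum, h.sum₁, h'.sum₁]; simp

end IsCycleCoeff

/-- The coefficients of `thetaChain`. -/
def thetaCoeff (j m l : Fin 4) : ℤ :=
  ∑ σ : Equiv.Perm (Fin 4), (Equiv.Perm.sign σ : ℤ) *
    ((if m = 0 then 1 else 0) - (if m = σ 2 then 1 else 0)) *
      ((if j = σ 0 then 1 else 0) - (if j = 0 then 1 else 0)) *
        ((if l = σ 1 then 1 else 0) - (if l = 0 then 1 else 0))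

/-- That this value is a unit makes `A_2` a generator over the integers and not only up to finite
index. -/
theorem thetaCoeff_one_two_three : thetaCoeff 1 2 3 = -1 := by
  decide +kernel

/-- Up to sign the edge factor has the same form as the two half-edge factors, so composing `σ` with
a transposition exchanges two factors and changes the sign. The sums vanish because each factor is a
difference of two indicator functions. -/
theorem isCycleCoeff_thetaCoeff : IsCycleCoeff thetaCoeff where
  swap₀ j m l := by
    rw [add_eq_zero_iff_eq_neg, thetaCoeff, thetaCoeff, ← Finset.sum_neg_distrib,
      ← Equiv.sum_comp (Equiv.mulRight (Equiv.swap (0 : Fin 4) 2))]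
    refine Finset.sum_congr rfl fun σ _ => ?_
    have h1 : Equiv.swap (0 : Fin 4) 2 1 = 1 := by decide
    simp only [Equiv.coe_mulRight, Equiv.Perm.coe_mul, Function.comp_apply, h1,
      Equiv.swap_apply_left, Equiv.swap_apply_right, Equiv.Perm.sign_mul,
      Equiv.Perm.sign_swap (show (0 : Fin 4) ≠ 2 by decide), Units.val_mul, Units.val_neg,
      Units.val_one]
    ring
  swap₁ j m l := by
    rw [add_eq_zero_iff_eq_neg, thetaCoeff, thetaCoeff, ← Finset.sum_neg_distrib,
      ← Equiv.sum_comp (Equiv.mulRight (Equiv.swap (1 : Fin 4) 2))]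
    refine Finset.sum_congr rfl fun σ _ => ?_
    have h1 : Equiv.swap (1 : Fin 4) 2 0 = 0 := by decide
    simp only [Equiv.coe_mulRight, Equiv.Perm.coe_mul, Function.comp_apply, h1,
      Equiv.swap_apply_left, Equiv.swap_apply_right, Equiv.Perm.sign_mul,
      Equiv.Perm.sign_swap (show (1 : Fin 4) ≠ 2 by decide), Units.val_mul, Units.val_neg,
      Units.val_one]
    ring
  sum₀ m l := by
    simp only [thetaCoeff]
    rw [Finset.sum_comm]
    refine Finset.sum_eq_zero fun σ _ => ?_
    rw [← Finset.sum_mul, ← Finset.mul_sum, Finset.sum_sub_distrib]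
    simp
  sum₁ j m := by
    simp only [thetaCoeff]
    rw [Finset.sum_comm]
    refine Finset.sum_eq_zero fun σ _ => ?_
    rw [← Finset.mul_sum, Finset.sum_sub_distrib]
    simp

theorem IsCycleCoeff.eq_mul_thetaCoeff {c : Fin 4 → Fin 4 → Fin 4 → ℤ} (h : IsCycleCoeff c)
    (j m l : Fin 4) : c j m l = -c 1 2 3 * thetaCoeff j m l := by
  have := (h.sub_smul isCycleCoeff_thetaCoeff (-c 1 2 3)).eq_zero
    (by rw [thetaCoeff_one_two_three]; ring) j m l
  linarith

/-! ### The Świątkowski complex in degree two and weight three -/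

/-- The state with the half-edge of `f v` at each vertex `v`. -/
def halfState (f : Fin 2 → Fin 4) : (theta 4).State := fun v => some (some ⟨(f v, v), rfl⟩)

theorem halfState_injective : Function.Injective halfState := by
  intro f g h
  funext v
  have := congrFun h v
  simp only [halfState, Option.some.injEq] at this
  exact congrArg (fun h => h.1.1) this

theorem halfState_inj (j l j' l' : Fin 4) :
    halfState ![j, l] = halfState ![j', l'] ↔ j = j' ∧ l = l' := by
  rw [halfState_injective.eq_iff]
  constructor
  · intro h
    exact ⟨congrFun h 0, congrFun h 1⟩
  · rintro ⟨rfl, rfl⟩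
    rfl

theorem active_halfState (f : Fin 2 → Fin 4) : (halfState f).active = Finset.univ := by
  ext v
  simp only [State.active, Finset.mem_filter, Finset.mem_univ, true_and, iff_true]
  exact ⟨_, rfl⟩

theorem occupied_halfState (f : Fin 2 → Fin 4) : (halfState f).occupied = Finset.univ := by
  ext v
  simp [State.occupied, halfState]

theorem degree_halfState (f : Fin 2 → Fin 4) : (halfState f).degree = 2 := by
  simp [State.degree, active_halfState]

theorem weight_halfState (f : Fin 2 → Fin 4) : (halfState f).weight = 2 := by
  simp [State.weight, occupied_halfState]

theorem exists_halfState_eq {s : (theta 4).State} (h : ∀ v, ∃ h, s v = some (some h)) :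
    ∃ j l, s = halfState ![j, l] := by
  choose h hs using h
  refine ⟨(h 0).1.1, (h 1).1.1, ?_⟩
  have key : ∀ v, s v = some (some ⟨((h v).1.1, v), rfl⟩) := by
    intro v
    rw [hs v]
    congr 2
    apply Subtype.ext
    exact Prod.ext rfl (h v).2
  funext v
  fin_cases v
  · exact key 0
  · exact key 1

theorem exists_halfState_of_degree {s : (theta 4).State} (h : s.degree = 2) :
    ∃ j l, s = halfState ![j, l] := by
  refine exists_halfState_eq fun v => ?_
  have : s.active = Finset.univ := Finset.eq_univ_of_card _ (h.trans (Fintype.card_fin 2).symm)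
  have hv : v ∈ s.active := this ▸ Finset.mem_univ v
  simpa [State.active] using hv

/-- The chain of degree two and weight three with the given coefficients. -/
def halfChain (c : Fin 4 → Fin 4 → Fin 4 → ℤ) : (theta 4).SwiatkowskiModule :=
  ∑ j, ∑ l, Finsupp.single (halfState ![j, l]) (∑ m, MvPolynomial.C (c j m l) * MvPolynomial.X m)

theorem halfChain_apply (c : Fin 4 → Fin 4 → Fin 4 → ℤ) (j l : Fin 4) :
    halfChain c (halfState ![j, l]) = ∑ m, MvPolynomial.C (c j m l) * MvPolynomial.X m := by
  simp only [halfChain, Finsupp.coe_finsetSum, Finset.sum_apply, Finsupp.single_apply,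
    halfState_inj, ite_and]
  simp

theorem halfChain_apply_of_ne (c : Fin 4 → Fin 4 → Fin 4 → ℤ) {s : (theta 4).State}
    (hs : ∀ j l, s ≠ halfState ![j, l]) : halfChain c s = 0 := by
  simp only [halfChain, Finsupp.coe_finsetSum, Finset.sum_apply]
  exact Finset.sum_eq_zero fun j _ => Finset.sum_eq_zero fun l _ =>
    Finsupp.single_eq_of_ne (hs j l)

theorem halfChain_smul (n : ℤ) (c : Fin 4 → Fin 4 → Fin 4 → ℤ) :
    halfChain (fun j m l => n * c j m l) = n • halfChain c := by
  simp only [halfChain, Finset.smul_sum, Finsupp.smul_single, map_mul, mul_assoc]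
  simp only [zsmul_eq_mul, eq_intCast]

theorem single_halfState_mem (j m l : Fin 4) :
    Finsupp.single (halfState ![j, l]) (MvPolynomial.X m) ∈ (theta 4).bigraded 2 3 :=
  Submodule.subset_span ⟨_, Finsupp.single m 1, degree_halfState _, by
    rw [weight_halfState, Finsupp.degree_single], rfl⟩

theorem halfChain_eq (c : Fin 4 → Fin 4 → Fin 4 → ℤ) :
    halfChain c =
      ∑ j, ∑ l, ∑ m, c j m l • Finsupp.single (halfState ![j, l]) (MvPolynomial.X m) := by
  simp only [halfChain, Finsupp.single_finsetSum, Finsupp.smul_single, zsmul_eq_mul, eq_intCast]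

theorem halfChain_mem (c : Fin 4 → Fin 4 → Fin 4 → ℤ) : halfChain c ∈ (theta 4).bigraded 2 3 := by
  rw [halfChain_eq]
  exact sum_mem fun j _ => sum_mem fun l _ => sum_mem fun m _ =>
    Submodule.smul_mem _ _ (single_halfState_mem j m l)

/-- Degree two forces a half-edge at both vertices, and the remaining weight one is a single edge.
-/
theorem exists_halfChain_eq {x : (theta 4).SwiatkowskiModule} (hx : x ∈ (theta 4).bigraded 2 3) :
    ∃ c, x = halfChain c := by
  induction hx using Submodule.span_induction with
  | mem x hx =>
    obtain ⟨s, m, hs, hm, rfl⟩ := hx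
    obtain ⟨j, l, rfl⟩ := exists_halfState_of_degree hs
    rw [weight_halfState] at hm
    have hm' : m.degree = 1 := by omega
    obtain ⟨e, rfl⟩ : ∃ e, m = Finsupp.single e 1 := by
      obtain ⟨e, he⟩ := (Finsupp.range_single_one (σ := Fin 4)).ge hm'
      exact ⟨e, he.symm⟩
    refine ⟨fun j' m' l' => if j = j' ∧ l = l' ∧ e = m' then 1 else 0, ?_⟩
    rw [halfChain_eq]
    simp only [ite_and, ite_smul, zero_smul, one_smul]
    simp
    rfl
  | zero => exact ⟨0, by simp [halfChain]⟩
  | add x y _ _ hx hy =>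
    obtain ⟨c, rfl⟩ := hx
    obtain ⟨c', rfl⟩ := hy
    exact ⟨c + c', by simp only [halfChain_eq, Pi.add_apply, add_smul, Finset.sum_add_distrib]⟩
  | smul n x _ hx =>
    obtain ⟨c, rfl⟩ := hx
    exact ⟨_, (halfChain_smul n c).symm⟩

end Theta

/-! ### Cycles of the Świątkowski complex in degree two and weight three -/

namespace Theta

open MultiGraph

/-- The half-edge of `l` at the vertex `1`, with the state `x` at the vertex `0`. -/
def farState (x : (theta 4).LocalState 0) (l : Fin 4) : (theta 4).State :=
  Function.update (halfState ![0, l]) 0 x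

/-- The half-edge of `j` at the vertex `0`, with the state `x` at the vertex `1`. -/
def nearState (x : (theta 4).LocalState 1) (j : Fin 4) : (theta 4).State :=
  Function.update (halfState ![j, 0]) 1 x

theorem update_halfState_zero (x : (theta 4).LocalState 0) (j l : Fin 4) :
    Function.update (halfState ![j, l]) 0 x = farState x l := by
  funext v
  fin_cases v <;> rfl

theorem update_halfState_one (x : (theta 4).LocalState 1) (j l : Fin 4) :
    Function.update (halfState ![j, l]) 1 x = nearState x j := by
  funext v
  fin_cases v <;> rfl

theorem farState_inj (x y : (theta 4).LocalState 0) (l l' : Fin 4) :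
    farState x l = farState y l' ↔ x = y ∧ l = l' := by
  constructor
  · intro h
    refine ⟨congrFun h 0, ?_⟩
    have : (some (some ⟨(l, 1), rfl⟩) : (theta 4).LocalState 1) = some (some ⟨(l', 1), rfl⟩) :=
      congrFun h 1
    simp only [Option.some.injEq] at this
    exact congrArg (fun h => h.1.1) this
  · rintro ⟨rfl, rfl⟩
    rfl

theorem nearState_inj (x y : (theta 4).LocalState 1) (j j' : Fin 4) :
    nearState x j = nearState y j' ↔ x = y ∧ j = j' := by
  constructor
  · intro h
    refine ⟨congrFun h 1, ?_⟩
    have : (some (some ⟨(j, 0), rfl⟩) : (theta 4).LocalState 0) = some (some ⟨(j', 0), rfl⟩) :=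
      congrFun h 0
    simp only [Option.some.injEq] at this
    exact congrArg (fun h => h.1.1) this
  · rintro ⟨rfl, rfl⟩
    rfl

theorem farState_ne_nearState (x : (theta 4).LocalState 0) (y : (theta 4).LocalState 1)
    (hx : ∀ h, x ≠ some (some h)) (j l : Fin 4) : farState x l ≠ nearState y j := by
  intro h
  exact hx ⟨(j, 0), rfl⟩ (congrFun h 0)

theorem boundary_halfState (j l : Fin 4) :
    (halfState ![j, l]).boundary =
      Finsupp.single (farState none l) (MvPolynomial.X j) -
          Finsupp.single (farState (some none) l) 1 -
        (Finsupp.single (nearState none j) (MvPolynomial.X l) -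
          Finsupp.single (nearState (some none) j) 1) := by
  -- The exponents of the Koszul signs: the half-edge at the vertex `1` is preceded by one
  -- half-edge.
  have h0 : (Finset.univ.filter (· < (0 : Fin 2))).card = 0 := by decide
  have h1 : (Finset.univ.filter (· < (1 : Fin 2))).card = 1 := by decide
  rw [State.boundary, Fin.sum_univ_two, active_halfState, h0, h1]
  refine Eq.trans (b := (-1 : ℤ) ^ 0 • _ + (-1 : ℤ) ^ 1 • _) rfl ?_
  rw [pow_zero, one_smul, pow_one, neg_smul, one_smul, ← sub_eq_add_neg, update_halfState_zero,
    update_halfState_zero, update_halfState_one, update_halfState_one]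
  rfl

theorem boundary_halfChain (c : Fin 4 → Fin 4 → Fin 4 → ℤ) :
    (theta 4).boundary (halfChain c) = ∑ j, ∑ l, (∑ m, MvPolynomial.C (c j m l) * MvPolynomial.X m) •
      (Finsupp.single (farState none l) (MvPolynomial.X j) -
          Finsupp.single (farState (some none) l) 1 -
        (Finsupp.single (nearState none j) (MvPolynomial.X l) -
          Finsupp.single (nearState (some none) j) 1)) := by
  simp only [halfChain, map_sum, boundary, Finsupp.linearCombination_single, boundary_halfState]

theorem eq_zero_of_sum_X_eq_zero {c : Fin 4 → ℤ}
    (h : ∑ m, MvPolynomial.C (c m) * MvPolynomial.X m = (0 : MvPolynomial (Fin 4) ℤ)) (m : Fin 4) :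
    c m = 0 := by
  have := congrArg (MvPolynomial.eval (Pi.single m 1)) h
  simpa [Pi.single_apply] using this

/-- Polarization of a quadratic form: evaluate at sums of two basis vectors, equal ones giving the
diagonal coefficients. -/
theorem add_swap_eq_zero_of_sum_X_mul_X_eq_zero {c : Fin 4 → Fin 4 → ℤ}
    (h : ∑ j, (∑ m, MvPolynomial.C (c j m) * MvPolynomial.X m) * MvPolynomial.X j =
      (0 : MvPolynomial (Fin 4) ℤ)) (j m : Fin 4) : c j m + c m j = 0 := by
  have key : ∀ a b, c a a + c a b + (c b a + c b b) = 0 := by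
    intro a b
    have := congrArg (MvPolynomial.eval (Pi.single a 1 + Pi.single b 1)) h
    simp only [map_sum, map_mul, MvPolynomial.eval_C, MvPolynomial.eval_X, Pi.add_apply,
      Pi.single_apply, mul_add, mul_ite, mul_one, mul_zero, Finset.sum_add_distrib,
      Finset.sum_ite_eq', Finset.mem_univ, if_true, map_zero] at this
    linarith
  have h1 := key j m
  have h2 := key j j
  have h3 := key m m
  linarith

/-- The boundary is supported on states with one half-edge. Where the other vertex is empty, its
coefficient is a quadratic form in the edges and gives antisymmetry; where the other vertex is
occupied, it is a linear form and gives a vanishing sum. -/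
theorem isCycleCoeff_of_boundary_eq_zero {c : Fin 4 → Fin 4 → Fin 4 → ℤ}
    (h : (theta 4).boundary (halfChain c) = 0) : IsCycleCoeff c := by
  rw [boundary_halfChain] at h
  have hne : ∀ x y (_ : x = none ∨ x = some none) j l, ¬ farState x l = nearState y j := by
    rintro x y hx j l
    refine farState_ne_nearState x y ?_ j l
    rintro h rfl
    simp at hx
  have hne' : ∀ x y (_ : x = none ∨ x = some none) j l, ¬ nearState y j = farState x l :=
    fun x y hx j l h => hne x y hx j l h.symm
  have key : ∀ s, _ := fun s => DFunLike.congr_fun h s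
  simp only [Finsupp.coe_finsetSum, Finset.sum_apply, Finsupp.smul_apply, Finsupp.sub_apply,
    Finsupp.single_apply, smul_eq_mul, Finsupp.coe_zero, Pi.zero_apply] at key
  refine ⟨fun j m l => ?_, fun j m l => ?_, fun m l => ?_, fun j m => ?_⟩
  · have := key (farState none l)
    simp [farState_inj, hne', mul_ite] at this
    exact add_swap_eq_zero_of_sum_X_mul_X_eq_zero (c := fun j m => c j m l) this j m
  · have := key (nearState none j)
    simp [nearState_inj, hne, mul_ite] at this
    rw [add_comm]
    exact add_swap_eq_zero_of_sum_X_mul_X_eq_zero (c := fun l m => c j m l) this m l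
  · have := key (farState (some none) l)
    simp [farState_inj, hne', mul_ite] at this
    rw [Finset.sum_comm] at this
    refine eq_zero_of_sum_X_eq_zero (c := fun m => ∑ j, c j m l) ?_ m
    simpa [Finset.sum_mul] using this
  · have := key (nearState (some none) j)
    simp [nearState_inj, hne, mul_ite] at this
    rw [Finset.sum_comm] at this
    refine eq_zero_of_sum_X_eq_zero (c := fun m => ∑ l, c j m l) ?_ m
    simpa [Finset.sum_mul] using this

theorem sum_mul_X_eq_zero {c : Fin 4 → Fin 4 → ℤ} (h : ∀ j m, c j m + c m j = 0) :
    ∑ j, (∑ m, MvPolynomial.C (c j m) * MvPolynomial.X m) * MvPolynomial.X j =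
      (0 : MvPolynomial (Fin 4) ℤ) := by
  rw [← self_eq_neg]
  simp only [Finset.sum_mul]
  conv_lhs => rw [Finset.sum_comm]
  rw [← Finset.sum_neg_distrib]
  refine Finset.sum_congr rfl fun j _ => ?_
  rw [← Finset.sum_neg_distrib]
  refine Finset.sum_congr rfl fun m _ => ?_
  rw [eq_neg_of_add_eq_zero_left (h m j), map_neg]
  ring

theorem IsCycleCoeff.boundary_eq_zero {c : Fin 4 → Fin 4 → Fin 4 → ℤ} (h : IsCycleCoeff c) :
    (theta 4).boundary (halfChain c) = 0 := by
  rw [boundary_halfChain]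
  simp only [smul_sub, Finset.sum_sub_distrib, Finsupp.smul_single, smul_eq_mul, mul_one]
  rw [Finset.sum_comm]
  conv_lhs =>
    enter [1, 2]
    rw [Finset.sum_comm]
  simp only [← Finsupp.single_finsetSum]
  have h1 : ∀ l, ∑ j, (∑ m, MvPolynomial.C (c j m l) * MvPolynomial.X m) * MvPolynomial.X j =
      (0 : MvPolynomial (Fin 4) ℤ) := fun l => sum_mul_X_eq_zero fun j m => h.swap₀ j m l
  have h2 : ∀ j, ∑ l, (∑ m, MvPolynomial.C (c j m l) * MvPolynomial.X m) * MvPolynomial.X l =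
      (0 : MvPolynomial (Fin 4) ℤ) := fun j => sum_mul_X_eq_zero (c := fun l m => c j m l)
        fun l m => by rw [add_comm]; exact h.swap₁ j l m
  have h3 : ∀ l, ∑ j, ∑ m, MvPolynomial.C (c j m l) * MvPolynomial.X m =
      (0 : MvPolynomial (Fin 4) ℤ) := fun l => by
    rw [Finset.sum_comm]
    simp only [← Finset.sum_mul, ← map_sum, h.sum₀, map_zero, zero_mul, Finset.sum_const_zero]
  have h4 : ∀ j, ∑ l, ∑ m, MvPolynomial.C (c j m l) * MvPolynomial.X m =
      (0 : MvPolynomial (Fin 4) ℤ) := fun j => by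
    rw [Finset.sum_comm]
    simp only [← Finset.sum_mul, ← map_sum, h.sum₁, map_zero, zero_mul, Finset.sum_const_zero]
  simp only [h1, h2, h3, h4, Finsupp.single_zero, Finset.sum_const_zero, sub_zero]

theorem thetaHalf_apply (i : Fin 2) (j : Fin 4) (h : (theta 4).HalfEdgeAt i) :
    thetaHalf i j (some (some h)) = if h.1.1 = j then 1 else 0 := by
  rw [thetaHalf, HalfEdgeAt.toLocal, Finsupp.single_apply]
  refine if_congr ⟨?_, ?_⟩ rfl rfl
  · intro e
    simp only [Option.some.injEq] at e
    exact congrArg (fun h => h.1.1) e.symm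
  · rintro rfl
    congr 2
    exact Subtype.ext (Prod.ext rfl h.2.symm)

theorem thetaHalf_halfState (i : Fin 2) (j : Fin 4) (f : Fin 2 → Fin 4) :
    thetaHalf i j (halfState f i) = if f i = j then 1 else 0 := thetaHalf_apply i j _

theorem thetaHalf_apply_of_ne (i : Fin 2) (j : Fin 4) {x : (theta 4).LocalState i}
    (hx : ∀ h, x ≠ some (some h)) : thetaHalf i j x = 0 :=
  Finsupp.single_eq_of_ne (hx _)

theorem thetaChain_eq : thetaChain = halfChain thetaCoeff := by
  refine Finsupp.ext fun s => ?_
  simp only [thetaChain, Finsupp.coe_finsetSum, Finset.sum_apply, Finsupp.smul_apply, pureTensor,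
    Finsupp.equivFunOnFinite_symm_apply_apply, Fin.prod_univ_two, Finsupp.sub_apply]
  by_cases hs : ∀ v, ∃ h, s v = some (some h)
  · obtain ⟨j, l, rfl⟩ := exists_halfState_eq hs
    rw [halfChain_apply]
    simp only [thetaCoeff, map_sum, Finset.sum_mul]
    rw [Finset.sum_comm]
    refine Finset.sum_congr rfl fun σ _ => ?_
    simp only [thetaHalf_halfState]
    have hX : ∀ e : Fin 4, ∑ m, MvPolynomial.C (if m = e then 1 else 0) * MvPolynomial.X m =
        (MvPolynomial.X e : MvPolynomial (Fin 4) ℤ) := fun e => by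
      simp [apply_ite (MvPolynomial.C : ℤ →+* MvPolynomial (Fin 4) ℤ)]
    change _ • _ • MvPolynomial.C (((if j = σ 0 then 1 else 0) - (if j = 0 then 1 else 0)) *
      ((if l = σ 1 then 1 else 0) - (if l = 0 then 1 else 0))) = _
    generalize ((if j = σ 0 then 1 else 0) - (if j = 0 then 1 else 0) : ℤ) = A
    generalize ((if l = σ 1 then 1 else 0) - (if l = 0 then 1 else 0) : ℤ) = B
    rw [← hX 0, ← hX (σ 2), ← Finset.sum_sub_distrib, smul_eq_mul, zsmul_eq_mul, Finset.sum_mul,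
      Finset.mul_sum]
    refine Finset.sum_congr rfl fun m _ => ?_
    simp only [map_mul, map_sub, eq_intCast]
    ring
  · rw [halfChain_apply_of_ne _ fun j l h => hs (by rw [h]; exact fun v => ⟨_, rfl⟩)]
    refine Finset.sum_eq_zero fun σ _ => ?_
    push Not at hs
    obtain ⟨v, hv⟩ := hs
    fin_cases v
    · have hv' : ∀ j, thetaHalf 0 j (s 0) = 0 := fun j => thetaHalf_apply_of_ne 0 j hv
      simp [hv']
    · have hv' : ∀ j, thetaHalf 1 j (s 1) = 0 := fun j => thetaHalf_apply_of_ne 1 j hv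
      simp [hv']

theorem thetaHalf_sub_mem (i : Fin 2) (j k : Fin 4) :
    thetaHalf i j - thetaHalf i k ∈ (theta 4).reducedLocal i :=
  Submodule.subset_span (Or.inr ⟨_, _, rfl⟩)

theorem thetaChain_mem_reduced : thetaChain ∈ (theta 4).reduced := by
  refine sum_mem fun σ _ => zsmul_mem (Submodule.smul_mem _ _ ?_) _
  refine Submodule.subset_span ⟨_, ?_, rfl⟩
  intro v
  fin_cases v
  · exact thetaHalf_sub_mem 0 _ _
  · exact thetaHalf_sub_mem 1 _ _

theorem thetaChain_mem_reducedCycles : thetaChain ∈ (theta 4).reducedCycles 2 3 :=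
  by
  refine ⟨⟨thetaChain_mem_reduced, ?_⟩, LinearMap.mem_ker.2 ?_⟩ <;> rw [thetaChain_eq]
  · exact halfChain_mem _
  · exact isCycleCoeff_thetaCoeff.boundary_eq_zero

/-- Every cycle is a multiple of `thetaChain` already before boundaries are divided out. -/
theorem span_reducedClass_thetaChain (hA : thetaChain ∈ (theta 4).reducedCycles 2 3) :
    Submodule.span ℤ {(theta 4).reducedClass 2 3 ⟨thetaChain, hA⟩} = ⊤ := by
  rw [eq_top_iff]
  rintro x -
  obtain ⟨⟨y, hy⟩, rfl⟩ := Submodule.mkQ_surjective _ x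
  obtain ⟨c, rfl⟩ := exists_halfChain_eq hy.1.2
  have hc := isCycleCoeff_of_boundary_eq_zero (LinearMap.mem_ker.1 hy.2)
  refine Submodule.mem_span_singleton.2 ⟨-c 1 2 3, ?_⟩
  rw [← map_smul]
  congr 1
  apply Subtype.ext
  change -c 1 2 3 • thetaChain = halfChain c
  rw [thetaChain_eq, ← halfChain_smul]
  congr 1
  funext j m l
  exact (hc.eq_mul_thetaCoeff j m l).symm

end Theta

/-! ### Chains in a square -/

namespace TupleChain

variable {S : Type}

theorem d_pair (a b : S) :
    d 0 (Finsupp.single ![a, b] 1) = Finsupp.single ![b] 1 - Finsupp.single ![a] 1 := by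
  have h0 : ![a, b] ∘ (0 : Fin 2).succAbove = ![b] := by funext i; fin_cases i; rfl
  have h1 : ![a, b] ∘ (1 : Fin 2).succAbove = ![a] := by funext i; fin_cases i; rfl
  rw [d_single, Fin.sum_univ_two, h0, h1]
  simp [sub_eq_add_neg]

theorem d_triple (a b c : S) :
    d 1 (Finsupp.single ![a, b, c] 1) =
      Finsupp.single ![b, c] 1 - Finsupp.single ![a, c] 1 + Finsupp.single ![a, b] 1 := by
  have h0 : ![a, b, c] ∘ (0 : Fin 3).succAbove = ![b, c] := by funext i; fin_cases i <;> rfl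
  have h1 : ![a, b, c] ∘ (1 : Fin 3).succAbove = ![a, c] := by funext i; fin_cases i <;> rfl
  have h2 : ![a, b, c] ∘ (2 : Fin 3).succAbove = ![a, b] := by funext i; fin_cases i <;> rfl
  rw [d_single, Fin.sum_univ_three, h0, h1, h2]
  simp [sub_eq_add_neg]

theorem d_quadruple (a b c e : S) :
    d 2 (Finsupp.single ![a, b, c, e] 1) =
      Finsupp.single ![b, c, e] 1 - Finsupp.single ![a, c, e] 1 + Finsupp.single ![a, b, e] 1 -
        Finsupp.single ![a, b, c] 1 := by
  have h0 : ![a, b, c, e] ∘ (0 : Fin 4).succAbove = ![b, c, e] := by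
    funext i; fin_cases i <;> rfl
  have h1 : ![a, b, c, e] ∘ (1 : Fin 4).succAbove = ![a, c, e] := by
    funext i; fin_cases i <;> rfl
  have h2 : ![a, b, c, e] ∘ (2 : Fin 4).succAbove = ![a, b, e] := by
    funext i; fin_cases i <;> rfl
  have h3 : ![a, b, c, e] ∘ (3 : Fin 4).succAbove = ![a, b, c] := by
    funext i; fin_cases i <;> rfl
  rw [d_single, Fin.sum_univ_four, h0, h1, h2, h3]
  simp [sub_eq_add_neg, pow_succ]

end TupleChain

section Square

/-- The unit square, as a subset of the plane. -/
abbrev squareSet : Set (Fin 2 → ℝ) := Set.Icc 0 1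

/-- The inclusion of the square. -/
def squareMap : C(squareSet, Fin 2 → unitInterval) where
  toFun x v := ⟨x.1 v, x.2.1 v, x.2.2 v⟩
  continuous_toFun := continuous_pi fun v =>
    Continuous.subtype_mk ((continuous_apply v).comp continuous_subtype_val) _

/-- The subdivision points of the unit interval. -/
def level : Fin 3 → ℝ := ![0, 1 / 4, 1]

theorem level_mem (i : Fin 3) : 0 ≤ level i ∧ level i ≤ 1 := by
  fin_cases i <;> norm_num [level]

/-- The vertices of the subdivision of the square into four rectangles. -/
def gridPt (g : Fin 3 × Fin 3) : squareSet :=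
  ⟨![level g.1, level g.2], by
    constructor <;> intro i <;> fin_cases i
    exacts [(level_mem _).1, (level_mem _).1, (level_mem _).2, (level_mem _).2]⟩

variable {X : Type} [TopologicalSpace X]

/-- The singular chain of a chain of simplices spanned by the subdivision points. -/
def squareChain (f : C(Fin 2 → unitInterval, X)) (n : ℕ) :
    TupleChain (Fin 3 × Fin 3) n →ₗ[ℤ] SingChain X n :=
  realizeTuple (convex_Icc (0 : Fin 2 → ℝ) 1) (f.comp squareMap) n ∘ₗ TupleChain.map gridPt n

theorem squareChain_single (f : C(Fin 2 → unitInterval, X)) {n : ℕ}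
    (v : Fin (n + 1) → Fin 3 × Fin 3) :
    squareChain f n (Finsupp.single v 1) = Finsupp.single ((f.comp squareMap).comp
      (affineSimplex (convex_Icc (0 : Fin 2 → ℝ) 1) (gridPt ∘ v))) 1 := by
  rw [squareChain, LinearMap.comp_apply, TupleChain.map_single, realizeTuple_single]

theorem d_squareChain (f : C(Fin 2 → unitInterval, X)) {n : ℕ}
    (x : TupleChain (Fin 3 × Fin 3) (n + 1)) :
    SingChain.d n (squareChain f (n + 1) x) = squareChain f n (TupleChain.d n x) := by
  simp only [squareChain, LinearMap.comp_apply, d_realizeTuple, TupleChain.map_d]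

theorem affineSimplex_gridPt_mem {C : Set (Fin 2 → ℝ)} (hC : Convex ℝ C) {n : ℕ}
    {v : Fin (n + 1) → Fin 3 × Fin 3} (hv : ∀ k, (gridPt (v k) : Fin 2 → ℝ) ∈ C) (t : StdSimp n) :
    (fun i => (squareMap (affineSimplex (convex_Icc (0 : Fin 2 → ℝ) 1) (gridPt ∘ v) t) i : ℝ)) ∈
      C :=
  hC.sum_mem (fun i _ => t.2.1 i) t.2.2 fun i _ => hv i

theorem squareChain_mem {C : Set (Fin 2 → ℝ)} (hC : Convex ℝ C) {S : Set X}
    {f : C(Fin 2 → unitInterval, X)}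
    (hf : ∀ t : Fin 2 → unitInterval, (fun i => (t i : ℝ)) ∈ C → f t ∈ S) {n : ℕ}
    {v : Fin (n + 1) → Fin 3 × Fin 3} (hv : ∀ k, (gridPt (v k) : Fin 2 → ℝ) ∈ C) :
    squareChain f n (Finsupp.single v 1) ∈ SingChain.inSet S n := by
  rw [squareChain_single]
  exact SingChain.single_mem_inSet (fun t => hf _ (affineSimplex_gridPt_mem hC hv t)) 1

theorem squareChain_congr {C : Set (Fin 2 → ℝ)} (hC : Convex ℝ C)
    {f f' : C(Fin 2 → unitInterval, X)}
    (hf : ∀ t : Fin 2 → unitInterval, (fun i => (t i : ℝ)) ∈ C → f t = f' t) {n : ℕ}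
    {v : Fin (n + 1) → Fin 3 × Fin 3} (hv : ∀ k, (gridPt (v k) : Fin 2 → ℝ) ∈ C) :
    squareChain f n (Finsupp.single v 1) = squareChain f' n (Finsupp.single v 1) := by
  rw [squareChain_single, squareChain_single]
  congr 1
  ext t
  exact hf _ (affineSimplex_gridPt_mem hC hv t)

theorem convex_coord_eq (i : Fin 2) (r : ℝ) : Convex ℝ {x : Fin 2 → ℝ | x i = r} := by
  intro x hx y hy a b _ _ hab
  simp only [Set.mem_ofPred_eq, Pi.add_apply, Pi.smul_apply, smul_eq_mul] at *
  rw [hx, hy, ← add_mul, hab, one_mul]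

theorem convex_coord_le (i : Fin 2) (r : ℝ) : Convex ℝ {x : Fin 2 → ℝ | x i ≤ r} :=
  convex_halfSpace_le (f := fun x : Fin 2 → ℝ => x i) ⟨fun _ _ => rfl, fun _ _ => rfl⟩ r

theorem convex_le_coord (i : Fin 2) (r : ℝ) : Convex ℝ {x : Fin 2 → ℝ | r ≤ x i} :=
  convex_halfSpace_ge (f := fun x : Fin 2 → ℝ => x i) ⟨fun _ _ => rfl, fun _ _ => rfl⟩ r

end Square

/-! ### Weighted sums of squares and their residues -/

namespace Theta

variable {X : Type} [TopologicalSpace X]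

/-- A family of squares whose faces cancel in the combinations with cycle coefficients. -/
structure IsMatching (F : Fin 4 → Fin 4 → Fin 4 → C(Fin 2 → unitInterval, X)) : Prop where
  swap₀ : ∀ j m l t, t 0 = 1 → F j m l t = F m j l t
  swap₁ : ∀ j m l t, t 1 = 1 → F j m l t = F j l m t
  forget₀ : ∀ j j' m l t, t 0 = 0 → F j m l t = F j' m l t
  forget₁ : ∀ j m l l' t, t 1 = 0 → F j m l t = F j m l' t

/-- The sum of the squares of a family, weighted by coefficients. -/
def weightedChain (c : Fin 4 → Fin 4 → Fin 4 → ℤ)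
    (F : Fin 4 → Fin 4 → Fin 4 → C(Fin 2 → unitInterval, X)) (n : ℕ) :
    TupleChain (Fin 3 × Fin 3) n →ₗ[ℤ] SingChain X n :=
  ∑ j, ∑ m, ∑ l, c j m l • squareChain (F j m l) n

variable {c : Fin 4 → Fin 4 → Fin 4 → ℤ} {F : Fin 4 → Fin 4 → Fin 4 → C(Fin 2 → unitInterval, X)}

theorem weightedChain_apply {n : ℕ} (x : TupleChain (Fin 3 × Fin 3) n) :
    weightedChain c F n x = ∑ j, ∑ m, ∑ l, c j m l • squareChain (F j m l) n x := by
  simp only [weightedChain, LinearMap.coe_sum, Finset.sum_apply, LinearMap.smul_apply]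

theorem d_weightedChain {n : ℕ} (x : TupleChain (Fin 3 × Fin 3) (n + 1)) :
    SingChain.d n (weightedChain c F (n + 1) x) = weightedChain c F n (TupleChain.d n x) := by
  simp only [weightedChain_apply, map_sum, map_smul, d_squareChain]

theorem sum_smul_eq_zero {M : Type} [AddCommGroup M] [IsAddTorsionFree M] {a : Fin 4 → Fin 4 → ℤ}
    (ha : ∀ i j, a i j + a j i = 0) {x : Fin 4 → Fin 4 → M} (hx : ∀ i j, x i j = x j i) :
    ∑ i, ∑ j, a i j • x i j = 0 := by
  rw [← self_eq_neg]
  conv_lhs => rw [Finset.sum_comm]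
  rw [← Finset.sum_neg_distrib]
  refine Finset.sum_congr rfl fun i _ => ?_
  rw [← Finset.sum_neg_distrib]
  refine Finset.sum_congr rfl fun j _ => ?_
  rw [hx, eq_neg_of_add_eq_zero_left (ha j i), neg_smul]

/-- On each side of the square the family is symmetric in two indices or independent of one, while
the coefficients are antisymmetric in those two or sum to zero over that one. -/
theorem weightedChain_eq_zero (hc : IsCycleCoeff c) (hF : IsMatching F) {n : ℕ}
    {v : Fin (n + 1) → Fin 3 × Fin 3} (hv : (∀ k, (v k).1 = 0) ∨ (∀ k, (v k).1 = 2) ∨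
      (∀ k, (v k).2 = 0) ∨ ∀ k, (v k).2 = 2) :
    weightedChain c F n (Finsupp.single v 1) = 0 := by
  have h1 : ∀ {x : Fin 2 → unitInterval} {i}, (x i : ℝ) = level 2 → x i = 1 :=
    fun h => Subtype.ext h
  have h0 : ∀ {x : Fin 2 → unitInterval} {i}, (x i : ℝ) = level 0 → x i = 0 :=
    fun h => Subtype.ext h
  have hg0 : ∀ {i}, (∀ k, (v k).1 = i) → ∀ k, (gridPt (v k) : Fin 2 → ℝ) ∈ {x | x 0 = level i} :=
    fun h k => congrArg level (h k)
  have hg1 : ∀ {i}, (∀ k, (v k).2 = i) → ∀ k, (gridPt (v k) : Fin 2 → ℝ) ∈ {x | x 1 = level i} :=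
    fun h k => congrArg level (h k)
  rw [weightedChain_apply]
  rcases hv with hv | hv | hv | hv
  · rw [Finset.sum_comm]
    refine Finset.sum_eq_zero fun m _ => ?_
    rw [Finset.sum_comm]
    refine Finset.sum_eq_zero fun l _ => ?_
    have : ∀ j, squareChain (F j m l) n (Finsupp.single v 1) =
        squareChain (F 0 m l) n (Finsupp.single v 1) := fun j =>
      squareChain_congr (convex_coord_eq 0 _) (fun t ht => hF.forget₀ _ _ _ _ _ (h0 ht)) (hg0 hv)
    simp only [this]
    rw [← Finset.sum_smul, hc.sum₀, zero_smul]
  · calc _ = ∑ j, ∑ l, ∑ m, c j m l • squareChain (F j m l) n (Finsupp.single v 1) :=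
          Finset.sum_congr rfl fun j _ => Finset.sum_comm
      _ = ∑ l, ∑ j, ∑ m, c j m l • squareChain (F j m l) n (Finsupp.single v 1) :=
          Finset.sum_comm
      _ = 0 := Finset.sum_eq_zero fun l _ => sum_smul_eq_zero (fun j m => hc.swap₀ j m l)
          fun j m => squareChain_congr (convex_coord_eq 0 _)
            (fun t ht => hF.swap₀ _ _ _ _ (h1 ht)) (hg0 hv)
  · refine Finset.sum_eq_zero fun j _ => Finset.sum_eq_zero fun m _ => ?_
    have : ∀ l, squareChain (F j m l) n (Finsupp.single v 1) =
        squareChain (F j m 0) n (Finsupp.single v 1) := fun j =>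
      squareChain_congr (convex_coord_eq 1 _) (fun t ht => hF.forget₁ _ _ _ _ _ (h0 ht)) (hg1 hv)
    simp only [this]
    rw [← Finset.sum_smul, hc.sum₁, zero_smul]
  · exact Finset.sum_eq_zero fun j _ => sum_smul_eq_zero (fun m l => hc.swap₁ j m l)
      fun m l => squareChain_congr (convex_coord_eq 1 _)
        (fun t ht => hF.swap₁ _ _ _ _ (h1 ht)) (hg1 hv)

theorem weightedChain_mem {C : Set (Fin 2 → ℝ)} (hC : Convex ℝ C) {S : Set X}
    (hF : ∀ j m l, ∀ t : Fin 2 → unitInterval, (fun i => (t i : ℝ)) ∈ C → F j m l t ∈ S) {n : ℕ}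
    {v : Fin (n + 1) → Fin 3 × Fin 3} (hv : ∀ k, (gridPt (v k) : Fin 2 → ℝ) ∈ C) :
    weightedChain c F n (Finsupp.single v 1) ∈ SingChain.inSet S n := by
  rw [weightedChain_apply]
  exact sum_mem fun j _ => sum_mem fun m _ => sum_mem fun l _ =>
    Submodule.smul_mem _ _ (squareChain_mem hC (hF j m l) hv)

/-- The square, cut into two triangles. -/
def squareTuples : TupleChain (Fin 3 × Fin 3) 2 :=
  Finsupp.single ![(0, 0), (2, 0), (2, 2)] 1 - Finsupp.single ![(0, 0), (0, 2), (2, 2)] 1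

theorem d_weightedChain_squareTuples (hc : IsCycleCoeff c) (hF : IsMatching F) :
    SingChain.d 1 (weightedChain c F 2 squareTuples) = 0 := by
  rw [d_weightedChain, squareTuples, map_sub, TupleChain.d_triple, TupleChain.d_triple]
  simp only [map_add, map_sub]
  rw [weightedChain_eq_zero (v := ![(2, 0), (2, 2)]) hc hF (by decide),
    weightedChain_eq_zero (v := ![(0, 0), (2, 0)]) hc hF (by decide),
    weightedChain_eq_zero (v := ![(0, 2), (2, 2)]) hc hF (by decide),
    weightedChain_eq_zero (v := ![(0, 0), (0, 2)]) hc hF (by decide)]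
  abel

/-- Cut the square along `t 0 = 1/4` and the cutting segment at `t 1 = 1/4`: the residue is
concentrated at the crossing point, since everything on the sides of the square cancels. -/
theorem isResidue_weightedChain {U₁ V₁ U₂ V₂ : Set X} (hc : IsCycleCoeff c) (hF : IsMatching F)
    (hU₁ : ∀ j m l t, (1 / 4 : ℝ) ≤ t 0 → F j m l t ∈ U₁)
    (hV₁ : ∀ j m l t, (t 0 : ℝ) ≤ 1 / 4 → F j m l t ∈ V₁)
    (hU₂ : ∀ j m l t, (1 / 4 : ℝ) ≤ t 1 → F j m l t ∈ U₂)
    (hV₂ : ∀ j m l t, (t 1 : ℝ) ≤ 1 / 4 → F j m l t ∈ V₂) :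
    SingChain.IsResidue U₁ V₁ U₂ V₂ (weightedChain c F 2 squareTuples)
      (weightedChain c F 0 (Finsupp.single ![(1, 1)] 1)) := by
  have l0 : level 0 = 0 := rfl
  have l1 : level 1 = 1 / 4 := rfl
  have l2 : level 2 = 1 := rfl
  have memU₁ : ∀ {n} {v : Fin (n + 1) → Fin 3 × Fin 3}, (∀ k, 1 ≤ (v k).1) →
      weightedChain c F n (Finsupp.single v 1) ∈ SingChain.inSet U₁ n := fun {n v} hv =>
    weightedChain_mem (convex_le_coord 0 (1 / 4)) (fun j m l t ht => hU₁ j m l t ht) fun k => by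
      have := hv k
      change 1 / 4 ≤ level (v k).1
      generalize (v k).1 = i at *
      fin_cases i <;> simp [l1, l2] at * <;> norm_num
  have memU₂ : ∀ {n} {v : Fin (n + 1) → Fin 3 × Fin 3}, (∀ k, 1 ≤ (v k).2) →
      weightedChain c F n (Finsupp.single v 1) ∈ SingChain.inSet U₂ n := fun {n v} hv =>
    weightedChain_mem (convex_le_coord 1 (1 / 4)) (fun j m l t ht => hU₂ j m l t ht) fun k => by
      have := hv k
      change 1 / 4 ≤ level (v k).2
      generalize (v k).2 = i at *
      fin_cases i <;> simp [l1, l2] at * <;> norm_num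
  have memV₁ : ∀ {n} {v : Fin (n + 1) → Fin 3 × Fin 3}, (∀ k, (v k).1 ≤ 1) →
      weightedChain c F n (Finsupp.single v 1) ∈ SingChain.inSet V₁ n := fun {n v} hv =>
    weightedChain_mem (convex_coord_le 0 (1 / 4)) (fun j m l t ht => hV₁ j m l t ht) fun k => by
      have := hv k
      change level (v k).1 ≤ 1 / 4
      generalize (v k).1 = i at *
      fin_cases i <;> simp [l0, l1] at *
  have memV₂ : ∀ {n} {v : Fin (n + 1) → Fin 3 × Fin 3}, (∀ k, (v k).2 ≤ 1) →
      weightedChain c F n (Finsupp.single v 1) ∈ SingChain.inSet V₂ n := fun {n v} hv =>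
    weightedChain_mem (convex_coord_le 1 (1 / 4)) (fun j m l t ht => hV₂ j m l t ht) fun k => by
      have := hv k
      change level (v k).2 ≤ 1 / 4
      generalize (v k).2 = i at *
      fin_cases i <;> simp [l0, l1] at *
  set R := fun n => weightedChain c F n with hR
  -- The first two chains are the rectangles on either side of the cut, each divided by a diagonal.
  -- The flat tetrahedra relate this triangulation to that of the square. The cutting segment, with
  -- reversed orientation, is divided at `(1, 1)`, and a flat triangle accounts for the division.
  refine ⟨R 2 (Finsupp.single ![(1, 0), (2, 0), (2, 2)] 1) -
      R 2 (Finsupp.single ![(1, 0), (1, 2), (2, 2)] 1),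
    sub_mem (memU₁ (by decide)) (memU₁ (by decide)),
    R 2 (Finsupp.single ![(0, 0), (1, 0), (1, 2)] 1) -
      R 2 (Finsupp.single ![(0, 0), (0, 2), (1, 2)] 1),
    sub_mem (memV₁ (by decide)) (memV₁ (by decide)),
    -R 3 (Finsupp.single ![(0, 0), (1, 0), (2, 0), (2, 2)] 1 -
      Finsupp.single ![(0, 0), (1, 0), (1, 2), (2, 2)] 1 +
      Finsupp.single ![(0, 0), (0, 2), (1, 2), (2, 2)] 1),
    -R 1 (Finsupp.single ![(1, 1), (1, 2)] 1),
    neg_mem (SingChain.mem_inSet_inter (SingChain.mem_inSet_inter (memU₁ (by decide))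
      (memV₁ (by decide))) (memU₂ (by decide))),
    -R 1 (Finsupp.single ![(1, 0), (1, 1)] 1),
    neg_mem (SingChain.mem_inSet_inter (SingChain.mem_inSet_inter (memU₁ (by decide))
      (memV₁ (by decide))) (memV₂ (by decide))),
    R 2 (Finsupp.single ![(1, 0), (1, 1), (1, 2)] 1),
    SingChain.mem_inSet_inter (memU₁ (by decide)) (memV₁ (by decide)), ?_, ?_, ?_⟩
  · simp only [hR, map_neg, d_weightedChain, map_add, map_sub, TupleChain.d_quadruple, squareTuples]
    rw [weightedChain_eq_zero (v := ![(0, 0), (1, 0), (2, 0)]) hc hF (by decide),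
      weightedChain_eq_zero (v := ![(0, 2), (1, 2), (2, 2)]) hc hF (by decide)]
    abel
  · simp only [hR, d_weightedChain, map_add, map_sub, TupleChain.d_triple]
    rw [weightedChain_eq_zero (v := ![(2, 0), (2, 2)]) hc hF (by decide),
      weightedChain_eq_zero (v := ![(1, 0), (2, 0)]) hc hF (by decide),
      weightedChain_eq_zero (v := ![(1, 2), (2, 2)]) hc hF (by decide)]
    abel
  · simp only [hR, d_weightedChain, map_neg, map_sub, TupleChain.d_pair]
    -- The other end of the half segment is on the side `t 1 = 1`.
    rw [weightedChain_eq_zero (v := ![(1, 2)]) hc hF (by decide)]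
    abel

end Theta

/-! ### The cubes of configurations on the theta graph -/

namespace MultiGraph

variable {V E : Type} {Γ : MultiGraph V E} [Fintype V] [LinearOrder V] [Fintype E] [DecidableEq E]

/-- Any complete labelling gives the same unordered configuration, so the arbitrary numbering in the
definition can be replaced by an explicit one. -/
theorem State.cube_apply (s : Γ.State) (m : E →₀ ℕ) {k : ℕ} (hk : s.weight + m.degree = k)
    (t : V → unitInterval) {lab : Fin k → s.Label m} (hlab : Function.Injective lab) :
    s.cube m hk t =
      toUnordered ⟨fun i => s.position m t (lab i), (s.position_injective m t).comp hlab⟩ := by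
  set e := Fintype.equivFinOfCardEq ((s.card_label m).trans hk) with he
  refine toUnordered_eq_iff.2 ⟨Equiv.ofBijective (fun i => e (lab i))
    (Finite.injective_iff_bijective.1 (e.injective.comp hlab)), fun i => ?_⟩
  change s.position m t (lab i) = s.position m t (e.symm (e (lab i)))
  rw [Equiv.symm_apply_apply]

end MultiGraph

namespace Theta

open MultiGraph

theorem weight_add_degree (f : Fin 2 → Fin 4) (m : Fin 4) :
    (halfState f).weight + (Finsupp.single m 1 : Fin 4 →₀ ℕ).degree = 3 := by
  rw [weight_halfState, Finsupp.degree_single]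

/-- The square of configurations with points moving from the vertices `0` and `1` into the edges
`j` and `l`, and a further point on the edge `m`. -/
def configSquare (j m l : Fin 4) : C(Fin 2 → unitInterval, B₃) :=
  (halfState ![j, l]).cube (Finsupp.single m 1) (weight_add_degree _ m)

/-- The coordinates of the three points in `configSquare`. -/
def squareHeight (j m l : Fin 4) (t : Fin 2 → unitInterval) : Fin 3 → unitInterval :=
  ![(halfState ![j, l]).coord (Finsupp.single m 1) t j 0,
    (halfState ![j, l]).coord (Finsupp.single m 1) t m 1,
    (halfState ![j, l]).coord (Finsupp.single m 1) t l ((Finsupp.single m 1 : Fin 4 →₀ ℕ) l + 1)]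

/-- The labels of the three points in `configSquare`. -/
def squareLabel (j m l : Fin 4) :
    Fin 3 → (halfState ![j, l]).Label (Finsupp.single m 1) :=
  ![Sum.inl ⟨0, by rw [occupied_halfState]; exact Finset.mem_univ _⟩,
    Sum.inr ⟨m, ⟨0, by rw [Finsupp.single_eq_same]; exact one_pos⟩⟩,
    Sum.inl ⟨1, by rw [occupied_halfState]; exact Finset.mem_univ _⟩]

theorem squareLabel_injective (j m l : Fin 4) : Function.Injective (squareLabel j m l) := by
  intro a b h
  fin_cases a <;> fin_cases b <;> simp [squareLabel] at h ⊢

theorem position_squareLabel (j m l : Fin 4) (t : Fin 2 → unitInterval) (i : Fin 3) :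
    (halfState ![j, l]).position (Finsupp.single m 1) t (squareLabel j m l i) =
      pt (![j, m, l] i) (squareHeight j m l t i) := by
  fin_cases i <;> rfl

theorem pt_squareHeight_injective (j m l : Fin 4) (t : Fin 2 → unitInterval) :
    Function.Injective fun i => pt (![j, m, l] i) (squareHeight j m l t i) := by
  have := (State.position_injective (halfState ![j, l]) (Finsupp.single m 1) t).comp
    (squareLabel_injective j m l)
  convert this using 2 with i
  exact (position_squareLabel j m l t i).symm

theorem configSquare_apply (j m l : Fin 4) (t : Fin 2 → unitInterval) :
    configSquare j m l t = toUnordered ⟨_, pt_squareHeight_injective j m l t⟩ := by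
  rw [configSquare, State.cube_apply _ _ _ t (squareLabel_injective j m l)]
  congr 2
  funext i
  exact position_squareLabel j m l t i

theorem time_zero (j l e : Fin 4) (t : Fin 2 → unitInterval) :
    (halfState ![j, l]).time t (e, 0) = if j = e then (t 0 : ℝ) else 0 := by
  unfold State.time
  refine if_congr ?_ rfl rfl
  constructor
  · intro h
    have : (some (some ⟨(j, 0), rfl⟩) : (theta 4).LocalState 0) = some (some ⟨(e, 0), rfl⟩) := h
    simp only [Option.some.injEq] at this
    exact congrArg (fun h => h.1.1) this
  · rintro rfl
    rfl

theorem time_one (j l e : Fin 4) (t : Fin 2 → unitInterval) :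
    (halfState ![j, l]).time t (e, 1) = if l = e then (t 1 : ℝ) else 0 := by
  unfold State.time
  refine if_congr ?_ rfl rfl
  constructor
  · intro h
    have : (some (some ⟨(l, 1), rfl⟩) : (theta 4).LocalState 1) = some (some ⟨(e, 1), rfl⟩) := h
    simp only [Option.some.injEq] at this
    exact congrArg (fun h => h.1.1) this
  · rintro rfl
    rfl

theorem squareHeight_zero (j m l : Fin 4) (t : Fin 2 → unitInterval) :
    (squareHeight j m l t 0 : ℝ) =
      t 0 / (t 0 + ((if m = j then 1 else 0) + 1) + if l = j then (t 1 : ℝ) else 0) := by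
  refine (State.coord_val _ _ _ _ _ (Nat.zero_le _)).trans ?_
  rw [State.total, time_zero, time_one, if_pos rfl, Finsupp.single_apply]
  push_cast
  simp

theorem squareHeight_one (j m l : Fin 4) (t : Fin 2 → unitInterval) :
    (squareHeight j m l t 1 : ℝ) = ((if j = m then (t 0 : ℝ) else 0) + 1) /
      ((if j = m then (t 0 : ℝ) else 0) + (1 + 1) + if l = m then (t 1 : ℝ) else 0) := by
  refine (State.coord_val _ _ _ _ _ (by simp)).trans ?_
  rw [State.total, time_zero, time_one, Finsupp.single_eq_same]
  push_cast
  rfl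

theorem squareHeight_two (j m l : Fin 4) (t : Fin 2 → unitInterval) :
    (squareHeight j m l t 2 : ℝ) =
      ((if j = l then (t 0 : ℝ) else 0) + ((if m = l then 1 else 0) + 1)) /
        ((if j = l then (t 0 : ℝ) else 0) + ((if m = l then 1 else 0) + 1) + t 1) := by
  refine (State.coord_val _ _ _ _ _ le_rfl).trans ?_
  rw [State.total, time_zero, time_one, if_pos rfl, Finsupp.single_apply]
  push_cast
  rfl

/-- At time `1` the moving point has become one of the equally spaced points of its edge and can be
exchanged with the stationary one. At time `0` it is at its vertex, and the other positions do not
depend on its edge. -/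
theorem isMatching_configSquare : IsMatching configSquare where
  swap₀ j m l t ht := by
    rcases eq_or_ne j m with rfl | h
    · rfl
    rw [configSquare_apply, configSquare_apply]
    refine toUnordered_eq_iff.2 ⟨Equiv.swap 0 1, fun i => ?_⟩
    have hs : Equiv.swap (0 : Fin 3) 1 2 = 2 := by decide
    fin_cases i
    · refine congrArg (pt m) (Subtype.ext ?_)
      change (squareHeight m j l t 0 : ℝ) = squareHeight j m l t 1
      rw [squareHeight_zero, squareHeight_one, if_neg h, if_neg h, ht]
      norm_num
    · refine congrArg (pt j) (Subtype.ext ?_)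
      change (squareHeight m j l t 1 : ℝ) = squareHeight j m l t 0
      rw [squareHeight_zero, squareHeight_one, if_neg h.symm, if_neg h.symm, ht]
      norm_num
    · change pt l (squareHeight m j l t 2) = pt (![j, m, l] (Equiv.swap (0 : Fin 3) 1 2)) _
      simp only [hs]
      refine congrArg (pt l) (Subtype.ext ?_)
      change (squareHeight m j l t 2 : ℝ) = squareHeight j m l t (Equiv.swap (0 : Fin 3) 1 2)
      rw [hs, squareHeight_two, squareHeight_two, ht, Set.Icc.coe_one]
      ring_nf
  swap₁ j m l t ht := by
    rcases eq_or_ne m l with rfl | h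
    · rfl
    rw [configSquare_apply, configSquare_apply]
    refine toUnordered_eq_iff.2 ⟨Equiv.swap 1 2, fun i => ?_⟩
    have hs : Equiv.swap (1 : Fin 3) 2 0 = 0 := by decide
    fin_cases i
    · refine congrArg (pt j) (Subtype.ext ?_)
      change (squareHeight j l m t 0 : ℝ) = squareHeight j m l t (Equiv.swap (1 : Fin 3) 2 0)
      rw [hs, squareHeight_zero, squareHeight_zero, ht, Set.Icc.coe_one]
      ring_nf
    · refine congrArg (pt l) (Subtype.ext ?_)
      change (squareHeight j l m t 1 : ℝ) = squareHeight j m l t 2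
      rw [squareHeight_one, squareHeight_two, if_neg h, if_neg h, ht]
      norm_num
      ring_nf
    · refine congrArg (pt m) (Subtype.ext ?_)
      change (squareHeight j l m t 2 : ℝ) = squareHeight j m l t 1
      rw [squareHeight_one, squareHeight_two, if_neg h.symm, if_neg h.symm, ht]
      norm_num
      ring_nf
  forget₀ j j' m l t ht := by
    rw [configSquare_apply, configSquare_apply]
    refine toUnordered_eq_iff.2 ⟨1, fun i => ?_⟩
    have h0 : ∀ j, squareHeight j m l t 0 = 0 := fun j => Subtype.ext (by
      rw [squareHeight_zero, ht, Set.Icc.coe_zero, zero_div])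
    fin_cases i
    · change pt j' (squareHeight j' m l t 0) = pt j (squareHeight j m l t 0)
      rw [h0, h0, pt_zero]
    · refine congrArg (pt m) (Subtype.ext ?_)
      change (squareHeight j' m l t 1 : ℝ) = squareHeight j m l t 1
      simp only [squareHeight_one, ht, Set.Icc.coe_zero, ite_self]
    · refine congrArg (pt l) (Subtype.ext ?_)
      change (squareHeight j' m l t 2 : ℝ) = squareHeight j m l t 2
      simp only [squareHeight_two, ht, Set.Icc.coe_zero, ite_self]
  forget₁ j m l l' t ht := by
    rw [configSquare_apply, configSquare_apply]
    refine toUnordered_eq_iff.2 ⟨1, fun i => ?_⟩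
    have h0 : ∀ l, squareHeight j m l t 2 = 1 := fun l => Subtype.ext (by
      rw [squareHeight_two, ht, Set.Icc.coe_zero, add_zero, div_self]
      · rfl
      · have := (t 0).2.1
        split_ifs <;> positivity)
    fin_cases i
    · refine congrArg (pt j) (Subtype.ext ?_)
      change (squareHeight j m l' t 0 : ℝ) = squareHeight j m l t 0
      simp only [squareHeight_zero, ht, Set.Icc.coe_zero, ite_self]
    · refine congrArg (pt m) (Subtype.ext ?_)
      change (squareHeight j m l' t 1 : ℝ) = squareHeight j m l t 1
      simp only [squareHeight_one, ht, Set.Icc.coe_zero, ite_self]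
    · change pt l' (squareHeight j m l' t 2) = pt l (squareHeight j m l t 2)
      rw [h0, h0, pt_one]

section Bounds

variable (j m l : Fin 4) (t : Fin 2 → unitInterval)

/-- The middle point stays in the middle third of its edge, and up to time `1/4` a moving point
stays within `1/5` of its vertex. So the parameter `1/4` is small enough to make the moving points
the unique closest ones. -/
theorem squareHeight_bounds :
    ((squareHeight j m l t 0 : ℝ) ≤ 1 / 2 ∧ ((t 0 : ℝ) ≤ 1 / 4 → (squareHeight j m l t 0 : ℝ) ≤ 1 / 5)) ∧
    ((1 / 3 : ℝ) ≤ squareHeight j m l t 1 ∧ (squareHeight j m l t 1 : ℝ) ≤ 2 / 3) ∧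
    ((1 / 2 : ℝ) ≤ squareHeight j m l t 2 ∧
      ((t 1 : ℝ) ≤ 1 / 4 → (4 / 5 : ℝ) ≤ squareHeight j m l t 2)) := by
  have a0 := (t 0).2.1
  have a1 := (t 0).2.2
  have b0 := (t 1).2.1
  have b1 := (t 1).2.2
  rw [squareHeight_zero, squareHeight_one, squareHeight_two]
  refine ⟨⟨?_, fun h => ?_⟩, ⟨?_, ?_⟩, ?_, fun h => ?_⟩
  all_goals first
    | rw [div_le_div_iff₀ (by split_ifs <;> positivity) (by norm_num)]
    | rw [div_le_div_iff₀ (by norm_num) (by split_ifs <;> positivity)]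
  all_goals split_ifs <;> linarith

theorem configSquare_mem_avoid₀ (h : 0 < (t 0 : ℝ)) : configSquare j m l t ∈ avoid₀ := by
  rw [configSquare_apply, toUnordered_mem_avoid₀]
  obtain ⟨-, ⟨h1, -⟩, h2, -⟩ := squareHeight_bounds j m l t
  have b0 := (t 1).2.1
  intro i
  change (0 : ℝ) < squareHeight j m l t i
  fin_cases i
  · change (0 : ℝ) < squareHeight j m l t 0
    rw [squareHeight_zero]
    split_ifs <;> positivity
  · change (0 : ℝ) < squareHeight j m l t 1
    linarith
  · change (0 : ℝ) < squareHeight j m l t 2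
    linarith

theorem configSquare_mem_avoid₁ (h : 0 < (t 1 : ℝ)) : configSquare j m l t ∈ avoid₁ := by
  rw [configSquare_apply, toUnordered_mem_avoid₁]
  obtain ⟨⟨h0, -⟩, ⟨-, h1⟩, -⟩ := squareHeight_bounds j m l t
  have b0 := (t 0).2.1
  intro i
  change (squareHeight j m l t i : ℝ) < 1
  fin_cases i
  · change (squareHeight j m l t 0 : ℝ) < 1
    linarith
  · change (squareHeight j m l t 1 : ℝ) < 1
    linarith
  · change (squareHeight j m l t 2 : ℝ) < 1
    rw [squareHeight_two, div_lt_one (by split_ifs <;> positivity)]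
    linarith

theorem squareHeight_zero_lt (h : (t 0 : ℝ) ≤ 1 / 4) (i : Fin 3) (hi : i ≠ 0) :
    squareHeight j m l t 0 < squareHeight j m l t i := by
  obtain ⟨⟨-, h0⟩, ⟨h1, -⟩, h2, -⟩ := squareHeight_bounds j m l t
  have := h0 h
  change (squareHeight j m l t 0 : ℝ) < squareHeight j m l t i
  fin_cases i
  · exact absurd rfl hi
  · change (squareHeight j m l t 0 : ℝ) < squareHeight j m l t 1
    linarith
  · change (squareHeight j m l t 0 : ℝ) < squareHeight j m l t 2
    linarith

theorem squareHeight_lt_two (h : (t 1 : ℝ) ≤ 1 / 4) (i : Fin 3) (hi : i ≠ 2) :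
    squareHeight j m l t i < squareHeight j m l t 2 := by
  obtain ⟨⟨h0, -⟩, ⟨-, h1⟩, -, h2⟩ := squareHeight_bounds j m l t
  have := h2 h
  change (squareHeight j m l t i : ℝ) < squareHeight j m l t 2
  fin_cases i
  · change (squareHeight j m l t 0 : ℝ) < squareHeight j m l t 2
    linarith
  · change (squareHeight j m l t 1 : ℝ) < squareHeight j m l t 2
    linarith
  · exact absurd rfl hi

theorem configSquare_mem_closest₀ (h : (t 0 : ℝ) ≤ 1 / 4) : configSquare j m l t ∈ closest₀ := by
  rw [configSquare_apply, toUnordered_mem_closest₀]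
  exact ⟨0, squareHeight_zero_lt j m l t h⟩

theorem configSquare_mem_closest₁ (h : (t 1 : ℝ) ≤ 1 / 4) : configSquare j m l t ∈ closest₁ := by
  rw [configSquare_apply, toUnordered_mem_closest₁]
  exact ⟨2, squareHeight_lt_two j m l t h⟩

theorem configSquare_mem_cell (h0 : 0 < (t 0 : ℝ)) (h0' : (t 0 : ℝ) ≤ 1 / 4) (h1 : 0 < (t 1 : ℝ))
    (h1' : (t 1 : ℝ) ≤ 1 / 4) : configSquare j m l t ∈ cell ![j, m, l] := by
  have k0 := configSquare_mem_avoid₀ j m l t h0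
  have k1 := configSquare_mem_avoid₁ j m l t h1
  rw [configSquare_apply] at *
  rw [toUnordered_mem_avoid₀] at k0
  rw [toUnordered_mem_avoid₁] at k1
  refine ⟨⟨_, pt_squareHeight_injective j m l t⟩, ⟨fun i _ _ => pt_mem_openEdge (k0 i) (k1 i),
    fun _ => squareHeight_zero_lt j m l t h0', fun _ => squareHeight_lt_two j m l t h1',
    fun a b hab _ => ?_⟩, rfl⟩
  change squareHeight j m l t a < squareHeight j m l t b
  by_cases ha : a = 0
  · subst ha
    exact squareHeight_zero_lt j m l t h0' b hab.ne'
  · have : b = 2 := by omega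
    subst this
    exact squareHeight_lt_two j m l t h1' a hab.ne

end Bounds

end Theta

/-! ### Generators of singular homology -/

namespace SingChain

variable {X : Type} [TopologicalSpace X]

theorem exists_cycles_eq {n : ℕ} {z : SingChain X (n + 1)} (hz : d n z = 0) :
    ∃ w : (singularChains X).cycles (n + 1),
      (singularChains X).iCycles (n + 1) w = toSingularChains (n + 1) z := by
  let k : ModuleCat.of ℤ ℤ ⟶ (singularChains X).X (n + 1) :=
    ModuleCat.ofHom (toSingularChains (n + 1) ∘ₗ
      LinearMap.toSpanSingleton ℤ (SingChain X (n + 1)) z)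
  have hk1 : k.hom (1 : ℤ) = toSingularChains (n + 1) z :=
    congrArg (toSingularChains (n + 1)) (one_smul ℤ z)
  have hk : k ≫ (singularChains X).d (n + 1) n = 0 := by
    refine ModuleCat.hom_ext (LinearMap.ext fun a => ?_)
    change (singularChains X).d (n + 1) n (toSingularChains (n + 1) ((show ℤ from a) • z)) = 0
    refine (d_toSingularChains _).trans ?_
    rw [map_zsmul, hz, smul_zero, map_zero]
  refine ⟨((singularChains X).liftCycles k n (by simp) hk).hom (1 : ℤ), ?_⟩
  refine Eq.trans ?_ hk1
  exact congrArg (fun g => g.hom (1 : ℤ)) ((singularChains X).liftCycles_i k n (by simp) hk)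

theorem homologyπ_eq_zero {n : ℕ} {w : (singularChains X).cycles (n + 1)} {y : SingChain X (n + 2)}
    (h : (singularChains X).iCycles (n + 1) w = toSingularChains (n + 1) (d (n + 1) y)) :
    (singularChains X).homologyπ (n + 1) w = 0 := by
  have hinj : Function.Injective ((singularChains X).iCycles (n + 1)) :=
    (ModuleCat.mono_iff_injective _).1 inferInstance
  have hw : w = (singularChains X).toCycles (n + 2) (n + 1) (toSingularChains (n + 2) y) := by
    refine hinj (h.trans ((d_toSingularChains y).symm.trans ?_))
    exact (congrArg (fun g => g.hom (toSingularChains (n + 2) y))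
      ((singularChains X).toCycles_i (n + 2) (n + 1))).symm
  rw [hw]
  exact congrArg (fun g => g.hom (toSingularChains (n + 2) y))
    ((singularChains X).toCycles_comp_homologyπ (n + 2) (n + 1))

/-- Carries a statement about formal chains over to homology: every class is represented by a cycle,
which the inverse comparison map turns into a formal one. -/
theorem span_homologyπ_eq_top {n : ℕ} {z : SingChain X (n + 1)}
    (hgen : ∀ z' : SingChain X (n + 1), d n z' = 0 → ∃ (a : ℤ) (y : SingChain X (n + 2)),
      d (n + 1) y = z' - a • z) {w : (singularChains X).cycles (n + 1)}
    (hw : (singularChains X).iCycles (n + 1) w = toSingularChains (n + 1) z) :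
    Submodule.span ℤ {(singularChains X).homologyπ (n + 1) w} =
      (⊤ : Submodule ℤ (singularHomology (n + 1) X)) := by
  rw [eq_top_iff]
  rintro h -
  have hsurj : Function.Surjective ((singularChains X).homologyπ (n + 1)) :=
    (ModuleCat.epi_iff_surjective _).1 inferInstance
  obtain ⟨w', rfl⟩ := hsurj h
  set z' := (ofSingularChains (n + 1)).hom ((singularChains X).iCycles (n + 1) w') with hz'
  have hw' : toSingularChains (n + 1) z' = (singularChains X).iCycles (n + 1) w' :=
    toSingularChains_ofSingularChains _
  have hdz' : d n z' = 0 := by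
    refine toSingularChains_injective n ?_
    rw [map_zero, ← d_toSingularChains, hw']
    exact congrArg (fun g => g.hom w') ((singularChains X).iCycles_d (n + 1) n)
  obtain ⟨a, y, hy⟩ := hgen z' hdz'
  have h0 : (singularChains X).homologyπ (n + 1) (w' - a • w) = 0 := by
    refine homologyπ_eq_zero (y := y) ?_
    rw [hy, map_sub, map_sub, map_zsmul, map_zsmul, hw, hw']
  rw [map_sub, map_zsmul, sub_eq_zero] at h0
  rw [h0]
  exact zsmul_mem (Submodule.mem_span_singleton_self _) a

end SingChain

namespace Theta

open MultiGraph

/-! ### The second homology of the configuration space -/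

/-- The chain realizing `thetaChain`. -/
def thetaCycle : SingChain B₃ 2 := weightedChain thetaCoeff configSquare 2 squareTuples

/-- The residue of `thetaCycle`. -/
def thetaResidue : SingChain B₃ 0 :=
  weightedChain thetaCoeff configSquare 0 (Finsupp.single ![(1, 1)] 1)

theorem d_thetaCycle : SingChain.d 1 thetaCycle = 0 :=
  d_weightedChain_squareTuples isCycleCoeff_thetaCoeff isMatching_configSquare

theorem isResidue_thetaCycle :
    SingChain.IsResidue avoid₀ closest₀ avoid₁ closest₁ thetaCycle thetaResidue :=
  isResidue_weightedChain isCycleCoeff_thetaCoeff isMatching_configSquare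
    (fun j m l t h => configSquare_mem_avoid₀ j m l t (by linarith))
    (fun j m l t h => configSquare_mem_closest₀ j m l t h)
    (fun j m l t h => configSquare_mem_avoid₁ j m l t (by linarith))
    (fun j m l t h => configSquare_mem_closest₁ j m l t h)

/-- The configuration at `(1/4, 1/4)` in the square of `j, m, l` lies in the cell of `(j, m, l)`
and, the cells being disjoint, in no other. -/
theorem cellCount_thetaResidue (j m l : Fin 4) :
    cellCount thetaResidue j m l = thetaCoeff j m l := by
  classical
  have hpt : ∀ j m l, squareChain (configSquare j m l) 0 (Finsupp.single ![(1, 1)] 1) ∈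
      SingChain.inSet (cell ![j, m, l]) 0 := fun j m l => by
    have h1 : level 1 = 1 / 4 := rfl
    refine squareChain_mem (C := {x | x 0 = 1 / 4} ∩ {x | x 1 = 1 / 4})
      ((convex_coord_eq 0 _).inter (convex_coord_eq 1 _)) (fun t ht => ?_) (fun k => ?_)
    · have h0 : (t 0 : ℝ) = 1 / 4 := ht.1
      have h1 : (t 1 : ℝ) = 1 / 4 := ht.2
      exact configSquare_mem_cell j m l t (by rw [h0]; norm_num) h0.le (by rw [h1]; norm_num) h1.le
    · fin_cases k
      exact ⟨h1, h1⟩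
  have key : ∀ j' m' l', SingChain.countIn (cell ![j, m, l])
      (squareChain (configSquare j' m' l') 0 (Finsupp.single ![(1, 1)] 1)) =
        if j = j' ∧ m = m' ∧ l = l' then 1 else 0 := by
    intro j' m' l'
    have := hpt j' m' l'
    rw [squareChain_single] at this ⊢
    rw [SingChain.countIn_single]
    have hmem := (Finsupp.mem_supported _ _).1 this
      (Finsupp.mem_support_iff.2 (by rw [Finsupp.single_eq_same]; exact one_ne_zero))
    refine if_congr ⟨fun h => ?_, ?_⟩ rfl rfl
    · have := cell_disjoint _ _ ⟨_, h, hmem (SingChain.stdVertices 0 0)⟩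
      exact ⟨congrFun this 0, congrFun this 1, congrFun this 2⟩
    · rintro ⟨rfl, rfl, rfl⟩
      exact hmem (SingChain.stdVertices 0 0)
  rw [cellCount, thetaResidue, weightedChain_apply]
  simp only [map_sum, map_smul, key, ite_and, smul_eq_mul, mul_ite, mul_one, mul_zero]
  simp

theorem piece_eq {k₀ m₀ k₁ m₁ : Prop} {A : Set B₃}
    (h : ∀ x, x ∈ A ↔
      (k₀ → x ∈ avoid₀) ∧ (m₀ → x ∈ closest₀) ∧ (k₁ → x ∈ avoid₁) ∧ (m₁ → x ∈ closest₁)) :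
    A = piece k₀ m₀ k₁ m₁ := Set.ext h

/-- One relation for each triple intersection: dropping `closest₀` or `closest₁` gives antisymmetry,
dropping `avoid₀` or `avoid₁` a vanishing sum. -/
theorem isCycleCoeff_cellCount {z : SingChain B₃ 2} (hz : SingChain.d 1 z = 0) {u : SingChain B₃ 0}
    (h : SingChain.IsResidue avoid₀ closest₀ avoid₁ closest₁ z u) :
    u ∈ SingChain.inSet (piece True True True True) 0 ∧ IsCycleCoeff (cellCount u) := by
  obtain ⟨hu, h1, h2, h3, h4⟩ := h.bounds isOpen_avoid₀ isOpen_closest₀ isOpen_avoid₁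
    isOpen_closest₁ avoid_union_closest₁ hz
  rw [piece_eq (A := avoid₀ ∩ closest₀ ∩ (avoid₁ ∩ closest₁)) (k₀ := True) (m₀ := True) (k₁ := True)
    (m₁ := True) (by simp; tauto)] at hu
  rw [piece_eq (A := avoid₀ ∩ closest₀ ∩ avoid₁) (k₀ := True) (m₀ := True) (k₁ := True)
    (m₁ := False) (by simp; tauto)] at h1
  rw [piece_eq (A := avoid₀ ∩ closest₀ ∩ closest₁) (k₀ := True) (m₀ := True) (k₁ := False)
    (m₁ := True) (by simp; tauto)] at h2
  rw [piece_eq (A := avoid₀ ∩ (avoid₁ ∩ closest₁)) (k₀ := True) (m₀ := False) (k₁ := True)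
    (m₁ := True) (by simp)] at h3
  rw [piece_eq (A := closest₀ ∩ (avoid₁ ∩ closest₁)) (k₀ := False) (m₀ := True) (k₁ := True)
    (m₁ := True) (by simp)] at h4
  exact ⟨hu, fun j m l => (cellCount_swap₀ hu h3 j m l).2, fun j m l => (cellCount_swap₁ hu h1 j m l).2,
    fun m l => cellCount_sum₀ hu h4 m l, fun j m => cellCount_sum₁ hu h2 j m⟩

/-- Every two-dimensional cycle is homologous to a multiple of `thetaCycle`. -/
theorem exists_d_eq_sub_smul_thetaCycle {z : SingChain B₃ 2} (hz : SingChain.d 1 z = 0) :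
    ∃ (a : ℤ) (y : SingChain B₃ 3), SingChain.d 2 y = z - a • thetaCycle := by
  obtain ⟨u, hu⟩ := SingChain.exists_isResidue isOpen_avoid₀ isOpen_closest₀ isOpen_avoid₁
    isOpen_closest₁ avoid_union_closest₀ avoid_union_closest₁ hz
  obtain ⟨hmem, hc⟩ := isCycleCoeff_cellCount hz hu
  obtain ⟨hmem', -⟩ := isCycleCoeff_cellCount d_thetaCycle isResidue_thetaCycle
  refine ⟨-cellCount u 1 2 3, ?_⟩
  -- The residues of `z` and of this multiple of `thetaCycle` have equal counts on all cells, so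
  -- their difference bounds in the fourfold intersection.
  have hbound := exists_d_eq_of_countIn_cell
    (sub_mem hmem (Submodule.smul_mem _ (-cellCount u 1 2 3) hmem')) (fun ε => by
      have h1 := hc.eq_mul_thetaCoeff (ε 0) (ε 1) (ε 2)
      rw [← cellCount_thetaResidue] at h1
      rw [map_sub, map_smul, smul_eq_mul, eq_vec ε, sub_eq_zero]
      exact h1)
  have acyc : ∀ {k₀ m₀ k₁ m₁ : Prop} (n : ℕ) {A : Set B₃}, (k₀ ∨ m₀) → (k₁ ∨ m₁) → (∀ x, x ∈ A ↔
      (k₀ → x ∈ avoid₀) ∧ (m₀ → x ∈ closest₀) ∧ (k₁ → x ∈ avoid₁) ∧ (m₁ → x ∈ closest₁)) →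
      SingChain.AcyclicIn A n := fun n _ h₀ h₁ h => by
    rw [piece_eq h]
    exact acyclicIn_piece h₀ h₁ n
  rw [← piece_eq (A := avoid₀ ∩ closest₀ ∩ (avoid₁ ∩ closest₁)) (by simp; tauto)] at hbound
  have hd : SingChain.d 1 (z - (-cellCount u 1 2 3) • thetaCycle) = 0 := by
    rw [map_sub, map_smul, hz, d_thetaCycle, smul_zero, sub_zero]
  -- Each of the eight intersections involves a set from both covers, so each is an acyclic piece.
  refine SingChain.IsResidue.exists_d_eq isOpen_avoid₀ isOpen_closest₀ isOpen_avoid₁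
    isOpen_closest₁ avoid_union_closest₁
    (acyc (k₀ := True) (m₀ := False) (k₁ := True) (m₁ := False) 1 ?_ ?_ ?_)
    (acyc (k₀ := True) (m₀ := False) (k₁ := False) (m₁ := True) 1 ?_ ?_ ?_)
    (acyc (k₀ := True) (m₀ := False) (k₁ := True) (m₁ := True) 0 ?_ ?_ ?_)
    (acyc (k₀ := False) (m₀ := True) (k₁ := True) (m₁ := False) 1 ?_ ?_ ?_)
    (acyc (k₀ := False) (m₀ := True) (k₁ := False) (m₁ := True) 1 ?_ ?_ ?_)
    (acyc (k₀ := False) (m₀ := True) (k₁ := True) (m₁ := True) 0 ?_ ?_ ?_)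
    (acyc (k₀ := True) (m₀ := True) (k₁ := True) (m₁ := False) 0 ?_ ?_ ?_)
    (acyc (k₀ := True) (m₀ := True) (k₁ := False) (m₁ := True) 0 ?_ ?_ ?_)
    hd (hu.sub_smul isResidue_thetaCycle _) hbound
  all_goals simp
  all_goals tauto

/-! ### The realization of the chain -/

theorem realize_halfChain (c : Fin 4 → Fin 4 → Fin 4 → ℤ) :
    (theta 4).realize 2 3 (halfChain c) = ∑ j, ∑ l, ∑ m, c j m l •
      (halfState ![j, l]).cubeChain (Finsupp.single m 1) (degree_halfState _)
        (weight_add_degree _ m) := by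
  classical
  have hcoeff : ∀ j l m, (halfChain c (halfState ![j, l])).coeff (Finsupp.single m 1) = c j m l := by
    intro j l m
    rw [halfChain_apply, MvPolynomial.coeff_sum]
    simp only [MvPolynomial.coeff_C_mul, MvPolynomial.coeff_X, Finsupp.single_left_inj one_ne_zero]
    simp
  have hsupp : ∀ j l, (halfChain c (halfState ![j, l])).support ⊆
      Finset.univ.image fun m : Fin 4 => Finsupp.single m 1 := by
    intro j l e he
    rw [MvPolynomial.mem_support_iff, halfChain_apply, MvPolynomial.coeff_sum] at he
    obtain ⟨m, -, hm⟩ := Finset.exists_ne_zero_of_sum_ne_zero he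
    rw [MvPolynomial.coeff_C_mul, MvPolynomial.coeff_X] at hm
    refine Finset.mem_image.2 ⟨m, Finset.mem_univ _, ?_⟩
    by_contra h
    exact hm (by rw [if_neg h, mul_zero])
  have hsupp' : (halfChain c).support ⊆
      Finset.univ.image fun p : Fin 4 × Fin 4 => halfState ![p.1, p.2] := by
    intro s hs
    by_contra h
    refine Finsupp.mem_support_iff.1 hs (halfChain_apply_of_ne c fun j l hjl => h ?_)
    exact Finset.mem_image.2 ⟨(j, l), Finset.mem_univ _, hjl.symm⟩
  unfold realize
  -- The sums over supports are extended to all pairs of half-edges and all edges, as some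
  -- coefficients may vanish.
  rw [Finset.sum_subset hsupp' fun s _ hs => by rw [Finsupp.notMem_support_iff.1 hs]; simp,
    Finset.sum_image fun p _ q _ h => by
      obtain ⟨h1, h2⟩ := (halfState_inj _ _ _ _).1 h
      exact Prod.ext h1 h2, Fintype.sum_prod_type]
  refine Finset.sum_congr rfl fun j _ => Finset.sum_congr rfl fun l _ => ?_
  rw [Finset.sum_subset (hsupp j l) fun e _ he => by
      rw [MvPolynomial.notMem_support_iff.1 he, zero_smul],
    Finset.sum_image fun p _ q _ h => Finsupp.single_left_injective one_ne_zero h]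
  refine Finset.sum_congr rfl fun m _ => ?_
  rw [hcoeff, dif_pos ⟨degree_halfState _, weight_add_degree _ m⟩]

theorem orderIsoOfFin_symm_halfState (f : Fin 2 → Fin 4) (v : Fin 2)
    (hv : v ∈ (halfState f).active) :
    ((halfState f).active.orderIsoOfFin (degree_halfState f)).symm ⟨v, hv⟩ = v := by
  set φ := (halfState f).active.orderIsoOfFin (degree_halfState f)
  have hlt : (φ 0).1 < (φ 1).1 := φ.strictMono (by decide : (0 : Fin 2) < 1)
  have h0 : (φ 0).1 = 0 := by omega
  have h1 : (φ 1).1 = 1 := by omega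
  rw [OrderIso.symm_apply_eq]
  refine Subtype.ext ?_
  fin_cases v
  · exact h0.symm
  · exact h1.symm

/-- The two permutations of the two active vertices give the two triangles of the square; the tail
sums are the coordinates on the triangle along the first axis and then the second, and the
transposition gives the other triangle with a minus sign. -/
theorem cubeChain_halfState (j m l : Fin 4) :
    (halfState ![j, l]).cubeChain (Finsupp.single m 1) (degree_halfState _)
        (weight_add_degree _ m) =
      SingChain.toSingularChains 2 (squareChain (configSquare j m l) 2 squareTuples) := by
  have huniv : (Finset.univ : Finset (Equiv.Perm (Fin 2))) = {1, Equiv.swap 0 1} := by decide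
  have hl0 : level 0 = 0 := rfl
  have hl2 : level 2 = 1 := rfl
  have htail0 : ∀ x : StdSimp 2, (tailSum (0 : Fin 2) x : ℝ) = x 1 + x 2 := by
    intro x
    have hx := x.2.2
    have h0 := x.2.1 0
    have h1 := x.2.1 1
    have h2 := x.2.1 2
    rw [Fin.sum_univ_three] at hx
    have : ∑ j : Fin 3 with (0 : Fin 2).castSucc < j, x j = x 1 + x 2 := by
      rw [Finset.sum_filter, Fin.sum_univ_three]
      simp
    rw [tailSum, this, Set.coe_projIcc]
    have : (x : Fin 3 → ℝ) 0 + x 1 + x 2 = 1 := hx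
    have : 0 ≤ (x : Fin 3 → ℝ) 0 := h0
    have : 0 ≤ (x : Fin 3 → ℝ) 1 := h1
    have : 0 ≤ (x : Fin 3 → ℝ) 2 := h2
    change max 0 (min 1 ((x : Fin 3 → ℝ) 1 + (x : Fin 3 → ℝ) 2)) =
      (x : Fin 3 → ℝ) 1 + (x : Fin 3 → ℝ) 2
    rw [min_eq_right (by linarith), max_eq_right (by linarith)]
  have htail1 : ∀ x : StdSimp 2, (tailSum (1 : Fin 2) x : ℝ) = x 2 := by
    intro x
    have hx := x.2.2
    have h0 := x.2.1 0
    have h1 := x.2.1 1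
    have h2 := x.2.1 2
    rw [Fin.sum_univ_three] at hx
    have : ∑ j : Fin 3 with (1 : Fin 2).castSucc < j, x j = x 2 := by
      rw [Finset.sum_filter, Fin.sum_univ_three]
      simp
    rw [tailSum, this, Set.coe_projIcc]
    have : (x : Fin 3 → ℝ) 0 + x 1 + x 2 = 1 := hx
    have : 0 ≤ (x : Fin 3 → ℝ) 0 := h0
    have : 0 ≤ (x : Fin 3 → ℝ) 1 := h1
    have : 0 ≤ (x : Fin 3 → ℝ) 2 := h2
    change max 0 (min 1 ((x : Fin 3 → ℝ) 2)) = (x : Fin 3 → ℝ) 2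
    rw [min_eq_right (by linarith), max_eq_right (by linarith)]
  have hsimp : ∀ (π : Equiv.Perm (Fin 2)) (x : StdSimp 2) (v : Fin 2),
      (halfState ![j, l]).simplexInCube (degree_halfState _) π x v = tailSum (π.symm v) x := by
    intro π x v
    have hv : v ∈ (halfState ![j, l]).active := by
      rw [active_halfState]; exact Finset.mem_univ v
    change (if hv : v ∈ (halfState ![j, l]).active then _ else _) = _
    rw [dif_pos hv, orderIsoOfFin_symm_halfState]
  have hcoord : ∀ (g : Fin 3 → Fin 3 × Fin 3) (x : StdSimp 2) (v : Fin 2),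
      (squareMap (affineSimplex (convex_Icc (0 : Fin 2 → ℝ) 1) (gridPt ∘ g) x) v : ℝ) =
        ∑ k, x k * (gridPt (g k) : Fin 2 → ℝ) v := by
    intro g x v
    change (∑ k, x k • (gridPt (g k) : Fin 2 → ℝ)) v = _
    simp only [Finset.sum_apply, Pi.smul_apply, smul_eq_mul]
  have e1 : ((halfState ![j, l]).cube (Finsupp.single m 1) (weight_add_degree _ m)).comp
      ((halfState ![j, l]).simplexInCube (degree_halfState _) 1) =
        ((configSquare j m l).comp squareMap).comp (affineSimplex (convex_Icc (0 : Fin 2 → ℝ) 1)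
          (gridPt ∘ ![(0, 0), (2, 0), (2, 2)])) := by
    ext x
    refine congrArg (configSquare j m l) (funext fun v => Subtype.ext ?_)
    rw [hsimp, hcoord, Fin.sum_univ_three]
    fin_cases v
    · refine (htail0 x).trans ?_
      simp [gridPt, hl0, hl2]
    · refine (htail1 x).trans ?_
      simp [gridPt, hl0, hl2]
  have e2 : ((halfState ![j, l]).cube (Finsupp.single m 1) (weight_add_degree _ m)).comp
      ((halfState ![j, l]).simplexInCube (degree_halfState _) (Equiv.swap 0 1)) =
        ((configSquare j m l).comp squareMap).comp (affineSimplex (convex_Icc (0 : Fin 2 → ℝ) 1)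
          (gridPt ∘ ![(0, 0), (0, 2), (2, 2)])) := by
    ext x
    refine congrArg (configSquare j m l) (funext fun v => Subtype.ext ?_)
    rw [hsimp, hcoord, Fin.sum_univ_three]
    fin_cases v
    · refine (htail1 x).trans ?_
      simp [gridPt, hl0, hl2]
    · refine (htail0 x).trans ?_
      simp [gridPt, hl0, hl2]
  rw [State.cubeChain, huniv, Finset.sum_pair (by decide), e1, e2, squareTuples, map_sub, map_sub,
    squareChain_single, squareChain_single, SingChain.toSingularChains_single,
    SingChain.toSingularChains_single, Equiv.Perm.sign_one, Equiv.Perm.sign_swap (by decide),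
    sub_eq_add_neg]
  refine congrArg₂ (· + ·) (one_zsmul _) ?_
  exact (neg_one_zsmul _)

theorem realize_thetaChain :
    (theta 4).realize 2 3 thetaChain = SingChain.toSingularChains 2 thetaCycle := by
  rw [thetaChain_eq, realize_halfChain, thetaCycle, weightedChain_apply, map_sum]
  refine Finset.sum_congr rfl fun j _ => ?_
  rw [Finset.sum_comm, map_sum]
  refine Finset.sum_congr rfl fun m _ => ?_
  rw [map_sum]
  refine Finset.sum_congr rfl fun l _ => ?_
  rw [cubeChain_halfState]
  exact (map_zsmul _ _ _).symm

end Theta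

end

/-! ### The main theorem -/

theorem lemma3p12 :
    -- `A_2` is a cycle of degree `2` and weight `3` in the reduced Świątkowski complex
    ∃ hA : MultiGraph.thetaChain ∈ (MultiGraph.theta 4).reducedCycles 2 3,
      -- its class generates the homology of this complex in degree `2` and weight `3`
      Submodule.span ℤ {(MultiGraph.theta 4).reducedClass 2 3 ⟨MultiGraph.thetaChain, hA⟩} = ⊤ ∧
      -- the class that it represents in singular homology generates `H_2(B_3(Θ_4))`
      ∃ z : (singularChains (UnorderedConf 3 (MultiGraph.theta 4).Space)).cycles 2,
        (singularChains (UnorderedConf 3 (MultiGraph.theta 4).Space)).iCycles 2 z =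
          (MultiGraph.theta 4).realize 2 3 MultiGraph.thetaChain ∧
        Submodule.span ℤ
            {(singularChains (UnorderedConf 3 (MultiGraph.theta 4).Space)).homologyπ 2 z} =
          (⊤ : Submodule ℤ (singularHomology 2 (UnorderedConf 3 (MultiGraph.theta 4).Space))) := by
  obtain ⟨z, hz⟩ := SingChain.exists_cycles_eq Theta.d_thetaCycle
  exact ⟨Theta.thetaChain_mem_reducedCycles, Theta.span_reducedClass_thetaChain _, z,
    hz.trans Theta.realize_thetaChain.symm,
    SingChain.span_homologyπ_eq_top (fun _ => Theta.exists_d_eq_sub_smul_thetaCycle) hz⟩
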